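/- For a finite simple bipartite graph $G=(A\cup B,E)$ with $|A|=n$, and $S\subseteq B$, let $N(S)\subseteq A$ be the set of vertices with a neighbour in $S$. In the problem 2PM one has to choose $S\subseteq B$ and $W\subseteq A$ such that $G$ has a matching between $W$ and $B\setminus S$ that covers every vertex of $W$, so as to maximize $|N(S)\cap W|$; in 2PPM one has to choose $S\subseteq B$ such that $G$ has a matching between $A$ and $B\setminus S$ that covers every vertex of $A$, so as to maximize $|N(S)|$. Let $\mathrm{OPT}_{2PM}$ and $\mathrm{OPT}_{2PPM}$ be the optimal values. An instance is $(3,2)$-regular if every vertex of $A$ has degree $3$ and every vertex of $B$ has degree $2$. **Theorem.** There is a (deterministic) polynomial-time algorithm that is a $9/10$-approximation algorithm for $(3,2)$-regular 2PM: given a $(3,2)$-regular instance $G$, it outputs a feasible solution $(S,W)$ of 2PM with $|N(S)\cap W|\ge \tfrac{9}{10}\,\mathrm{OPT}_{2PM}$. Moreover, its output satisfies $W=A$, and $S$ is an optimal solution of 2PPM on $G$, that is, $S$ is feasible for 2PPM and $|N(S)|=\mathrm{OPT}_{2PPM}$; and $\mathrm{OPT}_{2PPM}\ge \tfrac{9}{10}n\ge\tfrac{9}{10}\,\mathrm{OPT}_{2PM}$.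 -/

import Mathlib

namespace TwoPM

/-! ### Bipartite graphs, second-price matching and second-price perfect matching -/

/-- A finite simple bipartite graph with ordered parts `A = Fin n` and `B = Fin m`. -/
structure BipGraph (n m : ℕ) where
  adj : Fin n → Fin m → Bool

namespace BipGraph

variable {n m : ℕ}

/-- Every vertex of `A` has degree `d` and every vertex of `B` has degree `e`. -/
def IsBiregular (G : BipGraph n m) (d e : ℕ) : Prop :=
  (∀ a, (Finset.univ.filter fun b => G.adj a b = true).card = d) ∧
    ∀ b, (Finset.univ.filter fun a => G.adj a b = true).card = e

/-- The neighbourhood `N(S) ⊆ A` of a set `S ⊆ B`. -/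
def nbhd (G : BipGraph n m) (S : Finset (Fin m)) : Finset (Fin n) :=
  Finset.univ.filter fun a => ∃ b ∈ S, G.adj a b = true

/-- `(S, W)` is feasible for 2PM: some matching between `W` and `B \ S` covers all of `W`
(`M a` is the partner of `a ∈ W`; the values of `M` outside `W` are irrelevant). -/
def Feasible2PM (G : BipGraph n m) (S : Finset (Fin m)) (W : Finset (Fin n)) : Prop :=
  ∃ M : Fin n → Fin m,
    Set.InjOn M (W : Set (Fin n)) ∧ ∀ a ∈ W, G.adj a (M a) = true ∧ M a ∉ S

/-- The objective value of `(S, W)` for 2PM. -/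
def value2PM (G : BipGraph n m) (S : Finset (Fin m)) (W : Finset (Fin n)) : ℕ :=
  (G.nbhd S ∩ W).card

/-- The optimal value of 2PM. The set is non-empty, as it contains the value of `(∅, ∅)`,
and bounded by `n`. -/
noncomputable def opt2PM (G : BipGraph n m) : ℕ :=
  sSup {k | ∃ S W, G.Feasible2PM S W ∧ k = G.value2PM S W}

/-- `S` is feasible for 2PPM: some matching between `A` and `B \ S` covers all of `A`. -/
def Feasible2PPM (G : BipGraph n m) (S : Finset (Fin m)) : Prop :=
  ∃ M : Fin n → Fin m, Function.Injective M ∧ ∀ a, G.adj a (M a) = true ∧ M a ∉ S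

/-- The objective value of `S` for 2PPM. -/
def value2PPM (G : BipGraph n m) (S : Finset (Fin m)) : ℕ :=
  (G.nbhd S).card

/-- The optimal value of 2PPM. The set is bounded by `n`. -/
noncomputable def opt2PPM (G : BipGraph n m) : ℕ :=
  sSup {k | ∃ S, G.Feasible2PPM S ∧ k = G.value2PPM S}

/-- The input list of an instance: `n`, `m`, and the `n × m` adjacency matrix row by row. -/
def encode (G : BipGraph n m) : List ℕ :=
  n :: m :: List.ofFn fun k : Fin (n * m) => (G.adj k.divNat k.modNat).toNat

end BipGraph

/-- The 0/1 indicator list of a subset of `Fin k`. -/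
def indicator {k : ℕ} (S : Finset (Fin k)) : List ℕ :=
  List.ofFn fun i : Fin k => if i ∈ S then 1 else 0

/-- The output list of a pair `(S, W)`: the indicator of `S` followed by that of `W`. -/
def encodeSolution {n m : ℕ} (S : Finset (Fin m)) (W : Finset (Fin n)) : List ℕ :=
  indicator S ++ indicator W

/-! ### Random-access machine programs with running times

Programs act on scalar registers and on arrays of natural numbers. A fixed program mentions
finitely many registers and arrays only. The arithmetic is addition, truncated subtraction
and comparison, and every operation takes one unit of time. As there is no multiplication,
numbers gain at most a constant number of bits per step, and polynomial time for these
programs is polynomial time on Turing machines. -/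

/-- A memory state: registers `reg x` and array cells `arr a i`. -/
structure State where
  reg : ℕ → ℕ
  arr : ℕ → ℕ → ℕ

/-- Expressions; `get a i` is the `i`-th cell of the array `a`. -/
inductive Expr where
  | const (k : ℕ)
  | var (x : ℕ)
  | get (a : ℕ) (i : Expr)
  | add (e f : Expr)
  | sub (e f : Expr)
  | eq (e f : Expr)
  | lt (e f : Expr)

/-- The value of an expression; truth values are `1` and `0`. -/
def Expr.eval (s : State) : Expr → ℕ
  | .const k => k
  | .var x => s.reg x
  | .get a i => s.arr a (i.eval s)
  | .add e f => e.eval s + f.eval s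
  | .sub e f => e.eval s - f.eval s
  | .eq e f => if e.eval s = f.eval s then 1 else 0
  | .lt e f => if e.eval s < f.eval s then 1 else 0

/-- The time for evaluating an expression: one unit per operation. -/
def Expr.cost : Expr → ℕ
  | .const _ => 1
  | .var _ => 1
  | .get _ i => i.cost + 1
  | .add e f => e.cost + f.cost + 1
  | .sub e f => e.cost + f.cost + 1
  | .eq e f => e.cost + f.cost + 1
  | .lt e f => e.cost + f.cost + 1

/-- Programs. `loop e c` repeats `c` as long as `e` is non-zero. -/
inductive Prog where
  | skip
  | assign (x : ℕ) (e : Expr)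
  | store (a : ℕ) (i e : Expr)
  | seq (c d : Prog)
  | ite (e : Expr) (c d : Prog)
  | loop (e : Expr) (c : Prog)

/-- The state after writing `v` to register `x`. -/
def State.setReg (s : State) (x v : ℕ) : State :=
  { s with reg := Function.update s.reg x v }

/-- The state after writing `v` to cell `i` of array `a`. -/
def State.setArr (s : State) (a i v : ℕ) : State :=
  { s with arr := Function.update s.arr a (Function.update (s.arr a) i v) }

/-- `Exec c s s' t`: started in state `s`, the program `c` halts in state `s'` after time
exactly `t`. -/
inductive Exec : Prog → State → State → ℕ → Prop where
  | skip (s : State) : Exec .skip s s 1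
  | assign (x : ℕ) (e : Expr) (s : State) :
      Exec (.assign x e) s (s.setReg x (e.eval s)) (e.cost + 1)
  | store (a : ℕ) (i e : Expr) (s : State) :
      Exec (.store a i e) s (s.setArr a (i.eval s) (e.eval s)) (i.cost + e.cost + 1)
  | seq {c d : Prog} {s s' s'' : State} {t t' : ℕ} :
      Exec c s s' t → Exec d s' s'' t' → Exec (.seq c d) s s'' (t + t')
  | iteTrue {e : Expr} {c d : Prog} {s s' : State} {t : ℕ} :
      e.eval s ≠ 0 → Exec c s s' t → Exec (.ite e c d) s s' (e.cost + 1 + t)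
  | iteFalse {e : Expr} {c d : Prog} {s s' : State} {t : ℕ} :
      e.eval s = 0 → Exec d s s' t → Exec (.ite e c d) s s' (e.cost + 1 + t)
  | loopDone {e : Expr} {c : Prog} {s : State} :
      e.eval s = 0 → Exec (.loop e c) s s (e.cost + 1)
  | loopStep {e : Expr} {c : Prog} {s s' s'' : State} {t t' : ℕ} :
      e.eval s ≠ 0 → Exec c s s' t → Exec (.loop e c) s' s'' t' →
        Exec (.loop e c) s s'' (e.cost + 1 + t + t')

/-- Programs are deterministic: final state and running time depend only on the start. -/
theorem Exec.deterministic {c : Prog} {s s₁ s₂ : State} {t₁ t₂ : ℕ}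
    (h₁ : Exec c s s₁ t₁) (h₂ : Exec c s s₂ t₂) : s₁ = s₂ ∧ t₁ = t₂ := by
  induction h₁ generalizing s₂ t₂ with
  | skip => cases h₂; exact ⟨rfl, rfl⟩
  | assign => cases h₂; exact ⟨rfl, rfl⟩
  | store => cases h₂; exact ⟨rfl, rfl⟩
  | seq _ _ ih ih' =>
    cases h₂ with
    | seq k k' =>
      obtain ⟨rfl, rfl⟩ := ih k
      obtain ⟨rfl, rfl⟩ := ih' k'
      exact ⟨rfl, rfl⟩
  | iteTrue h _ ih =>
    cases h₂ with
    | iteTrue _ k => obtain ⟨rfl, rfl⟩ := ih k; exact ⟨rfl, rfl⟩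
    | iteFalse h' _ => exact absurd h' h
  | iteFalse h _ ih =>
    cases h₂ with
    | iteTrue h' _ => exact absurd h h'
    | iteFalse _ k => obtain ⟨rfl, rfl⟩ := ih k; exact ⟨rfl, rfl⟩
  | loopDone h =>
    cases h₂ with
    | loopDone => exact ⟨rfl, rfl⟩
    | loopStep h' => exact absurd h h'
  | loopStep h _ _ ih ih' =>
    cases h₂ with
    | loopDone h' => exact absurd h' h
    | loopStep _ k k' =>
      obtain ⟨rfl, rfl⟩ := ih k
      obtain ⟨rfl, rfl⟩ := ih' k'
      exact ⟨rfl, rfl⟩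

/-- The initial state: the input list is in array `0`, its length in register `0`, and all
other registers and cells are `0`. -/
def State.init (l : List ℕ) : State where
  reg x := if x = 0 then l.length else 0
  arr a i := if a = 0 then l.getD i 0 else 0

/-- The output list of a state: the first `reg 1` cells of array `1`. -/
def State.output (s : State) : List ℕ :=
  (List.range (s.reg 1)).map (s.arr 1)

/-- On input `inp`, the program `p` halts within time `T` with output `out`. -/
def OutputsWithin (p : Prog) (inp out : List ℕ) (T : ℕ) : Prop :=
  ∃ s t, Exec p (State.init inp) s t ∧ t ≤ T ∧ s.output = out

/-- The size of an input list: the total number of binary digits of its entries, plus one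
separator for each entry. -/
def inputSize (l : List ℕ) : ℕ :=
  (l.map fun a => a.size + 1).sum

end TwoPM

namespace TwoPM

/-! ### Programs with counting loops -/

/-! Read `A` as the vertices and `B` as the edges of a loopless cubic multigraph, so `3 * n = 2 *
m`. Then N(S) is the set of vertices covered by the edge set S, and S is feasible for 2PPM exactly
when every vertex can be given an incident edge outside S of its own (`Saturable`). Let ν be the
largest size of a matching in this multigraph.

Upper bound. A feasible S has at most m - n = n/2 edges. Adding the edges of S one at a time, those
that cover two new vertices form a matching, so |N(S)| ≤ |S| + ν ≤ n/2 + ν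
(`exists_matching_card_ends_le`).

The bound is attained. Let S start as a maximum matching, which covers 2ν vertices. Each vertex
keeps two edges outside S, so Hall's condition holds (`IsMatching.saturable_compl`). As long as more
than n edges lie outside S, stripping vertices of degree one from the graph of these edges leaves a
vertex of degree three. No edge of S meets it, and moving one of its edges into S keeps S feasible
(`Peeling.saturable_erase`). Each such edge covers a new vertex, and when none is left |S| = m - n
(`Peeling.card_eq`), so |N(S)| ≥ ν + n/2.

The ratio. An alternating forest that cannot be extended has as many outer blossoms as inner
vertices and exposed vertices together. Outer blossoms are odd, and every edge leaving one ends in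
an inner vertex. This makes the matching maximum (`Forest.card_le`). In a cubic graph odd sets have
odd cuts, and counting edges at inner vertices leaves at most n/5 vertices exposed
(`Forest.five_mul_exposed_le`). Hence ν ≥ 2n/5 and the optimum of 2PPM is at least 9n/10, whereas
2PM never exceeds n.

The maximum matching. Edmonds' search is used only to decide whether a larger matching exists. No
augmenting path is ever unfolded: factor-critical blossoms show that a larger matching exists
(`Climb.augment`). Edges outside the current matching M are then deleted while a larger matching
survives. The surviving ones lie in every larger matching, and exchanging them against the edges of
M that they meet enlarges M (`exchanged_spec`).

Running time. All loops are counting loops capped by register `0`, the input length, so the time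
bound is polynomial by the syntax alone (`Cmd.exists_exec`). A loop that should run until some goal
is reached runs that many rounds instead, and a bounded potential shows that the goal is reached in
time. -/

@[simp] theorem State.setReg_arr (s : State) (x v : ℕ) : (s.setReg x v).arr = s.arr := rfl

@[simp] theorem State.setArr_reg (s : State) (a i v : ℕ) : (s.setArr a i v).reg = s.reg := rfl

@[simp] theorem State.setReg_reg_self (s : State) (x v : ℕ) : (s.setReg x v).reg x = v := by
  simp [State.setReg]

theorem State.setReg_reg_of_ne (s : State) {x y : ℕ} (v : ℕ) (h : y ≠ x) :
    (s.setReg x v).reg y = s.reg y := by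
  simp [State.setReg, Function.update_of_ne h]

theorem State.setReg_reg (s : State) (x v y : ℕ) :
    (s.setReg x v).reg y = if y = x then v else s.reg y := by
  simp [State.setReg, Function.update_apply]

theorem State.setArr_arr (s : State) (a i v b : ℕ) :
    (s.setArr a i v).arr b = if b = a then Function.update (s.arr a) i v else s.arr b := by
  simp [State.setArr, Function.update_apply]

theorem State.setArr_arr_of_ne (s : State) {a b : ℕ} (i v : ℕ) (h : b ≠ a) :
    (s.setArr a i v).arr b = s.arr b := by
  simp [State.setArr, Function.update_of_ne h]

/-- Commands in which the only iteration is a counting loop. `loop x k c` runs `c` for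
`x = 0, 1, …` below the minimum of the registers `k` and `0`. -/
inductive Cmd where
  | skip
  | assign (x : ℕ) (e : Expr)
  | store (a : ℕ) (i e : Expr)
  | seq (c d : Cmd)
  | ite (e : Expr) (c d : Cmd)
  | loop (x k : ℕ) (c : Cmd)

namespace Cmd

/-- The guard of a counting loop: `x` is below both `k` and register `0`. -/
def guard (x k : ℕ) : Expr :=
  .lt (.const 1) (.add (.lt (.var x) (.var k)) (.lt (.var x) (.var 0)))

/-- Increment of a register. -/
def incr (x : ℕ) : Prog := .assign x (.add (.var x) (.const 1))

/-- Translation to programs. -/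
def toProg : Cmd → Prog
  | skip => .skip
  | assign x e => .assign x e
  | store a i e => .store a i e
  | seq c d => .seq c.toProg d.toProg
  | ite e c d => .ite e c.toProg d.toProg
  | loop x k c => .seq (.assign x (.const 0)) (.loop (guard x k) (.seq c.toProg (incr x)))

/-- The state after running a command. -/
def run : Cmd → State → State
  | skip, s => s
  | assign x e, s => s.setReg x (e.eval s)
  | store a i e, s => s.setArr a (i.eval s) (e.eval s)
  | seq c d, s => d.run (c.run s)
  | ite e c d, s => if e.eval s = 0 then d.run s else c.run s
  | loop x k c, s =>
    (fun s => (c.run s).setReg x ((c.run s).reg x + 1))^[min (s.reg k) (s.reg 0)] (s.setReg x 0)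

theorem run_skip (s : State) : skip.run s = s := rfl

theorem run_assign (x : ℕ) (e : Expr) (s : State) :
    (assign x e).run s = s.setReg x (e.eval s) := rfl

theorem run_store (a : ℕ) (i e : Expr) (s : State) :
    (store a i e).run s = s.setArr a (i.eval s) (e.eval s) := rfl

theorem run_seq (c d : Cmd) (s : State) : (seq c d).run s = d.run (c.run s) := rfl

theorem run_ite (e : Expr) (c d : Cmd) (s : State) :
    (ite e c d).run s = if e.eval s = 0 then d.run s else c.run s := rfl

/-- Whether a command may write the register `r`. -/
def setsReg : Cmd → ℕ → Bool
  | skip, _ => false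
  | assign x _, r => r == x
  | store _ _ _, _ => false
  | seq c d, r => c.setsReg r || d.setsReg r
  | ite _ c d, r => c.setsReg r || d.setsReg r
  | loop x _ c, r => r == x || c.setsReg r

/-- Whether a command may write the array `b`. -/
def setsArr : Cmd → ℕ → Bool
  | skip, _ => false
  | assign _ _, _ => false
  | store a _ _, b => b == a
  | seq c d, b => c.setsArr b || d.setsArr b
  | ite _ c d, b => c.setsArr b || d.setsArr b
  | loop _ _ c, b => c.setsArr b

/-- Loop bodies write neither their counter nor their bound, and register `0` is not
written. -/
def wf : Cmd → Bool
  | skip => true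
  | assign x _ => x != 0
  | store _ _ _ => true
  | seq c d => c.wf && d.wf
  | ite _ c d => c.wf && d.wf
  | loop x k c => x != 0 && x != k && !c.setsReg x && !c.setsReg k && c.wf

/-- A bound on the running time in terms of register `0`. -/
noncomputable def time : Cmd → Polynomial ℕ
  | skip => 1
  | assign _ e => (e.cost + 1 : ℕ)
  | store _ i e => (i.cost + e.cost + 1 : ℕ)
  | seq c d => c.time + d.time
  | ite e c d => (e.cost + 1 : ℕ) + c.time + d.time
  -- A passed guard costs 10 and the increment 4, giving 14 per round. The failing guard at the end
  -- costs 10 and setting the counter to zero costs 2, giving 12.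
  | loop _ _ c => 12 + Polynomial.X * (c.time + 14)

/-- Frame rule. The condition is Boolean, so `rfl` settles it for every concrete program below. -/
theorem run_reg (c : Cmd) {r : ℕ} (h : c.setsReg r = false) (s : State) :
    (c.run s).reg r = s.reg r := by
  induction c generalizing s with
  | skip => rfl
  | assign x e =>
    simp only [setsReg, beq_eq_false_iff_ne] at h
    exact State.setReg_reg_of_ne _ _ h
  | store a i e => rfl
  | seq c d ihc ihd =>
    simp only [setsReg, Bool.or_eq_false_iff] at h
    simp only [run, ihd h.2, ihc h.1]
  | ite e c d ihc ihd =>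
    simp only [setsReg, Bool.or_eq_false_iff] at h
    simp only [run]
    split_ifs
    · exact ihd h.2 s
    · exact ihc h.1 s
  | loop x k c ih =>
    simp only [setsReg, Bool.or_eq_false_iff, beq_eq_false_iff_ne] at h
    simp only [run]
    generalize min (s.reg k) (s.reg 0) = N
    induction N with
    | zero => exact State.setReg_reg_of_ne _ _ h.1
    | succ N ihN =>
      rw [Function.iterate_succ_apply', State.setReg_reg_of_ne _ _ h.1, ih h.2, ihN]

theorem run_arr (c : Cmd) {b : ℕ} (h : c.setsArr b = false) (s : State) :
    (c.run s).arr b = s.arr b := by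
  induction c generalizing s with
  | skip => rfl
  | assign x e => rfl
  | store a i e =>
    simp only [setsArr, beq_eq_false_iff_ne] at h
    exact State.setArr_arr_of_ne _ _ _ h
  | seq c d ihc ihd =>
    simp only [setsArr, Bool.or_eq_false_iff] at h
    simp only [run, ihd h.2, ihc h.1]
  | ite e c d ihc ihd =>
    simp only [setsArr, Bool.or_eq_false_iff] at h
    simp only [run]
    split_ifs
    · exact ihd h.2 s
    · exact ihc h.1 s
  | loop x k c ih =>
    simp only [setsArr] at h
    simp only [run]
    generalize min (s.reg k) (s.reg 0) = N
    induction N with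
    | zero => rfl
    | succ N ihN =>
      rw [Function.iterate_succ_apply', State.setReg_arr, ih h, ihN]

theorem setsReg_zero_of_wf (c : Cmd) (h : c.wf = true) : c.setsReg 0 = false := by
  induction c with
  | skip => rfl
  | assign x e =>
    simp only [wf, bne_iff_ne] at h
    simp only [setsReg, beq_eq_false_iff_ne]
    exact Ne.symm h
  | store a i e => rfl
  | seq c d ihc ihd =>
    simp only [wf, Bool.and_eq_true] at h
    simp [setsReg, ihc h.1, ihd h.2]
  | ite e c d ihc ihd =>
    simp only [wf, Bool.and_eq_true] at h
    simp [setsReg, ihc h.1, ihd h.2]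
  | loop x k c ih =>
    simp only [wf, Bool.and_eq_true, bne_iff_ne] at h
    simp only [setsReg, Bool.or_eq_false_iff, beq_eq_false_iff_ne]
    exact ⟨Ne.symm h.1.1.1.1, ih h.2⟩

theorem guard_eval_ne_zero {x k : ℕ} {s : State} :
    (guard x k).eval s ≠ 0 ↔ s.reg x < min (s.reg k) (s.reg 0) := by
  simp only [guard, Expr.eval, lt_min_iff]
  by_cases h1 : s.reg x < s.reg k <;> by_cases h2 : s.reg x < s.reg 0 <;> simp [h1, h2]

/-- Commands run in polynomial time. -/
theorem exists_exec (c : Cmd) (h : c.wf = true) (s : State) :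
    ∃ t ≤ c.time.eval (s.reg 0), Exec c.toProg s (c.run s) t := by
  induction c generalizing s with
  | skip => exact ⟨1, by simp [time], .skip s⟩
  | assign x e => exact ⟨_, by simp [time], .assign x e s⟩
  | store a i e => exact ⟨_, by simp [time], .store a i e s⟩
  | seq c d ihc ihd =>
    simp only [wf, Bool.and_eq_true] at h
    obtain ⟨t, ht, et⟩ := ihc h.1 s
    obtain ⟨u, hu, eu⟩ := ihd h.2 (c.run s)
    rw [run_reg c (setsReg_zero_of_wf c h.1)] at hu
    exact ⟨t + u, by simpa [time] using add_le_add ht hu, .seq et eu⟩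
  | ite e c d ihc ihd =>
    simp only [wf, Bool.and_eq_true] at h
    by_cases he : e.eval s = 0
    · obtain ⟨t, ht, et⟩ := ihd h.2 s
      refine ⟨_, ?_, by simpa [run, he, toProg] using Exec.iteFalse he et⟩
      simp only [time, Polynomial.eval_add, Polynomial.eval_natCast, Nat.cast_id]
      omega
    · obtain ⟨t, ht, et⟩ := ihc h.1 s
      refine ⟨_, ?_, by simpa [run, he, toProg] using Exec.iteTrue he et⟩
      simp only [time, Polynomial.eval_add, Polynomial.eval_natCast, Nat.cast_id]
      omega
  | loop x k c ih =>
    simp only [wf, Bool.and_eq_true, bne_iff_ne, Bool.not_eq_true'] at h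
    obtain ⟨⟨⟨⟨hx0, hxk⟩, hcx⟩, hck⟩, hc⟩ := h
    -- Induction on the number `j` of remaining rounds. The body writes neither the counter, nor its
    -- bound, nor register `0`, so one round lowers `j` by exactly one and the time bound of the
    -- body is the same in all rounds.
    have key : ∀ (j : ℕ) (s : State), s.reg x + j = min (s.reg k) (s.reg 0) →
        ∃ t ≤ j * (c.time.eval (s.reg 0) + 14) + 10,
          Exec (.loop (guard x k) (.seq c.toProg (incr x))) s
            ((fun s => (c.run s).setReg x ((c.run s).reg x + 1))^[j] s) t := by
      intro j
      induction j with
      | zero =>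
        intro s hs
        refine ⟨_, ?_, .loopDone ?_⟩
        · simp [guard, Expr.cost]
        · by_contra hne
          have := guard_eval_ne_zero.1 hne
          omega
      | succ j ihj =>
        intro s hs
        obtain ⟨t, ht, et⟩ := ih hc s
        set s₁ := c.run s with hs₁
        set s₂ := s₁.setReg x (s₁.reg x + 1) with hs₂
        have e0 : s₂.reg 0 = s.reg 0 := by
          rw [hs₂, State.setReg_reg_of_ne _ _ (Ne.symm hx0), hs₁,
            run_reg c (setsReg_zero_of_wf c hc)]
        have ek : s₂.reg k = s.reg k := by
          rw [hs₂, State.setReg_reg_of_ne _ _ (Ne.symm hxk), hs₁, run_reg c hck]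
        have ex : s₂.reg x = s.reg x + 1 := by
          rw [hs₂, State.setReg_reg_self, hs₁, run_reg c hcx]
        obtain ⟨u, hu, eu⟩ := ihj s₂ (by rw [e0, ek, ex]; omega)
        refine ⟨_, ?_, .loopStep (guard_eval_ne_zero.2 (by omega))
          (.seq et (.assign x _ s₁)) eu⟩
        rw [e0] at hu
        simp only [guard, Expr.cost]
        rw [Nat.succ_mul]
        omega
    obtain ⟨t, ht, et⟩ := key (min (s.reg k) (s.reg 0)) (s.setReg x 0) (by
      rw [State.setReg_reg_self, State.setReg_reg_of_ne _ _ (Ne.symm hx0),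
        State.setReg_reg_of_ne _ _ (Ne.symm hxk), zero_add])
    refine ⟨_, ?_, .seq (.assign x (.const 0) s) et⟩
    rw [State.setReg_reg_of_ne _ _ (Ne.symm hx0)] at ht
    have hm := Nat.mul_le_mul_right (c.time.eval (s.reg 0) + 14)
      (min_le_right (s.reg k) (s.reg 0))
    simp only [time, Expr.cost, Polynomial.eval_add, Polynomial.eval_mul, Polynomial.eval_X,
      Polynomial.eval_ofNat]
    omega

/-- The invariant rule for counting loops. -/
theorem run_loop {x k : ℕ} {c : Cmd} (hw : (loop x k c).wf = true) (s : State)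
    (P : ℕ → State → Prop) (h0 : P 0 (s.setReg x 0))
    (hs : ∀ i < min (s.reg k) (s.reg 0), ∀ s' : State, s'.reg x = i →
      (∀ r, (loop x k c).setsReg r = false → s'.reg r = s.reg r) →
      (∀ b, (loop x k c).setsArr b = false → s'.arr b = s.arr b) →
      P i s' → P (i + 1) ((c.run s').setReg x (i + 1))) :
    P (min (s.reg k) (s.reg 0)) ((loop x k c).run s) := by
  simp only [wf, Bool.and_eq_true, bne_iff_ne, Bool.not_eq_true'] at hw
  obtain ⟨⟨⟨⟨hx0, hxk⟩, hcx⟩, hck⟩, hc⟩ := hw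
  simp only [run]
  set N := min (s.reg k) (s.reg 0)
  set f : State → State := fun s => (c.run s).setReg x ((c.run s).reg x + 1) with hf
  have key : ∀ i ≤ N, (f^[i] (s.setReg x 0)).reg x = i ∧
      (∀ r, (loop x k c).setsReg r = false → (f^[i] (s.setReg x 0)).reg r = s.reg r) ∧
      (∀ b, (loop x k c).setsArr b = false → (f^[i] (s.setReg x 0)).arr b = s.arr b) ∧
      P i (f^[i] (s.setReg x 0)) := by
    intro i
    induction i with
    | zero =>
      intro _
      refine ⟨by simp, fun r hr => ?_, fun b _ => by simp, h0⟩
      simp only [setsReg, Bool.or_eq_false_iff, beq_eq_false_iff_ne] at hr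
      exact State.setReg_reg_of_ne _ _ hr.1
    | succ i ih =>
      intro hi
      obtain ⟨h1, h2, h3, h4⟩ := ih (by omega)
      rw [Function.iterate_succ_apply']
      set s' := f^[i] (s.setReg x 0)
      have e : f s' = (c.run s').setReg x (i + 1) := by
        simp only [hf, run_reg c hcx, h1]
      rw [e]
      refine ⟨by simp, fun r hr => ?_, fun b hb => ?_, hs i (by omega) s' h1 h2 h3 h4⟩
      · rw [← h2 r hr]
        simp only [setsReg, Bool.or_eq_false_iff, beq_eq_false_iff_ne] at hr
        rw [State.setReg_reg_of_ne _ _ hr.1, run_reg c hr.2]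
      · rw [State.setReg_arr, ← h3 b hb]
        exact run_arr c hb s'
  exact (key N le_rfl).2.2.2

end Cmd

attribute [simp] Cmd.run_skip Cmd.run_assign Cmd.run_store Cmd.run_seq Cmd.run_ite Expr.eval
  State.setReg_reg State.setArr_arr

end TwoPM

namespace TwoPM

/-! ### Perfectly matched sets, factor-critical sets and matchings -/

section Matched

variable {adj : ℕ → ℕ → Prop}

/-- The set splits into pairs of adjacent vertices. -/
inductive PerfectlyMatched (adj : ℕ → ℕ → Prop) : Finset ℕ → Prop
  | empty : PerfectlyMatched adj ∅
  | pair {U : Finset ℕ} {a b : ℕ} : PerfectlyMatched adj U → adj a b → a ≠ b → a ∉ U → b ∉ U →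
      PerfectlyMatched adj (insert a (insert b U))

theorem PerfectlyMatched.union {U V : Finset ℕ} (hU : PerfectlyMatched adj U)
    (hV : PerfectlyMatched adj V) (h : Disjoint U V) : PerfectlyMatched adj (U ∪ V) := by
  induction hU with
  | empty => simpa using hV
  | pair _ hab hne ha hb ih =>
    simp only [Finset.disjoint_insert_left] at h
    rw [Finset.insert_union, Finset.insert_union]
    exact .pair (ih h.2.2) hab hne (by simp [ha, h.1]) (by simp [hb, h.2.1])

theorem PerfectlyMatched.even_card {U : Finset ℕ} (hU : PerfectlyMatched adj U) :
    Even U.card := by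
  induction hU with
  | empty => simp
  | pair _ _ hne ha hb ih =>
    rw [Finset.card_insert_of_notMem (by simp [hne, ha]), Finset.card_insert_of_notMem hb]
    obtain ⟨k, hk⟩ := ih
    exact ⟨k + 1, by omega⟩

/-- A set closed under a fixed-point free adjacent involution is perfectly matched. -/
theorem PerfectlyMatched.of_involution {mate : ℕ → ℕ} (U : Finset ℕ)
    (h : ∀ v ∈ U, mate v ∈ U ∧ mate (mate v) = v ∧ mate v ≠ v ∧ adj v (mate v)) :
    PerfectlyMatched adj U := by
  induction hn : U.card using Nat.strong_induction_on generalizing U with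
  | _ k ih =>
    rcases U.eq_empty_or_nonempty with rfl | ⟨v, hv⟩
    · exact .empty
    obtain ⟨h1, h2, h3, h4⟩ := h v hv
    have hlt : ((U.erase v).erase (mate v)).card < k := by
      rw [← hn]
      exact lt_of_le_of_lt (Finset.card_le_card (Finset.erase_subset _ _))
        (Finset.card_erase_lt_of_mem hv)
    have := ih _ hlt ((U.erase v).erase (mate v)) (fun w hw => by
      simp only [Finset.mem_erase] at hw ⊢
      obtain ⟨g1, g2, g3, g4⟩ := h w hw.2.2
      refine ⟨⟨fun e => hw.2.1 ?_, fun e => hw.1 ?_, g1⟩, g2, g3, g4⟩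
      · rw [← g2, e, h2]
      · rw [← e, g2]) rfl
    have hp := this.pair h4 h3.symm (by simp) (by simp)
    convert hp using 1
    ext w
    simp only [Finset.mem_insert, Finset.mem_erase]
    constructor
    · intro hw
      tauto
    · rintro (rfl | rfl | hw)
      · exact hv
      · exact h1
      · exact hw.2.2

/-- Removing any vertex leaves a perfectly matched set. -/
def FactorCritical (adj : ℕ → ℕ → Prop) (Z : Finset ℕ) : Prop :=
  ∀ z ∈ Z, PerfectlyMatched adj (Z.erase z)

theorem factorCritical_singleton (v : ℕ) : FactorCritical adj {v} := by
  intro z hz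
  obtain rfl := Finset.mem_singleton.1 hz
  simpa using PerfectlyMatched.empty

theorem FactorCritical.odd_card {Z : Finset ℕ} (h : FactorCritical adj Z) {z : ℕ} (hz : z ∈ Z) :
    Odd Z.card := by
  obtain ⟨k, hk⟩ := (h z hz).even_card
  have := Finset.card_erase_add_one hz
  exact ⟨k, by omega⟩

/-- Some vertex of `Y` is adjacent to some vertex of `Z`. -/
def Link (adj : ℕ → ℕ → Prop) (Y Z : Finset ℕ) : Prop :=
  ∃ y ∈ Y, ∃ z ∈ Z, adj y z

/-- The two ends of the link are matched to each other. Factor-criticality matches the rest of each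
set within itself. -/
theorem FactorCritical.union {Y Z : Finset ℕ} (hY : FactorCritical adj Y)
    (hZ : FactorCritical adj Z) (hd : Disjoint Y Z) (h : Link adj Y Z) :
    PerfectlyMatched adj (Y ∪ Z) := by
  obtain ⟨y, hy, z, hz, hyz⟩ := h
  have hne : y ≠ z := fun e => Finset.disjoint_left.1 hd hy (e ▸ hz)
  have hu := (hY y hy).union (hZ z hz)
    (hd.mono (Finset.erase_subset _ _) (Finset.erase_subset _ _))
  have hyZ : y ∉ Z := Finset.disjoint_left.1 hd hy
  have hzY : z ∉ Y := Finset.disjoint_right.1 hd hz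
  have hp := hu.pair hyz hne (by simp [hyZ]) (by simp [hzY])
  convert hp using 1
  ext w
  simp only [Finset.mem_insert, Finset.mem_erase, Finset.mem_union]
  constructor
  · intro hw
    tauto
  · rintro (rfl | rfl | hw)
    · exact Or.inl hy
    · exact Or.inr hz
    · tauto

/-- The union of a list of finite sets. -/
def unions (L : List (Finset ℕ)) : Finset ℕ := L.foldr (· ∪ ·) ∅

@[simp] theorem unions_nil : unions [] = (∅ : Finset ℕ) := rfl

@[simp] theorem unions_cons (Z : Finset ℕ) (L : List (Finset ℕ)) :
    unions (Z :: L) = Z ∪ unions L := rfl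

theorem mem_unions {L : List (Finset ℕ)} {z : ℕ} : z ∈ unions L ↔ ∃ Z ∈ L, z ∈ Z := by
  induction L with
  | nil => simp
  | cons Z L ih => simp [ih]

theorem disjoint_unions {L : List (Finset ℕ)} {Y : Finset ℕ} :
    Disjoint Y (unions L) ↔ ∀ Z ∈ L, Disjoint Y Z := by
  induction L with
  | nil => simp
  | cons Z L ih => simp [ih, Finset.disjoint_union_right]

/-- The union of an even chain of disjoint linked factor-critical sets is perfectly matched. -/
theorem perfectlyMatched_unions : ∀ L : List (Finset ℕ), L.IsChain (Link adj) →
    (∀ Z ∈ L, FactorCritical adj Z) → L.Pairwise Disjoint → Even L.length →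
    PerfectlyMatched adj (unions L)
  | [], _, _, _, _ => .empty
  | [_], _, _, _, h => by simp at h
  | Y :: Z :: L, hc, hf, hd, he => by
    rw [List.isChain_cons_cons] at hc
    rw [List.pairwise_cons, List.pairwise_cons] at hd
    have h1 := (hf Y (by simp)).union (hf Z (by simp)) (hd.1 Z (by simp)) hc.1
    have h2 := perfectlyMatched_unions L hc.2.tail (fun W hW => hf W (by simp [hW])) hd.2.2 (by
      simpa [Nat.even_add_one] using he)
    rw [unions_cons, unions_cons, ← Finset.union_assoc]
    refine h1.union h2 ?_
    rw [Finset.disjoint_union_left, disjoint_unions, disjoint_unions]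
    exact ⟨fun W hW => hd.1 W (by simp [hW]), hd.2.1⟩

/-- The union of an odd closed chain of disjoint linked factor-critical sets is
factor-critical. -/
theorem factorCritical_unions {Y : Finset ℕ} {C : List (Finset ℕ)}
    (hc : (Y :: C ++ [Y]).IsChain (Link adj)) (hf : ∀ Z ∈ Y :: C, FactorCritical adj Z)
    (hd : (Y :: C).Pairwise Disjoint) (he : Even C.length) :
    FactorCritical adj (unions (Y :: C)) := by
  -- It suffices to open the cycle at the set containing the removed vertex: that set is matched
  -- internally without the vertex, and the other sets form an even chain.
  have main : ∀ (D : List (Finset ℕ)) (Z : Finset ℕ) (z : ℕ), z ∈ Z → D.IsChain (Link adj) →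
      (Z :: D).Perm (Y :: C) → PerfectlyMatched adj ((unions (Y :: C)).erase z) := by
    intro D Z z hz hD hp
    have hd' : (Z :: D).Pairwise Disjoint := hd.perm hp.symm fun h => h.symm
    rw [List.pairwise_cons] at hd'
    have hlen := hp.length_eq
    simp only [List.length_cons, Nat.add_right_cancel_iff] at hlen
    have h1 := perfectlyMatched_unions D hD
      (fun W hW => hf W (hp.subset (by simp [hW]))) hd'.2 (hlen ▸ he)
    have h2 := hf Z (hp.subset (by simp)) z hz
    have hdis : Disjoint Z (unions D) := disjoint_unions.2 hd'.1
    convert h2.union h1 (hdis.mono_left (Finset.erase_subset _ _)) using 1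
    have hU : unions (Y :: C) = Z ∪ unions D := by
      rw [← unions_cons]
      ext w
      simp only [mem_unions, hp.mem_iff]
    rw [hU, Finset.erase_union_distrib,
      Finset.erase_eq_of_notMem (Finset.disjoint_left.1 hdis hz)]
  intro z hz
  rw [unions_cons, Finset.mem_union] at hz
  rcases hz with hz | hz
  · refine main C Y z hz ?_ (List.Perm.refl _)
    exact hc.tail.left_of_append
  · obtain ⟨Z, hZ, hzZ⟩ := mem_unions.1 hz
    obtain ⟨L₁, L₂, rfl⟩ := List.append_of_mem hZ
    -- Going round the cycle from the successor of `Z` passes through `L₂`, then `Y`, then `L₁`.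
    refine main (L₂ ++ Y :: L₁) Z z hzZ ?_ ?_
    · rw [List.isChain_split]
      constructor
      · have : (Y :: L₁ ++ Z :: (L₂ ++ [Y])).IsChain (Link adj) := by simpa using hc
        exact (List.isChain_append.1 this).2.1.tail
      · have : (Y :: L₁ ++ Z :: (L₂ ++ [Y])).IsChain (Link adj) := by simpa using hc
        exact (List.isChain_append.1 this).1
    · calc (Z :: (L₂ ++ Y :: L₁)).Perm (Z :: (Y :: L₁ ++ L₂)) :=
            (List.perm_append_comm).cons Z
        _ = Z :: Y :: (L₁ ++ L₂) := rfl
        _ |>.Perm (Y :: Z :: (L₁ ++ L₂)) := List.Perm.swap _ _ _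
        _ |>.Perm (Y :: (L₁ ++ Z :: L₂)) := (List.perm_middle.symm).cons Y

end Matched

/-! ### Matchings as sets of edge indices, with parallel edges allowed -/

section Edges

variable {x y : ℕ → ℕ}

/-- Distinct edges of `N` have no common end; the edge `e` has the ends `x e` and `y e`. -/
def IsMatching (x y : ℕ → ℕ) (N : Finset ℕ) : Prop :=
  ∀ e ∈ N, ∀ f ∈ N, e ≠ f → x e ≠ x f ∧ x e ≠ y f ∧ y e ≠ x f ∧ y e ≠ y f

/-- The set of ends of the edges in `N`. -/
def ends (x y : ℕ → ℕ) (N : Finset ℕ) : Finset ℕ := N.biUnion fun e => {x e, y e}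

theorem mem_ends {N : Finset ℕ} {v : ℕ} : v ∈ ends x y N ↔ ∃ e ∈ N, v = x e ∨ v = y e := by
  simp [ends]

theorem ends_mono {M N : Finset ℕ} (h : M ⊆ N) : ends x y M ⊆ ends x y N :=
  Finset.biUnion_subset_biUnion_of_subset_left _ h

theorem ends_insert (e : ℕ) (N : Finset ℕ) :
    ends x y (insert e N) = {x e, y e} ∪ ends x y N := by
  simp only [ends, Finset.biUnion_insert]

theorem IsMatching.mono {M N : Finset ℕ} (h : IsMatching x y N) (hM : M ⊆ N) :
    IsMatching x y M :=
  fun e he f hf => h e (hM he) f (hM hf)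

theorem IsMatching.insert {N : Finset ℕ} (h : IsMatching x y N) {e : ℕ}
    (hx : x e ∉ ends x y N) (hy : y e ∉ ends x y N) : IsMatching x y (insert e N) := by
  simp only [mem_ends, not_exists, not_and, not_or] at hx hy
  intro f hf g hg hne
  rw [Finset.mem_insert] at hf hg
  rcases hf with rfl | hf <;> rcases hg with rfl | hg
  · exact absurd rfl hne
  · exact ⟨(hx g hg).1, (hx g hg).2, (hy g hg).1, (hy g hg).2⟩
  · exact ⟨Ne.symm (hx f hf).1, Ne.symm (hy f hf).1, Ne.symm (hx f hf).2,
      Ne.symm (hy f hf).2⟩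
  · exact h f hf g hg hne

theorem IsMatching.card_ends {N : Finset ℕ} (h : IsMatching x y N)
    (hxy : ∀ e ∈ N, x e ≠ y e) : (ends x y N).card = 2 * N.card := by
  rw [ends, Finset.card_biUnion]
  · rw [Finset.sum_congr rfl fun e he => Finset.card_pair (hxy e he), Finset.sum_const,
      smul_eq_mul, mul_comm]
  · intro e he f hf hne
    obtain ⟨h1, h2, h3, h4⟩ := h e he f hf hne
    simp [h1.symm, h2.symm, h3.symm, h4.symm]

/-- `a` and `b` are the ends of an edge in `A`. -/
def AdjBy (x y : ℕ → ℕ) (A : Finset ℕ) (a b : ℕ) : Prop :=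
  ∃ e ∈ A, (x e = a ∧ y e = b) ∨ (x e = b ∧ y e = a)

theorem AdjBy.symm {A : Finset ℕ} {a b : ℕ} (h : AdjBy x y A a b) : AdjBy x y A b a := by
  obtain ⟨e, he, h⟩ := h
  exact ⟨e, he, h.symm⟩

/-- One edge index is chosen for each pair. This passes from pairings of vertices back to a
multigraph, where a pair may be joined by several edges. -/
theorem PerfectlyMatched.exists_matching {A U : Finset ℕ}
    (h : PerfectlyMatched (AdjBy x y A) U) :
    ∃ N ⊆ A, IsMatching x y N ∧ ends x y N = U := by
  induction h with
  | empty => exact ⟨∅, by simp, by simp [IsMatching], by simp [ends]⟩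
  | @pair U a b _ hab hne ha hb ih =>
    obtain ⟨N, hNA, hN, rfl⟩ := ih
    obtain ⟨e, he, h⟩ := hab
    refine ⟨insert e N, Finset.insert_subset he hNA, ?_, ?_⟩
    · rcases h with ⟨rfl, rfl⟩ | ⟨rfl, rfl⟩
      · exact hN.insert ha hb
      · exact hN.insert hb ha
    · rw [ends_insert]
      rcases h with ⟨rfl, rfl⟩ | ⟨rfl, rfl⟩
      · ext v; simp
      · ext v; simp only [Finset.mem_union, Finset.mem_insert, Finset.mem_singleton]; tauto

/-- A set covered by a matching none of whose edges leaves it has an even number of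
elements. -/
theorem IsMatching.even_card {N Z : Finset ℕ} (h : IsMatching x y N)
    (hxy : ∀ e ∈ N, x e ≠ y e) (hZ : Z ⊆ ends x y N) (hc : ∀ e ∈ N, x e ∈ Z ↔ y e ∈ Z) :
    Even Z.card := by
  have : Z = ends x y (N.filter fun e => x e ∈ Z) := by
    ext v
    simp only [mem_ends, Finset.mem_filter]
    constructor
    · intro hv
      obtain ⟨e, he, rfl | rfl⟩ := mem_ends.1 (hZ hv)
      · exact ⟨e, ⟨he, hv⟩, Or.inl rfl⟩
      · exact ⟨e, ⟨he, (hc e he).2 hv⟩, Or.inr rfl⟩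
    · rintro ⟨e, ⟨he, hx⟩, rfl | rfl⟩
      · exact hx
      · exact (hc e he).1 hx
  rw [this, (h.mono (Finset.filter_subset _ _)).card_ends
    fun e he => hxy e (Finset.mem_of_mem_filter e he)]
  exact even_two_mul _

/-- The number of vertices covered by `S` exceeds `|S|` by at most the size of some matching
inside `S`. -/
theorem exists_matching_card_ends_le (S : Finset ℕ) :
    ∃ N ⊆ S, IsMatching x y N ∧ (ends x y S).card ≤ S.card + N.card := by
  induction S using Finset.induction_on with
  | empty => exact ⟨∅, by simp, by simp [IsMatching], by simp [ends]⟩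
  | insert e S he ih =>
    obtain ⟨N, hNS, hN, hc⟩ := ih
    rw [ends_insert, Finset.card_insert_of_notMem he]
    -- An edge with a covered end adds at most one vertex, paid for by the growth of `S`. Otherwise
    -- it adds at most two, and the second is paid for by putting it into `N`.
    by_cases h : x e ∈ ends x y S ∨ y e ∈ ends x y S
    · refine ⟨N, hNS.trans (Finset.subset_insert _ _), hN, ?_⟩
      have : ({x e, y e} ∪ ends x y S).card ≤ (ends x y S).card + 1 := by
        rcases h with h | h
        · have : ({x e, y e} ∪ ends x y S) = insert (y e) (ends x y S) := by
            ext v; simp only [Finset.mem_union, Finset.mem_insert, Finset.mem_singleton]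
            constructor
            · rintro ((rfl | h') | h') <;> tauto
            · tauto
          rw [this]
          exact Finset.card_insert_le _ _
        · have : ({x e, y e} ∪ ends x y S) = insert (x e) (ends x y S) := by
            ext v; simp only [Finset.mem_union, Finset.mem_insert, Finset.mem_singleton]
            constructor
            · rintro ((h' | rfl) | h') <;> tauto
            · tauto
          rw [this]
          exact Finset.card_insert_le _ _
      omega
    · push Not at h
      refine ⟨insert e N, Finset.insert_subset_insert _ hNS,
        hN.insert (fun h' => h.1 (ends_mono hNS h')) (fun h' => h.2 (ends_mono hNS h')), ?_⟩
      rw [Finset.card_insert_of_notMem fun h' => he (hNS h')]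
      have h1 := Finset.card_union_le {x e, y e} (ends x y S)
      have h2 := Finset.card_le_two (a := x e) (b := y e)
      omega

end Edges

end TwoPM

namespace TwoPM

/-! ### Alternating forests with contracted blossoms -/

/-- The vertices below `n` with the base `b`. -/
def blob (n : ℕ) (base : ℕ → ℕ) (b : ℕ) : Finset ℕ := (Finset.range n).filter fun z => base z = b

@[simp] theorem mem_blob {n : ℕ} {base : ℕ → ℕ} {b z : ℕ} :
    z ∈ blob n base b ↔ z < n ∧ base z = b := by simp [blob]

/-- The number of labelled vertices. -/
def labelled (n : ℕ) (lab : ℕ → ℕ) : ℕ := ((Finset.range n).filter fun z => lab z ≠ 0).card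

/-- The number of vertices other than bases. -/
def absorbed (n : ℕ) (base : ℕ → ℕ) : ℕ := ((Finset.range n).filter fun z => base z ≠ z).card

/-- The vertices covered by a matching, given by the partners `mate`; a vertex is exposed if it
is its own partner. -/
def covered (n : ℕ) (mate : ℕ → ℕ) : Finset ℕ := (Finset.range n).filter fun z => mate z ≠ z

/-- An alternating forest for the matching `mate`. Labels: `1` outer, `2` inner, `0` neither.
The vertices with equal base form a blossom, `par` is the parent of an inner vertex, and `dep`
decreases on the way to the root. -/
structure Forest (n : ℕ) (adj : ℕ → ℕ → Prop) (mate base lab par dep : ℕ → ℕ) : Prop where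
  symm : ∀ a b, adj a b → adj b a
  mate_lt : ∀ v < n, mate v < n
  mate_mate : ∀ v < n, mate (mate v) = v
  adj_mate : ∀ v < n, mate v ≠ v → adj v (mate v)
  base_lt : ∀ v < n, base v < n
  base_base : ∀ v < n, base (base v) = base v
  lab_base : ∀ v < n, lab (base v) = lab v
  lab_le : ∀ v < n, lab v ≤ 2
  base_eq : ∀ v < n, lab v ≠ 1 → base v = v
  mate_unlabelled : ∀ v < n, lab v = 0 → mate v ≠ v ∧ lab (mate v) = 0
  mate_inner : ∀ v < n, lab v = 2 → lab (mate v) = 1 ∧ base (mate v) = mate v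
  par_inner : ∀ v < n, lab v = 2 → par v < n ∧ lab (par v) = 1 ∧ adj v (par v) ∧
    dep (base (par v)) < dep (mate v)
  mate_base : ∀ v < n, lab v = 1 → base v = v → mate v ≠ v → lab (mate v) = 2
  mate_absorbed : ∀ v < n, base v ≠ v → mate v ≠ v ∧ base (mate v) = base v
  dep_exposed : ∀ v < n, mate v = v → dep v = 0
  dep_le : ∀ v < n, dep v ≤ labelled n lab
  factorCritical : ∀ b < n, FactorCritical adj (blob n base b)

section

variable {n : ℕ} {adj : ℕ → ℕ → Prop} {mate base lab par dep : ℕ → ℕ}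

/-- The initial forest: the exposed vertices are roots. -/
theorem Forest.init (symm : ∀ a b, adj a b → adj b a) (mate_lt : ∀ v < n, mate v < n)
    (mate_mate : ∀ v < n, mate (mate v) = v) (adj_mate : ∀ v < n, mate v ≠ v → adj v (mate v))
    (hbase : ∀ v < n, base v = v) (hlab : ∀ v < n, lab v = if mate v = v then 1 else 0)
    (hdep : ∀ v < n, dep v = 0) : Forest n adj mate base lab par dep where
  symm := symm
  mate_lt := mate_lt
  mate_mate := mate_mate
  adj_mate := adj_mate
  base_lt v hv := by rw [hbase v hv]; exact hv
  base_base v hv := by rw [hbase v hv, hbase v hv]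
  lab_base v hv := by rw [hbase v hv]
  lab_le v hv := by rw [hlab v hv]; split_ifs <;> omega
  base_eq v hv _ := hbase v hv
  mate_unlabelled v hv h := by
    rw [hlab v hv] at h
    rw [hlab _ (mate_lt v hv), mate_mate v hv]
    by_cases hm : mate v = v
    · simp [hm] at h
    · exact ⟨hm, if_neg (Ne.symm hm)⟩
  mate_inner v hv h := by
    rw [hlab v hv] at h
    split_ifs at h; omega
  par_inner v hv h := by
    rw [hlab v hv] at h
    split_ifs at h; omega
  mate_base v hv h _ hm := by
    rw [hlab v hv, if_neg hm] at h
    omega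
  mate_absorbed v hv h := absurd (hbase v hv) h
  dep_exposed v hv _ := hdep v hv
  dep_le v hv := by rw [hdep v hv]; exact Nat.zero_le _
  factorCritical b hb := by
    have : blob n base b = {b} := by
      ext z
      simp only [mem_blob, Finset.mem_singleton]
      constructor
      · rintro ⟨h1, h2⟩
        rw [← h2, hbase z h1]
      · rintro rfl
        exact ⟨hb, hbase z hb⟩
    rw [this]
    exact factorCritical_singleton b

theorem Forest.mate_ne_of_inner (h : Forest n adj mate base lab par dep) {v : ℕ} (hv : v < n)
    (hl : lab v = 2) : mate v ≠ v := by
  intro e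
  have := (h.mate_inner v hv hl).1
  rw [e] at this
  omega

/-- An unlabelled neighbour of an outer vertex, and its partner, can be added. -/
theorem Forest.grow (h : Forest n adj mate base lab par dep) {v w : ℕ} (hv : v < n) (hw : w < n)
    (hlv : lab v = 1) (hlw : lab w = 0) (hvw : adj v w) :
    Forest n adj mate base (Function.update (Function.update lab w 2) (mate w) 1)
      (Function.update par w v) (Function.update dep (mate w) (dep (base v) + 1)) ∧
    labelled n lab < labelled n (Function.update (Function.update lab w 2) (mate w) 1) := by
  obtain ⟨hm, hlm⟩ := h.mate_unlabelled w hw hlw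
  have hmn := h.mate_lt w hw
  have hmm := h.mate_mate w hw
  have hbw := h.base_eq w hw (by omega)
  have hbm := h.base_eq _ hmn (by omega)
  have hlt : labelled n lab <
      labelled n (Function.update (Function.update lab w 2) (mate w) 1) := by
    refine Finset.card_lt_card (Finset.ssubset_iff_subset_ne.2 ⟨fun z hz => ?_, fun e => ?_⟩)
    · simp only [Finset.mem_filter, Function.update_apply] at hz ⊢
      refine ⟨hz.1, ?_⟩
      split_ifs <;> omega
    · have : w ∈ (Finset.range n).filter fun z =>
          Function.update (Function.update lab w 2) (mate w) 1 z ≠ 0 := by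
        simp [hw, Function.update_apply, Ne.symm hm]
      rw [← e] at this
      simp [hlw] at this
  -- Vertices that are not outer are blossoms of their own, so relabelling `w` and its partner
  -- affects no other blossom.
  have hb1 : ∀ z < n, base z = w → z = w := by
    intro z hz e
    have := h.lab_base z hz
    rw [e, hlw] at this
    rw [← h.base_eq z hz (by omega), e]
  have hb2 : ∀ z < n, base z = mate w → z = mate w := by
    intro z hz e
    have := h.lab_base z hz
    rw [e, hlm] at this
    rw [← h.base_eq z hz (by omega), e]
  have hinj : ∀ z < n, mate z = mate w → z = w := fun z hz e => by
    rw [← h.mate_mate z hz, e, hmm]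
  have hinj' : ∀ z < n, mate z = w → z = mate w := fun z hz e => by
    rw [← h.mate_mate z hz, e]
  refine ⟨{ h with
    lab_base := ?_, lab_le := ?_, base_eq := ?_, mate_unlabelled := ?_, mate_inner := ?_,
    par_inner := ?_, mate_base := ?_, dep_exposed := ?_, dep_le := ?_ }, hlt⟩
  · intro z hz
    have := h.lab_base z hz
    have := hb1 z hz
    have := hb2 z hz
    simp only [Function.update_apply]
    grind
  · intro z hz
    have := h.lab_le z hz
    simp only [Function.update_apply]
    grind
  · intro z hz
    have := h.base_eq z hz
    simp only [Function.update_apply]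
    grind
  · intro z hz
    have := h.mate_unlabelled z hz
    have := hinj z hz
    have := hinj' z hz
    simp only [Function.update_apply]
    grind
  · intro z hz
    have := h.mate_inner z hz
    simp only [Function.update_apply]
    grind
  · intro z hz
    have := h.par_inner z hz
    have := hinj z hz
    simp only [Function.update_apply]
    by_cases hzm : z = mate w
    · simp [hzm]
    by_cases hzw : z = w
    · subst hzw
      intro _
      -- The base of `v` is outer and the partner is still unlabelled, so the new depth does not
      -- overwrite the depth it is computed from.
      have : base v ≠ mate z := fun e => by
        have := h.lab_base v hv
        rw [e] at this
        omega
      refine ⟨by simpa using hv, ?_, by simpa using h.symm _ _ hvw, ?_⟩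
      · simp only [if_true]
        grind
      · simp [this]
    · simp only [if_neg hzm, if_neg hzw]
      intro hl
      obtain ⟨g1, g2, g3, g4⟩ := h.par_inner z hz hl
      have e1 : base (par z) ≠ mate w := fun e => by
        have := h.lab_base _ g1
        rw [e] at this
        omega
      have e2 : mate z ≠ mate w := fun e => hzw (hinj z hz e)
      refine ⟨g1, ?_, g3, by simpa [e1, e2] using g4⟩
      grind
  · intro z hz
    have := h.mate_base z hz
    have := hinj z hz
    have := hinj' z hz
    have := h.mate_lt z hz
    have := h.mate_mate z hz
    simp only [Function.update_apply]
    grind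
  · intro z hz
    have := h.dep_exposed z hz
    simp only [Function.update_apply]
    grind
  · intro z hz
    have h1 := h.dep_le z hz
    have h2 := h.dep_le _ (h.base_lt v hv)
    rw [Function.update_apply]
    split_ifs <;> omega

/-- The state while two pointers `p` and `q` climb towards the roots: the marked blossoms form
an even chain of linked factor-critical sets between the blossoms of `p` and `q`. -/
structure Climb (n : ℕ) (adj : ℕ → ℕ → Prop) (mate base lab dep mark : ℕ → ℕ) (p q : ℕ) :
    Prop where
  left : p < n ∧ lab p = 1 ∧ base p = p
  right : q < n ∧ lab q = 1 ∧ base q = q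
  mark_outer : ∀ z < n, mark z = 1 → lab z = 1 → base z = z ∧ mate z ≠ z ∧ mark (mate z) = 1 ∧
    z ≠ p ∧ z ≠ q ∧ dep p ≤ dep z ∧ dep q ≤ dep z
  mark_inner : ∀ z < n, mark z = 1 → lab z ≠ 1 → lab z = 2 ∧ mark (mate z) = 1
  chain : ∃ C : List (Finset ℕ),
    (blob n base p :: C ++ [blob n base q]).IsChain (Link adj) ∧ C.Pairwise Disjoint ∧
    (∀ Z ∈ C, FactorCritical adj Z) ∧ Even C.length ∧
    unions C = (Finset.range n).filter fun z => mark (base z) = 1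

/-- The edge between `v` and `w` links their blossoms directly, so the chain starts empty. -/
theorem Climb.init (h : Forest n adj mate base lab par dep) {mark : ℕ → ℕ}
    (hmark : ∀ z < n, mark z = 0) {v w : ℕ} (hv : v < n) (hw : w < n) (hlv : lab v = 1)
    (hlw : lab w = 1) (hvw : adj v w) :
    Climb n adj mate base lab dep mark (base v) (base w) where
  left := ⟨h.base_lt v hv, by rw [h.lab_base v hv, hlv], h.base_base v hv⟩
  right := ⟨h.base_lt w hw, by rw [h.lab_base w hw, hlw], h.base_base w hw⟩
  mark_outer z hz hm := by
    rw [hmark z hz] at hm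
    omega
  mark_inner z hz hm := by
    rw [hmark z hz] at hm
    omega
  chain := by
    refine ⟨[], ?_, by simp, by simp, by simp, ?_⟩
    · simpa using ⟨v, by simpa using hv, w, by simpa using hw, hvw⟩
    · ext z
      simp only [unions_nil, Finset.notMem_empty, Finset.mem_filter, Finset.mem_range, false_iff]
      rintro ⟨hz, hm⟩
      rw [hmark _ (h.base_lt z hz)] at hm
      omega

theorem unions_reverse (C : List (Finset ℕ)) : unions C.reverse = unions C := by
  ext z
  simp [mem_unions]

/-- Exchanging the pointers reverses the chain. This lets the climbing step be proved for one
pointer only. -/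
theorem Climb.symm (h : Forest n adj mate base lab par dep) {mark : ℕ → ℕ} {p q : ℕ}
    (c : Climb n adj mate base lab dep mark p q) : Climb n adj mate base lab dep mark q p where
  left := c.right
  right := c.left
  mark_outer z hz hm hl := by
    obtain ⟨h1, h2, h3, h4, h5, h6, h7⟩ := c.mark_outer z hz hm hl
    exact ⟨h1, h2, h3, h5, h4, h7, h6⟩
  mark_inner := c.mark_inner
  chain := by
    obtain ⟨C, h1, h2, h3, h4, h5⟩ := c.chain
    refine ⟨C.reverse, ?_, ?_, by simpa using h3, by simpa using h4, by rw [unions_reverse, h5]⟩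
    · have : blob n base q :: C.reverse ++ [blob n base p] =
          (blob n base p :: C ++ [blob n base q]).reverse := by simp
      rw [this, List.isChain_reverse]
      refine h1.imp fun Y Z => ?_
      rintro ⟨y, hy, z, hz, hyz⟩
      exact ⟨z, hz, y, hy, h.symm _ _ hyz⟩
    · rw [List.pairwise_reverse]
      exact h2.imp fun hd => hd.symm

/-- The deeper pointer moves up. -/
theorem Climb.step (h : Forest n adj mate base lab par dep) {mark : ℕ → ℕ} {p q : ℕ}
    (c : Climb n adj mate base lab dep mark p q) (hpq : p ≠ q) (hd : dep q ≤ dep p)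
    (hp : dep p ≠ 0) :
    Climb n adj mate base lab dep (Function.update (Function.update mark p 1) (mate p) 1)
      (base (par (mate p))) q ∧
    dep (base (par (mate p))) < dep p := by
  obtain ⟨hpn, hlp, hbp⟩ := c.left
  have hm : mate p ≠ p := fun e => hp (h.dep_exposed p hpn e)
  have hmn := h.mate_lt p hpn
  have hmm := h.mate_mate p hpn
  have hlm := h.mate_base p hpn hlp hbp hm
  obtain ⟨hrn, hlr, hadj, hdep⟩ := h.par_inner _ hmn hlm
  rw [hmm] at hdep
  have hbm := h.base_eq _ hmn (by omega)
  have hbrn := h.base_lt _ hrn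
  -- The blossom of `p` and the inner vertex above it are still unmarked, which keeps the sets of
  -- the chain disjoint.
  have hmp : mark p ≠ 1 := fun e => (c.mark_outer p hpn e hlp).2.2.2.1 rfl
  have hmu : mark (mate p) ≠ 1 := fun e => by
    have := (c.mark_inner _ hmn e (by omega)).2
    rw [hmm] at this
    exact hmp this
  refine ⟨⟨⟨hbrn, by rw [h.lab_base _ hrn, hlr], h.base_base _ hrn⟩, c.right, ?_, ?_, ?_⟩, hdep⟩
  · intro z hz hmz hlz
    by_cases hzp : z = p
    · subst hzp
      refine ⟨hbp, hm, by simp, fun e => ?_, hpq, hdep.le, hd⟩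
      rw [← e] at hdep
      omega
    · have hzu : z ≠ mate p := fun e => by rw [e] at hlz; omega
      rw [Function.update_of_ne hzu, Function.update_of_ne hzp] at hmz
      obtain ⟨h1, h2, h3, h4, h5, h6, h7⟩ := c.mark_outer z hz hmz hlz
      refine ⟨h1, h2, ?_, fun e => ?_, h5, by omega, h7⟩
      · simp only [Function.update_apply]
        split_ifs <;> first | rfl | exact h3
      · rw [e] at h6
        omega
  · intro z hz hmz hlz
    have hzp : z ≠ p := fun e => hlz (e ▸ hlp)
    by_cases hzu : z = mate p
    · subst hzu
      refine ⟨hlm, ?_⟩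
      rw [hmm, Function.update_of_ne (Ne.symm hm), Function.update_self]
    · rw [Function.update_of_ne hzu, Function.update_of_ne hzp] at hmz
      obtain ⟨h1, h2⟩ := c.mark_inner z hz hmz hlz
      refine ⟨h1, ?_⟩
      simp only [Function.update_apply]
      split_ifs <;> first | rfl | exact h2
  · obtain ⟨C, h1, h2, h3, h4, h5⟩ := c.chain
    have hC : ∀ Z ∈ C, ∀ z ∈ Z, z < n ∧ mark (base z) = 1 := fun Z hZ z hz => by
      have : z ∈ unions C := mem_unions.2 ⟨Z, hZ, hz⟩
      simpa [h5] using this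
    -- Two sets are prepended, so the parity is kept. The links are the edge from the inner vertex
    -- to its parent and the matching edge at `p`.
    refine ⟨{mate p} :: blob n base p :: C, ?_, ?_, ?_, ?_, ?_⟩
    · simp only [List.cons_append, List.isChain_cons_cons] at h1 ⊢
      refine ⟨⟨par (mate p), by simpa using hrn, mate p, by simp, h.symm _ _ hadj⟩,
        ⟨mate p, by simp, p, by simp [hpn, hbp], h.symm _ _ (h.adj_mate p hpn hm)⟩, h1⟩
    · rw [List.pairwise_cons, List.pairwise_cons]
      refine ⟨fun Z hZ => ?_, fun Z hZ => ?_, h2⟩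
      · rw [Finset.disjoint_singleton_left]
        intro hz
        rcases List.mem_cons.1 hZ with rfl | hZ
        · rw [mem_blob, hbm] at hz
          exact hm hz.2
        · have := (hC Z hZ _ hz).2
          rw [hbm] at this
          exact hmu this
      · rw [Finset.disjoint_left]
        intro z hz hz'
        have := (hC Z hZ z hz').2
        rw [(mem_blob.1 hz).2] at this
        exact hmp this
    · intro Z hZ
      rcases List.mem_cons.1 hZ with rfl | hZ
      · exact factorCritical_singleton _
      rcases List.mem_cons.1 hZ with rfl | hZ
      · exact h.factorCritical p hpn
      · exact h3 Z hZ
    · simpa [Nat.even_add_one] using h4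
    · ext z
      simp only [unions_cons, h5, Finset.mem_union, Finset.mem_singleton, mem_blob,
        Finset.mem_filter, Finset.mem_range, Function.update_apply]
      constructor
      · rintro (rfl | ⟨hz, e⟩ | ⟨hz, e⟩)
        · exact ⟨hmn, by rw [hbm, if_pos rfl]⟩
        · refine ⟨hz, ?_⟩
          rw [e, if_neg (Ne.symm hm), if_pos rfl]
        · refine ⟨hz, ?_⟩
          split_ifs <;> first | rfl | exact e
      · rintro ⟨hz, e⟩
        split_ifs at e with e1 e2
        · left
          have := h.lab_base z hz
          rw [e1, hlm] at this
          rw [← e1, h.base_eq z hz (by omega)]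
        · exact Or.inr (Or.inl ⟨hz, e2⟩)
        · exact Or.inr (Or.inr ⟨hz, e⟩)

/-- The marked region is closed under partners: a vertex that is not a base has its partner in the
same blossom, and marked bases and inner vertices are marked together with their partners. A merge
therefore separates no unabsorbed vertex from its partner. -/
theorem Climb.mate_mem (h : Forest n adj mate base lab par dep) {mark : ℕ → ℕ} {p q : ℕ}
    (c : Climb n adj mate base lab dep mark p q) {z : ℕ} (hz : z < n)
    (hm : mark (base z) = 1) : mate z ≠ z ∧ mark (base (mate z)) = 1 := by
  by_cases hb : base z = z
  · rw [hb] at hm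
    by_cases hl : lab z = 1
    · obtain ⟨-, h2, h3, -⟩ := c.mark_outer z hz hm hl
      refine ⟨h2, ?_⟩
      rw [h.base_eq _ (h.mate_lt z hz) (by rw [h.mate_base z hz hl hb h2]; omega), h3]
    · obtain ⟨h1, h2⟩ := c.mark_inner z hz hm hl
      exact ⟨h.mate_ne_of_inner hz h1, by rw [(h.mate_inner z hz h1).2, h2]⟩
  · obtain ⟨h1, h2⟩ := h.mate_absorbed z hz hb
    exact ⟨h1, by rw [h2, hm]⟩

/-- If the pointers meet, the marked blossoms and that of the pointers form a blossom. -/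
theorem Climb.merge (h : Forest n adj mate base lab par dep) {mark : ℕ → ℕ} {p : ℕ}
    (c : Climb n adj mate base lab dep mark p p) {base' lab' : ℕ → ℕ}
    (hb' : ∀ z < n, base' z = if mark (base z) = 1 then p else base z)
    (hl' : ∀ z < n, lab' z = if mark (base z) = 1 then 1 else lab z)
    (hne : ∃ z < n, mark z = 1 ∧ lab z = 1) :
    Forest n adj mate base' lab' par dep ∧ labelled n lab ≤ labelled n lab' ∧
      absorbed n base < absorbed n base' := by
  obtain ⟨hpn, hlp, hbp⟩ := c.left
  have hmp : mark p ≠ 1 := fun e => (c.mark_outer p hpn e hlp).2.2.2.1 rfl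
  have hbp' : base' p = p := by rw [hb' p hpn, hbp, if_neg hmp]
  have hlp' : lab' p = 1 := by rw [hl' p hpn, hbp, if_neg hmp, hlp]
  have hle : labelled n lab ≤ labelled n lab' := by
    refine Finset.card_le_card fun z hz => ?_
    simp only [Finset.mem_filter, Finset.mem_range] at hz ⊢
    refine ⟨hz.1, ?_⟩
    rw [hl' z hz.1]
    split_ifs <;> omega
  -- A marked outer vertex was its own base and differs from `p`. It now has base `p`.
  have hlt : absorbed n base < absorbed n base' := by
    refine Finset.card_lt_card (Finset.ssubset_iff_subset_ne.2 ⟨fun z hz => ?_, fun e => ?_⟩)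
    · simp only [Finset.mem_filter, Finset.mem_range] at hz ⊢
      refine ⟨hz.1, ?_⟩
      rw [hb' z hz.1]
      split_ifs with hm
      · rintro rfl
        exact hz.2 hbp
      · exact hz.2
    · obtain ⟨z, hz, hmz, hlz⟩ := hne
      obtain ⟨h1, -, -, h4, -⟩ := c.mark_outer z hz hmz hlz
      have : z ∈ (Finset.range n).filter fun z => base' z ≠ z := by
        simp only [Finset.mem_filter, Finset.mem_range]
        refine ⟨hz, ?_⟩
        rw [hb' z hz, h1, if_pos hmz]
        exact Ne.symm h4
      rw [← e] at this
      simp [h1] at this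
  have hlab0 : ∀ z < n, lab' z ≠ 1 → mark (base z) ≠ 1 ∧ lab' z = lab z ∧ base z = z := by
    intro z hz hl
    rw [hl' z hz] at hl
    have hm : mark (base z) ≠ 1 := fun hm => hl (if_pos hm)
    rw [if_neg hm] at hl
    refine ⟨hm, ?_, h.base_eq z hz hl⟩
    rw [hl' z hz, if_neg hm]
  have hmate : ∀ z < n, mark (base (mate z)) = 1 → mark (base z) = 1 := fun z hz hm => by
    have := (c.mate_mem h (h.mate_lt z hz) hm).2
    rwa [h.mate_mate z hz] at this
  refine ⟨{ h with
    base_lt := ?_, base_base := ?_, lab_base := ?_, lab_le := ?_, base_eq := ?_,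
    mate_unlabelled := ?_, mate_inner := ?_, par_inner := ?_, mate_base := ?_,
    mate_absorbed := ?_, dep_le := ?_, factorCritical := ?_ }, hle, hlt⟩
  · intro z hz
    rw [hb' z hz]
    split_ifs
    · exact hpn
    · exact h.base_lt z hz
  · intro z hz
    by_cases hm : mark (base z) = 1
    · rw [hb' z hz, if_pos hm, hbp']
    · rw [hb' z hz, if_neg hm, hb' _ (h.base_lt z hz), h.base_base z hz, if_neg hm]
  · intro z hz
    by_cases hm : mark (base z) = 1
    · rw [hb' z hz, if_pos hm, hl' z hz, if_pos hm, hlp']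
    · rw [hb' z hz, if_neg hm, hl' _ (h.base_lt z hz), h.base_base z hz, if_neg hm,
        hl' z hz, if_neg hm, h.lab_base z hz]
  · intro z hz
    rw [hl' z hz]
    split_ifs
    · omega
    · exact h.lab_le z hz
  · intro z hz hl
    obtain ⟨h1, h2, h3⟩ := hlab0 z hz hl
    rw [hb' z hz, if_neg h1, h3]
  · intro z hz hl
    obtain ⟨h1, h2, h3⟩ := hlab0 z hz (by omega)
    obtain ⟨h4, h5⟩ := h.mate_unlabelled z hz (by omega)
    refine ⟨h4, ?_⟩
    rw [hl' _ (h.mate_lt z hz), if_neg fun e => h1 (hmate z hz e), h5]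
  · intro z hz hl
    obtain ⟨h1, h2, h3⟩ := hlab0 z hz (by omega)
    obtain ⟨h4, h5⟩ := h.mate_inner z hz (by omega)
    have h6 : mark (base (mate z)) ≠ 1 := fun e => h1 (hmate z hz e)
    refine ⟨?_, ?_⟩
    · rw [hl' _ (h.mate_lt z hz), if_neg h6, h4]
    · rw [hb' _ (h.mate_lt z hz), if_neg h6, h5]
  · intro z hz hl
    obtain ⟨h1, h2, h3⟩ := hlab0 z hz (by omega)
    obtain ⟨g1, g2, g3, g4⟩ := h.par_inner z hz (by omega)
    refine ⟨g1, ?_, g3, ?_⟩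
    · rw [hl' _ g1, g2]
      simp
    -- If the blossom of the parent is absorbed, its base becomes `p`, which is no deeper than any
    -- marked outer base. Depths therefore still decrease towards the root without being updated.
    · rw [hb' _ g1]
      split_ifs with hm
      · have := (c.mark_outer _ (h.base_lt _ g1) hm (by rw [h.lab_base _ g1, g2])).2.2.2.2.2.1
        omega
      · exact g4
  · intro z hz hl hb hmz
    have h1 : mark (base z) ≠ 1 := fun hm => by
      rw [hb' z hz, if_pos hm] at hb
      rw [← hb, hbp] at hm
      exact hmp hm
    rw [hb' z hz, if_neg h1] at hb
    rw [hl' z hz, if_neg h1] at hl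
    rw [hl' _ (h.mate_lt z hz), if_neg fun e => h1 (hmate z hz e), h.mate_base z hz hl hb hmz]
  · intro z hz hb
    by_cases hm : mark (base z) = 1
    · obtain ⟨h1, h2⟩ := c.mate_mem h hz hm
      exact ⟨h1, by rw [hb' _ (h.mate_lt z hz), if_pos h2, hb' z hz, if_pos hm]⟩
    · rw [hb' z hz, if_neg hm] at hb ⊢
      obtain ⟨h1, h2⟩ := h.mate_absorbed z hz hb
      exact ⟨h1, by rw [hb' _ (h.mate_lt z hz), h2, if_neg hm]⟩
  · intro z hz
    exact (h.dep_le z hz).trans hle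
  · intro b hb
    -- The new blossom is a closed chain of odd length through the blossom of `p`. An absorbed base
    -- keeps an empty blossom, which is trivially factor-critical.
    by_cases hbp : b = p
    · subst hbp
      obtain ⟨C, h1, h2, h3, h4, h5⟩ := c.chain
      have : blob n base' b = unions (blob n base b :: C) := by
        ext z
        simp only [unions_cons, h5, Finset.mem_union, mem_blob, Finset.mem_filter,
          Finset.mem_range]
        constructor
        · rintro ⟨hz, e⟩
          rw [hb' z hz] at e
          split_ifs at e with hm
          · exact Or.inr ⟨hz, hm⟩
          · exact Or.inl ⟨hz, e⟩
        · rintro (⟨hz, e⟩ | ⟨hz, e⟩)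
          · refine ⟨hz, ?_⟩
            rw [hb' z hz, e]
            simp
          · exact ⟨hz, by rw [hb' z hz, if_pos e]⟩
      rw [this]
      refine factorCritical_unions h1 ?_ ?_ h4
      · intro Z hZ
        rcases List.mem_cons.1 hZ with rfl | hZ
        · exact h.factorCritical b hb
        · exact h3 Z hZ
      · rw [List.pairwise_cons]
        refine ⟨fun Z hZ => Finset.disjoint_left.2 fun z hz hz' => ?_, h2⟩
        have hu : z ∈ unions C := mem_unions.2 ⟨Z, hZ, hz'⟩
        simp only [h5, Finset.mem_filter] at hu
        rw [(mem_blob.1 hz).2] at hu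
        exact hmp hu.2
    · have hsub : blob n base' b = if mark b = 1 then ∅ else blob n base b := by
        ext z
        split_ifs with hm
        · simp only [mem_blob, Finset.notMem_empty, iff_false]
          rintro ⟨hz, e⟩
          rw [hb' z hz] at e
          split_ifs at e with e1
          · exact hbp e.symm
          · exact e1 (e ▸ hm)
        · simp only [mem_blob]
          refine and_congr_right fun hz => ?_
          rw [hb' z hz]
          split_ifs with e1
          · exact ⟨fun e => absurd e.symm hbp, fun e => absurd (e ▸ e1) hm⟩
          · rfl
      rw [hsub]
      split_ifs
      · intro z hz
        simp at hz
      · exact h.factorCritical b hb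

/-- If the pointers end at distinct roots, the matching is not maximum. -/
theorem Climb.augment (h : Forest n adj mate base lab par dep) {mark : ℕ → ℕ} {p q : ℕ}
    (c : Climb n adj mate base lab dep mark p q) (hpq : p ≠ q) (hp : dep p = 0)
    (hq : dep q = 0) :
    ∃ U, PerfectlyMatched adj U ∧ (covered n mate).card < U.card := by
  -- A base with a partner has a parent blossom of strictly smaller depth, so an outer base of depth
  -- zero is exposed.
  have root : ∀ r < n, lab r = 1 → base r = r → dep r = 0 → mate r = r := by
    intro r hr hl hb hd
    by_contra hm
    have h1 := (h.par_inner _ (h.mate_lt r hr) (h.mate_base r hr hl hb hm)).2.2.2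
    rw [h.mate_mate r hr] at h1
    omega
  obtain ⟨hpn, hlp, hbp⟩ := c.left
  obtain ⟨hqn, hlq, hbq⟩ := c.right
  have hmp := root p hpn hlp hbp hp
  have hmq := root q hqn hlq hbq hq
  have hkp : mark p ≠ 1 := fun e => (c.mark_outer p hpn e hlp).2.2.2.1 rfl
  have hkq : mark q ≠ 1 := fun e => (c.mark_outer q hqn e hlq).2.2.2.2.1 rfl
  obtain ⟨C, h1, h2, h3, h4, h5⟩ := c.chain
  set L := blob n base p :: C ++ [blob n base q] with hL
  have hT : ∀ z, z ∈ unions L ↔ z < n ∧ (base z = p ∨ mark (base z) = 1 ∨ base z = q) := by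
    intro z
    have hu : z ∈ unions C ↔ z < n ∧ mark (base z) = 1 := by simp [h5]
    rw [mem_unions] at hu ⊢
    simp only [hL, List.cons_append, List.mem_cons, List.mem_append, List.not_mem_nil, or_false]
    constructor
    · rintro ⟨Z, rfl | hZ | rfl, hz⟩
      · rw [mem_blob] at hz; tauto
      · have := hu.1 ⟨Z, hZ, hz⟩; tauto
      · rw [mem_blob] at hz; tauto
    · rintro ⟨hz, e | e | e⟩
      · exact ⟨_, Or.inl rfl, mem_blob.2 ⟨hz, e⟩⟩
      · obtain ⟨Z, hZ, hz⟩ := hu.2 ⟨hz, e⟩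
        exact ⟨Z, Or.inr (Or.inl hZ), hz⟩
      · exact ⟨_, Or.inr (Or.inr rfl), mem_blob.2 ⟨hz, e⟩⟩
  have hPM : PerfectlyMatched adj (unions L) := by
    have hCd : ∀ Z ∈ C, ∀ z ∈ Z, mark (base z) = 1 := fun Z hZ z hz => by
      have hu : z ∈ unions C := mem_unions.2 ⟨Z, hZ, hz⟩
      simp only [h5, Finset.mem_filter] at hu
      exact hu.2
    refine perfectlyMatched_unions L h1 ?_ ?_ ?_
    · intro Z hZ
      simp only [hL, List.cons_append, List.mem_cons, List.mem_append, List.not_mem_nil,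
        or_false] at hZ
      rcases hZ with rfl | hZ | rfl
      · exact h.factorCritical p hpn
      · exact h3 Z hZ
      · exact h.factorCritical q hqn
    · simp only [hL, List.cons_append, List.pairwise_cons, List.mem_append, List.mem_cons,
        List.not_mem_nil, or_false, List.pairwise_append, List.Pairwise.nil, h2, true_and]
      refine ⟨?_, by simp, ?_⟩
      · rintro Z (hZ | rfl)
        · refine Finset.disjoint_left.2 fun z hz hz' => hkp ?_
          rw [← (mem_blob.1 hz).2]
          exact hCd Z hZ z hz'
        · refine Finset.disjoint_left.2 fun z hz hz' => hpq ?_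
          rw [← (mem_blob.1 hz).2, (mem_blob.1 hz').2]
      · rintro Z hZ W rfl
        refine Finset.disjoint_left.2 fun z hz hz' => hkq ?_
        rw [← (mem_blob.1 hz').2]
        exact hCd Z hZ z hz
    · simpa [hL, Nat.even_add_one] using h4
  -- The union of the chain is closed under partners except at its two exposed roots. Hence the old
  -- matching still pairs up the covered vertices outside it.
  have hclosed : ∀ z ∈ unions L, z ≠ p → z ≠ q → mate z ∈ unions L := by
    intro z hz hzp hzq
    rw [hT] at hz ⊢
    refine ⟨h.mate_lt z hz.1, ?_⟩
    rcases hz with ⟨hz, e | e | e⟩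
    · left
      rw [(h.mate_absorbed z hz (fun e' => hzp (e'.symm.trans e))).2, e]
    · exact Or.inr (Or.inl (c.mate_mem h hz e).2)
    · right; right
      rw [(h.mate_absorbed z hz (fun e' => hzq (e'.symm.trans e))).2, e]
  have hR : PerfectlyMatched adj (covered n mate \ unions L) := by
    refine PerfectlyMatched.of_involution (mate := mate) _ fun v hv => ?_
    simp only [covered, Finset.mem_sdiff, Finset.mem_filter, Finset.mem_range] at hv ⊢
    obtain ⟨⟨hv, hm⟩, hn⟩ := hv
    have hmm := h.mate_mate v hv
    refine ⟨⟨⟨h.mate_lt v hv, by rw [hmm]; exact Ne.symm hm⟩, fun e => hn ?_⟩, hmm, hm,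
      h.adj_mate v hv hm⟩
    rw [← hmm]
    refine hclosed _ e (fun e' => hm ?_) (fun e' => hm ?_)
    · rw [e', hmp] at hmm
      rw [e', hmm]
    · rw [e', hmq] at hmm
      rw [e', hmm]
  refine ⟨_, hPM.union hR Finset.disjoint_sdiff, ?_⟩
  refine Finset.card_lt_card (Finset.ssubset_iff_subset_ne.2 ⟨fun z hz => ?_, fun e => ?_⟩)
  · simp only [Finset.mem_union, Finset.mem_sdiff]
    tauto
  -- The pairing covers all old vertices and the root `p` as well.
  · have : p ∈ unions L ∪ covered n mate \ unions L :=
      Finset.mem_union_left _ ((hT p).2 ⟨hpn, Or.inl hbp⟩)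
    rw [← e] at this
    simp [covered, hmp] at this

end

end TwoPM

namespace TwoPM

/-! ### Counting arguments -/

section Counting

variable {x y : ℕ → ℕ}

/-- The edges of `A` at the vertex `v`. -/
def inc (x y : ℕ → ℕ) (A : Finset ℕ) (v : ℕ) : Finset ℕ := A.filter fun e => x e = v ∨ y e = v

@[simp] theorem mem_inc {A : Finset ℕ} {v e : ℕ} :
    e ∈ inc x y A v ↔ e ∈ A ∧ (x e = v ∨ y e = v) := by simp [inc]

theorem inc_mono {A B : Finset ℕ} (h : A ⊆ B) (v : ℕ) : inc x y A v ⊆ inc x y B v :=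
  Finset.filter_subset_filter _ h

/-- Handshake counting. Loops have to be excluded, since `inc` would count them once only. -/
theorem sum_card_inc {A : Finset ℕ} (hxy : ∀ e ∈ A, x e ≠ y e) (X : Finset ℕ) :
    ∑ v ∈ X, (inc x y A v).card =
      ∑ e ∈ A, ((if x e ∈ X then 1 else 0) + if y e ∈ X then 1 else 0) := by
  have h : ∀ v ∈ X, (inc x y A v).card =
      ∑ e ∈ A, ((if x e = v then 1 else 0) + if y e = v then 1 else 0) := by
    intro v _
    rw [inc, Finset.card_filter]
    refine Finset.sum_congr rfl fun e he => ?_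
    have := hxy e he
    by_cases h1 : x e = v <;> by_cases h2 : y e = v
    · exact absurd (h1.trans h2.symm) this
    all_goals simp [h1, h2]
  rw [Finset.sum_congr rfl h, Finset.sum_comm]
  refine Finset.sum_congr rfl fun e _ => ?_
  rw [Finset.sum_add_distrib, Finset.sum_ite_eq, Finset.sum_ite_eq]

/-- The edges of `A` with exactly one end in `X`. -/
def cut (x y : ℕ → ℕ) (A X : Finset ℕ) : Finset ℕ :=
  A.filter fun e => ¬(x e ∈ X ↔ y e ∈ X)

/-- The edges of `A` with both ends in `X`. -/
def inside (x y : ℕ → ℕ) (A X : Finset ℕ) : Finset ℕ :=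
  A.filter fun e => x e ∈ X ∧ y e ∈ X

theorem sum_card_inc_eq_cut {A : Finset ℕ} (hxy : ∀ e ∈ A, x e ≠ y e) (X : Finset ℕ) :
    ∑ v ∈ X, (inc x y A v).card = 2 * (inside x y A X).card + (cut x y A X).card := by
  rw [sum_card_inc hxy, inside, cut, Finset.card_filter, Finset.card_filter, Finset.mul_sum,
    ← Finset.sum_add_distrib]
  refine Finset.sum_congr rfl fun e _ => ?_
  by_cases h1 : x e ∈ X <;> by_cases h2 : y e ∈ X <;> simp [h1, h2]

/-- No edge leads from an outer vertex to an unlabelled vertex or to another blossom. -/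
def Stuck (n : ℕ) (adj : ℕ → ℕ → Prop) (base lab : ℕ → ℕ) : Prop :=
  ∀ a < n, ∀ b < n, adj a b → lab a = 1 → lab b ≠ 2 → base a = base b

variable {n : ℕ} {mate base lab par dep : ℕ → ℕ} {A : Finset ℕ}

/-- Partners pair the inner vertices with the outer bases that are not exposed, and every exposed
vertex is an outer base. -/
theorem Forest.card_outer (h : Forest n (AdjBy x y A) mate base lab par dep) :
    ((Finset.range n).filter fun v => lab v = 1 ∧ base v = v).card =
      ((Finset.range n).filter fun v => lab v = 2).card +
        ((Finset.range n).filter fun v => mate v = v).card := by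
  have h1 : ((Finset.range n).filter fun v => lab v = 2).card =
      ((Finset.range n).filter fun v => (lab v = 1 ∧ base v = v) ∧ mate v ≠ v).card := by
    refine Finset.card_nbij' mate mate ?_ ?_ ?_ ?_
    · intro v hv
      simp only [Finset.coe_filter, Finset.mem_range, Set.mem_ofPred_eq] at hv ⊢
      obtain ⟨g1, g2⟩ := h.mate_inner v hv.1 hv.2
      refine ⟨h.mate_lt v hv.1, ⟨g1, g2⟩, ?_⟩
      rw [h.mate_mate v hv.1]
      exact (h.mate_ne_of_inner hv.1 hv.2).symm
    · intro v hv
      simp only [Finset.coe_filter, Finset.mem_range, Set.mem_ofPred_eq] at hv ⊢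
      exact ⟨h.mate_lt v hv.1, h.mate_base v hv.1 hv.2.1.1 hv.2.1.2 hv.2.2⟩
    · intro v hv
      simp only [Finset.coe_filter, Finset.mem_range, Set.mem_ofPred_eq] at hv
      exact h.mate_mate v hv.1
    · intro v hv
      simp only [Finset.coe_filter, Finset.mem_range, Set.mem_ofPred_eq] at hv
      exact h.mate_mate v hv.1
  have h2 : ((Finset.range n).filter fun v => mate v = v) =
      (Finset.range n).filter fun v => (lab v = 1 ∧ base v = v) ∧ ¬ mate v ≠ v := by
    refine Finset.filter_congr fun v hv => ?_
    rw [Finset.mem_range] at hv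
    simp only [ne_eq, not_not, iff_and_self]
    intro hm
    refine ⟨?_, by_contra fun hb => (h.mate_absorbed v hv hb).1 hm⟩
    have h0 : lab v ≠ 0 := fun e => (h.mate_unlabelled v hv e).1 hm
    have h2 : lab v ≠ 2 := fun e => h.mate_ne_of_inner hv e hm
    have := h.lab_le v hv
    omega
  have h3 := Finset.card_filter_add_card_filter_not
    (s := (Finset.range n).filter fun v => lab v = 1 ∧ base v = v) (fun v => mate v ≠ v)
  rw [Finset.filter_filter, Finset.filter_filter] at h3
  rw [h1, h2, h3]

theorem card_covered_add (n : ℕ) (mate : ℕ → ℕ) :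
    ((Finset.range n).filter fun v => mate v = v).card + (covered n mate).card = n := by
  have := Finset.card_filter_add_card_filter_not (s := Finset.range n) (fun v => mate v = v)
  simpa [covered] using this

/-- A stuck forest shows that the matching is maximum. -/
theorem Forest.card_le (h : Forest n (AdjBy x y A) mate base lab par dep)
    (hA : ∀ e ∈ A, x e < n ∧ y e < n ∧ x e ≠ y e) (hs : Stuck n (AdjBy x y A) base lab)
    {N : Finset ℕ} (hNA : N ⊆ A) (hN : IsMatching x y N) :
    2 * N.card ≤ (covered n mate).card := by
  set O := (Finset.range n).filter fun v => lab v = 1 ∧ base v = v with hO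
  set I := (Finset.range n).filter fun v => lab v = 2 with hI
  have hsub : ends x y N ⊆ Finset.range n := by
    intro v hv
    obtain ⟨e, he, rfl | rfl⟩ := mem_ends.1 hv
    · exact Finset.mem_range.2 (hA e (hNA he)).1
    · exact Finset.mem_range.2 (hA e (hNA he)).2.1
  have hcard := hN.card_ends fun e he => (hA e (hNA he)).2.2
  set W := Finset.range n \ ends x y N with hW
  have hWc : W.card + 2 * N.card = n := by
    rw [← hcard, hW, Finset.card_sdiff_add_card_eq_card hsub, Finset.card_range]
  -- By parity, `N` cannot match an odd blossom within itself. It misses a vertex of the blossom or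
  -- has an edge leaving it, which ends in an inner vertex as the forest is stuck.
  have key : ∀ b ∈ O, ∃ t, (t ∈ W ∧ base t = b) ∨ (t ∈ I ∧ ∃ z < n, base z = b ∧
      ∃ e ∈ N, (x e = z ∧ y e = t) ∨ (x e = t ∧ y e = z)) := by
    intro b hb
    simp only [hO, Finset.mem_filter, Finset.mem_range] at hb
    obtain ⟨hbn, hlb, hbb⟩ := hb
    by_contra hcon
    push Not at hcon
    have hodd := (h.factorCritical b hbn).odd_card (mem_blob.2 ⟨hbn, hbb⟩)
    have hlabZ : ∀ z < n, base z = b → lab z = 1 := fun z hz e => by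
      rw [← h.lab_base z hz, e, hlb]
    have heven : Even (blob n base b).card := by
      refine hN.even_card (fun e he => (hA e (hNA he)).2.2) ?_ ?_
      · intro z hz
        rw [mem_blob] at hz
        by_contra hz'
        exact (hcon z).1 (by simp [hW, hz.1, hz']) hz.2
      · have cross : ∀ z < n, ∀ t < n, base z = b → AdjBy x y A z t → (∃ e ∈ N,
            (x e = z ∧ y e = t) ∨ (x e = t ∧ y e = z)) → base t = b := by
          intro z hz t ht hb hzt he
          by_contra hbt
          have hlt : lab t = 2 := by
            by_contra hl
            exact hbt ((hs z hz t ht hzt (hlabZ z hz hb) hl).symm.trans hb)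
          obtain ⟨e, he, h'⟩ := he
          rcases (hcon t).2 (by simp [hI, ht, hlt]) z hz hb e he with ⟨g1, g2⟩
          tauto
        intro e he
        obtain ⟨h1, h2, -⟩ := hA e (hNA he)
        simp only [mem_blob, h1, h2, true_and]
        constructor
        · intro hb
          exact cross _ h1 _ h2 hb ⟨e, hNA he, Or.inl ⟨rfl, rfl⟩⟩ ⟨e, he, Or.inl ⟨rfl, rfl⟩⟩
        · intro hb
          exact cross _ h2 _ h1 hb ⟨e, hNA he, Or.inr ⟨rfl, rfl⟩⟩ ⟨e, he, Or.inr ⟨rfl, rfl⟩⟩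
    exact Nat.not_even_iff_odd.2 hodd heven
  choose! g hg using key
  have hcov : ∀ t, t ∈ W → ∀ e ∈ N, x e ≠ t ∧ y e ≠ t := by
    intro t ht e he
    simp only [hW, Finset.mem_sdiff, mem_ends, not_exists, not_and, not_or] at ht
    exact ⟨Ne.symm (ht.2 e he).1, Ne.symm (ht.2 e he).2⟩
  -- The witnesses differ for different blossoms: an uncovered vertex determines its blossom by its
  -- base, an inner one by the other end of its only edge in `N`, and no vertex is a witness of both
  -- kinds.
  have hle : O.card ≤ (W ∪ I).card := by
    refine Finset.card_le_card_of_injOn g ?_ ?_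
    · intro b hb
      rcases hg b hb with h1 | h1
      · exact Finset.mem_coe.2 (Finset.mem_union_left _ h1.1)
      · exact Finset.mem_coe.2 (Finset.mem_union_right _ h1.1)
    · intro b hb b' hb' e
      rcases hg b hb with ⟨h1, h2⟩ | ⟨h1, z, hz, hbz, f, hf, hzf⟩ <;>
        rcases hg b' hb' with ⟨h1', h2'⟩ | ⟨h1', z', hz', hbz', f', hf', hzf'⟩
      · rw [← h2, ← h2', e]
      · have := hcov _ h1 f' hf'
        rw [e] at this
        tauto
      · have := hcov _ h1' f hf
        rw [← e] at this
        tauto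
      · rw [← e] at hzf'
        have hff : f = f' := by
          by_contra hne
          have := hN f hf f' hf' hne
          grind
        subst hff
        have hne := (hA f (hNA hf)).2.2
        have : z = z' := by grind
        rw [← hbz, ← hbz', this]
  have h1 : O.card = I.card + _ := h.card_outer
  have h2 := card_covered_add n mate
  have h3 := Finset.card_union_le W I
  omega

/-- In a graph with all degrees three, a maximum matching leaves at most a fifth of the
vertices exposed. -/
theorem Forest.five_mul_exposed_le (h : Forest n (AdjBy x y A) mate base lab par dep)
    (hA : ∀ e ∈ A, x e < n ∧ y e < n ∧ x e ≠ y e) (hs : Stuck n (AdjBy x y A) base lab)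
    (hd : ∀ v < n, (inc x y A v).card = 3) :
    5 * ((Finset.range n).filter fun v => mate v = v).card ≤ n := by
  set O := (Finset.range n).filter fun v => lab v = 1 ∧ base v = v with hO
  set I := (Finset.range n).filter fun v => lab v = 2 with hI
  have hOi : ∀ b ∈ O, b < n ∧ lab b = 1 ∧ base b = b := fun b hb => by simpa [hO] using hb
  have hlabZ : ∀ b ∈ O, ∀ z ∈ blob n base b, lab z = 1 := fun b hb z hz => by
    rw [mem_blob] at hz
    rw [← h.lab_base z hz.1, hz.2, (hOi b hb).2.1]
  have hcut : ∀ b ∈ O, ∀ e ∈ cut x y A (blob n base b),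
      (x e ∈ blob n base b ∧ y e ∈ I) ∨ (y e ∈ blob n base b ∧ x e ∈ I) := by
    intro b hb e he
    simp only [cut, Finset.mem_filter] at he
    obtain ⟨h1, h2, -⟩ := hA e he.1
    have aux : ∀ z t, z < n → t < n → AdjBy x y A z t → z ∈ blob n base b →
        t ∉ blob n base b → t ∈ I := by
      intro z t hz ht hzt hzb htb
      simp only [hI, Finset.mem_filter, Finset.mem_range]
      refine ⟨ht, by_contra fun hl => htb ?_⟩
      rw [mem_blob, ← hs z hz t ht hzt (hlabZ b hb z hzb) hl]
      exact ⟨ht, (mem_blob.1 hzb).2⟩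
    by_cases hx : x e ∈ blob n base b
    · exact Or.inl ⟨hx, aux _ _ h1 h2 ⟨e, he.1, Or.inl ⟨rfl, rfl⟩⟩ hx (by tauto)⟩
    · have hy : y e ∈ blob n base b := by tauto
      exact Or.inr ⟨hy, aux _ _ h2 h1 ⟨e, he.1, Or.inr ⟨rfl, rfl⟩⟩ hy hx⟩
  have hlI : ∀ z ∈ I, lab z = 2 := fun z hz => by
    simp only [hI, Finset.mem_filter] at hz
    exact hz.2
  -- Edges leaving outer blossoms end in inner vertices, each of degree three. No edge leaves two of
  -- these blossoms, because its other end is inner.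
  have hcuts : ∑ b ∈ O, (cut x y A (blob n base b)).card ≤ 3 * I.card := by
    rw [← Finset.card_biUnion]
    · have hsub : (O.biUnion fun b => cut x y A (blob n base b)) ⊆ I.biUnion (inc x y A) := by
        intro e he
        obtain ⟨b, hb, he⟩ := Finset.mem_biUnion.1 he
        have heA : e ∈ A := Finset.mem_of_mem_filter e he
        rcases hcut b hb e he with h1 | h1
        · exact Finset.mem_biUnion.2 ⟨_, h1.2, mem_inc.2 ⟨heA, Or.inr rfl⟩⟩
        · exact Finset.mem_biUnion.2 ⟨_, h1.2, mem_inc.2 ⟨heA, Or.inl rfl⟩⟩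
      refine (Finset.card_le_card hsub).trans ?_
      rw [mul_comm]
      refine Finset.card_biUnion_le_card_mul _ _ _ fun v hv => ?_
      simp only [hI, Finset.mem_filter, Finset.mem_range] at hv
      exact (hd v hv.1).le
    · intro b hb b' hb' hne
      refine Finset.disjoint_left.2 fun e he he' => hne ?_
      rcases hcut b hb e he with ⟨h1, h2⟩ | ⟨h1, h2⟩ <;>
        rcases hcut b' hb' e he' with ⟨h1', h2'⟩ | ⟨h1', h2'⟩
      · rw [← (mem_blob.1 h1).2, ← (mem_blob.1 h1').2]
      · have := hlabZ b hb _ h1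
        rw [hlI _ h2'] at this
        omega
      · have := hlabZ b hb _ h1
        rw [hlI _ h2'] at this
        omega
      · rw [← (mem_blob.1 h1).2, ← (mem_blob.1 h1').2]
  -- The degree sum of an odd blossom is odd, hence so is its cut. A single vertex has cut 3, giving
  -- 2 * 3 + 1, and three or more vertices with cut at least 1 give at least 2 + 3.
  have hblob : ∀ b ∈ O, 5 ≤ 2 * (cut x y A (blob n base b)).card + (blob n base b).card := by
    intro b hb
    obtain ⟨hbn, -, hbb⟩ := hOi b hb
    obtain ⟨k, hk⟩ := (h.factorCritical b hbn).odd_card (mem_blob.2 ⟨hbn, hbb⟩)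
    have hsum := sum_card_inc_eq_cut (fun e he => (hA e he).2.2) (blob n base b)
    rw [Finset.sum_congr rfl fun v hv => hd v (mem_blob.1 hv).1, Finset.sum_const,
      smul_eq_mul] at hsum
    rcases Nat.eq_zero_or_pos k with rfl | hk0
    · have h0 : inside x y A (blob n base b) = ∅ := by
        refine Finset.filter_eq_empty_iff.2 fun e he hxy => (hA e he).2.2 ?_
        obtain ⟨a, ha⟩ := Finset.card_eq_one.1 (by simpa using hk)
        rw [ha, Finset.mem_singleton, Finset.mem_singleton] at hxy
        rw [hxy.1, hxy.2]
      rw [h0, Finset.card_empty] at hsum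
      omega
    · omega
  have hblobs : I.card + ∑ b ∈ O, (blob n base b).card ≤ n := by
    rw [← Finset.card_biUnion, ← Finset.card_union_of_disjoint]
    · refine (Finset.card_le_card (t := Finset.range n) ?_).trans (Finset.card_range n).le
      refine Finset.union_subset (Finset.filter_subset _ _) (Finset.biUnion_subset.2 ?_)
      exact fun b _ => Finset.filter_subset _ _
    · refine Finset.disjoint_left.2 fun z hz hz' => ?_
      obtain ⟨b, hb, hz'⟩ := Finset.mem_biUnion.1 hz'
      have := hlabZ b hb z hz'
      rw [hlI z hz] at this
      omega
    · intro b _ b' _ hne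
      refine Finset.disjoint_left.2 fun z hz hz' => hne ?_
      rw [← (mem_blob.1 hz).2, ← (mem_blob.1 hz').2]
  -- Summing gives 5|O| ≤ 6|I| + (n - |I|) = 5|I| + n, and |O| - |I| is the number of exposed
  -- vertices.
  have hsum := Finset.sum_le_sum hblob
  rw [Finset.sum_const, smul_eq_mul, Finset.sum_add_distrib, ← Finset.mul_sum] at hsum
  have : O.card = I.card + _ := h.card_outer
  omega

end Counting

/-! ### Saturating assignments of edges to vertices -/

section Saturable

variable {x y : ℕ → ℕ}

/-- The vertices of `V` can be assigned distinct incident edges from `F`. -/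
def Saturable (x y : ℕ → ℕ) (V F : Finset ℕ) : Prop :=
  ∃ f : ℕ → ℕ, Set.InjOn f V ∧ ∀ v ∈ V, f v ∈ inc x y F v

/-- Hall's theorem: the edges meeting X number at least half the degree sum over X. By parity a
deficit of one in the degree sum is harmless, and this is what allows one edge to be deleted later.
-/
theorem saturable_of_sum {V F : Finset ℕ} (hxy : ∀ e ∈ F, x e ≠ y e)
    (h : ∀ X ⊆ V, 2 * X.card ≤ ∑ v ∈ X, (inc x y F v).card + 1) : Saturable x y V F := by
  classical
  have hall : ∀ s : Finset {v // v ∈ V},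
      s.card ≤ (s.biUnion fun v => inc x y F v.1).card := by
    intro s
    have h1 := h (s.map ⟨Subtype.val, Subtype.val_injective⟩) (fun v hv => by
      obtain ⟨w, -, rfl⟩ := Finset.mem_map.1 hv
      exact w.2)
    rw [sum_card_inc hxy, Finset.card_map] at h1
    set X := s.map ⟨Subtype.val, Subtype.val_injective⟩ with hX
    have h2 : ∑ e ∈ F, ((if x e ∈ X then 1 else 0) + if y e ∈ X then 1 else 0) ≤
        2 * (s.biUnion fun v => inc x y F v.1).card := by
      have h3 : (s.biUnion fun v => inc x y F v.1) =
          F.filter fun e => x e ∈ X ∨ y e ∈ X := by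
        ext e
        simp only [Finset.mem_biUnion, mem_inc, Finset.mem_filter, hX, Finset.mem_map,
          Function.Embedding.coeFn_mk]
        constructor
        · rintro ⟨v, hv, he, h' | h'⟩
          · exact ⟨he, Or.inl ⟨v, hv, h'.symm⟩⟩
          · exact ⟨he, Or.inr ⟨v, hv, h'.symm⟩⟩
        · rintro ⟨he, ⟨v, hv, h'⟩ | ⟨v, hv, h'⟩⟩
          · exact ⟨v, hv, he, Or.inl h'.symm⟩
          · exact ⟨v, hv, he, Or.inr h'.symm⟩
      rw [h3, Finset.card_filter, Finset.mul_sum]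
      refine Finset.sum_le_sum fun e _ => ?_
      by_cases g1 : x e ∈ X <;> by_cases g2 : y e ∈ X <;> simp [g1, g2]
    omega
  obtain ⟨f, hf, hm⟩ := (Finset.all_card_le_biUnion_card_iff_exists_injective _).1 hall
  refine ⟨fun v => if hv : v ∈ V then f ⟨v, hv⟩ else 0, ?_, ?_⟩
  · intro v hv w hw e
    rw [Finset.mem_coe] at hv hw
    simp only [hv, hw, dif_pos] at e
    exact congrArg Subtype.val (hf e)
  · intro v hv
    simp only [hv, dif_pos]
    exact hm ⟨v, hv⟩

/-- The vertices `V` and edges `B` remain after removing vertices of degree one from a graph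
with vertices below `n` and edges `F`. -/
structure Peeling (n : ℕ) (x y : ℕ → ℕ) (F V B : Finset ℕ) : Prop where
  vertices : V ⊆ Finset.range n
  edges : B ⊆ F
  closed : ∀ e ∈ B, x e ∈ V ∧ y e ∈ V
  card : B.card + n = V.card + F.card
  saturable : Saturable x y V B
  extend : ∀ C ⊆ B, Saturable x y V C → Saturable x y (Finset.range n) (F \ (B \ C))

variable {n : ℕ} {F V B : Finset ℕ}

theorem Peeling.init (hF : ∀ e ∈ F, x e < n ∧ y e < n ∧ x e ≠ y e)
    (hs : Saturable x y (Finset.range n) F) : Peeling n x y F (Finset.range n) F where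
  vertices := subset_rfl
  edges := subset_rfl
  closed e he := by simpa using ⟨(hF e he).1, (hF e he).2.1⟩
  card := by rw [Finset.card_range, add_comm]
  saturable := hs
  extend C hC h := by rwa [Finset.sdiff_sdiff_eq_self hC]

/-- The only edge at `v` is necessarily the one assigned to `v`. The other assignments therefore
survive its removal, and conversely any assignment of the remaining graph extends by giving this
edge to `v`. -/
theorem Peeling.step (h : Peeling n x y F V B) {v e : ℕ} (hv : v ∈ V)
    (he : inc x y B v = {e}) : Peeling n x y F (V.erase v) (B.erase e) := by
  have heB : e ∈ inc x y B v := by simp [he]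
  have heB' := (mem_inc.1 heB).1
  refine ⟨(Finset.erase_subset _ _).trans h.vertices, (Finset.erase_subset _ _).trans h.edges,
    ?_, ?_, ?_, ?_⟩
  · intro f hf
    rw [Finset.mem_erase] at hf
    have hfv : ¬(x f = v ∨ y f = v) := fun h' => hf.1 (by
      have : f ∈ inc x y B v := mem_inc.2 ⟨hf.2, h'⟩
      simpa [he] using this)
    push Not at hfv
    exact ⟨Finset.mem_erase.2 ⟨hfv.1, (h.closed f hf.2).1⟩,
      Finset.mem_erase.2 ⟨hfv.2, (h.closed f hf.2).2⟩⟩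
  · have h1 := Finset.card_erase_add_one hv
    have h2 := Finset.card_erase_add_one heB'
    have h3 := h.card
    omega
  · obtain ⟨f, hf, hm⟩ := h.saturable
    refine ⟨f, hf.mono (by simp), fun u hu => ?_⟩
    rw [Finset.mem_erase] at hu
    have h1 := mem_inc.1 (hm u hu.2)
    refine mem_inc.2 ⟨Finset.mem_erase.2 ⟨fun e' => hu.1 ?_, h1.1⟩, h1.2⟩
    have h2 := hm v hv
    rw [he, Finset.mem_singleton] at h2
    exact hf hu.2 hv (e'.trans h2.symm)
  · rintro C hC ⟨f, hf, hm⟩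
    have hCe : e ∉ C := fun h' => by simpa using hC h'
    have hset : B.erase e \ C = B \ insert e C := by
      ext g
      simp only [Finset.mem_sdiff, Finset.mem_erase, Finset.mem_insert]
      tauto
    rw [hset]
    refine h.extend _ (Finset.insert_subset heB' (hC.trans (Finset.erase_subset _ _))) ?_
    have hfu : ∀ u ∈ V, u ≠ v → f u ∈ C := fun u hu hne =>
      (mem_inc.1 (hm u (Finset.mem_erase.2 ⟨hne, hu⟩))).1
    refine ⟨Function.update f v e, ?_, ?_⟩
    · intro u hu w hw huw
      by_cases h1 : u = v <;> by_cases h2 : w = v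
      · rw [h1, h2]
      · rw [h1, Function.update_self, Function.update_of_ne h2] at huw
        exact absurd (huw ▸ hfu w hw h2) hCe
      · rw [h2, Function.update_self, Function.update_of_ne h1] at huw
        exact absurd (huw ▸ hfu u hu h1) hCe
      · rw [Function.update_of_ne h1, Function.update_of_ne h2] at huw
        exact hf (Finset.mem_coe.2 (Finset.mem_erase.2 ⟨h1, hu⟩))
          (Finset.mem_coe.2 (Finset.mem_erase.2 ⟨h2, hw⟩)) huw
    · intro u hu
      by_cases h1 : u = v
      · rw [h1, Function.update_self]
        exact mem_inc.2 ⟨Finset.mem_insert_self _ _, (mem_inc.1 heB).2⟩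
      · rw [Function.update_of_ne h1]
        exact inc_mono (Finset.subset_insert _ _) _ (hm u (Finset.mem_erase.2 ⟨h1, hu⟩))

theorem Peeling.two_le (h : Peeling n x y F V B) (hp : ∀ v ∈ V, (inc x y B v).card ≠ 1) :
    ∀ v ∈ V, 2 ≤ (inc x y B v).card := by
  intro v hv
  obtain ⟨f, -, hm⟩ := h.saturable
  have h1 := Finset.card_pos.2 ⟨_, hm v hv⟩
  have h2 := hp v hv
  omega

/-- After peeling, an edge at a vertex of degree three can be removed. -/
theorem Peeling.saturable_erase (h : Peeling n x y F V B) (hF : ∀ e ∈ F, x e ≠ y e)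
    (hp : ∀ v ∈ V, (inc x y B v).card ≠ 1) {v e : ℕ} (h3 : 3 ≤ (inc x y B v).card)
    (he : e ∈ inc x y B v) : Saturable x y (Finset.range n) (F.erase e) := by
  have heB := (mem_inc.1 he).1
  have h2 := h.two_le hp
  have hset : F \ (B \ B.erase e) = F.erase e := by
    ext g
    simp only [Finset.mem_sdiff, Finset.mem_erase]
    constructor
    · rintro ⟨g1, g2⟩
      exact ⟨fun e' => g2 ⟨e' ▸ heB, fun g3 => g3.1 e'⟩, g1⟩
    · rintro ⟨g1, g2⟩
      exact ⟨g2, fun g3 => g3.2 ⟨g1, g3.1⟩⟩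
  rw [← hset]
  refine h.extend _ (Finset.erase_subset _ _) (saturable_of_sum
    (fun f hf => hF f (h.edges (Finset.mem_of_mem_erase hf))) fun X hX => ?_)
  -- Here `w` is the other end of `e`. All degrees were at least two and that of `v` at least three,
  -- so after deleting `e` only `w` may have degree one, a deficit that `saturable_of_sum`
  -- tolerates.
  obtain ⟨w, hw⟩ : ∃ w, ∀ u, (x e = u ∨ y e = u) → u = v ∨ u = w := by
    rcases (mem_inc.1 he).2 with h' | h'
    · exact ⟨y e, fun u hu => hu.imp (fun a => a.symm.trans h') Eq.symm⟩
    · exact ⟨x e, fun u hu => hu.symm.imp (fun a => a.symm.trans h') Eq.symm⟩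
  have hu : ∀ u ∈ X, 2 ≤ (inc x y (B.erase e) u).card + if u = w then 1 else 0 := by
    intro u hu
    have g1 := h2 u (hX hu)
    have g2 : inc x y (B.erase e) u = (inc x y B u).erase e := by
      ext g
      simp only [mem_inc, Finset.mem_erase]
      tauto
    rw [g2]
    by_cases hue : e ∈ inc x y B u
    · have g3 := Finset.card_erase_add_one hue
      rcases hw u (mem_inc.1 hue).2 with rfl | rfl
      · split_ifs <;> omega
      · rw [if_pos rfl]
        omega
    · rw [Finset.erase_eq_of_notMem hue]
      split_ifs <;> omega
  have hsum := Finset.sum_le_sum hu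
  rw [Finset.sum_const, smul_eq_mul, Finset.sum_add_distrib, Finset.sum_ite_eq'] at hsum
  split_ifs at hsum <;> omega

/-- The remaining graph is 2-regular, so it has as many edges as vertices. Peeling preserves the
difference between the two numbers. -/
theorem Peeling.card_eq (h : Peeling n x y F V B) (hF : ∀ e ∈ F, x e ≠ y e)
    (hp : ∀ v ∈ V, (inc x y B v).card ≠ 1) (h3 : ∀ v ∈ V, (inc x y B v).card < 3) :
    F.card = n := by
  have h2 := h.two_le hp
  have h1 : ∑ v ∈ V, (inc x y B v).card = 2 * V.card := by
    rw [Finset.sum_congr rfl fun v hv =>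
      show (inc x y B v).card = 2 by have := h2 v hv; have := h3 v hv; omega,
      Finset.sum_const, smul_eq_mul, mul_comm]
  rw [sum_card_inc fun e he => hF e (h.edges he),
    Finset.sum_congr rfl fun e he => show _ = 2 by
      rw [if_pos (h.closed e he).1, if_pos (h.closed e he).2],
    Finset.sum_const, smul_eq_mul] at h1
  have := h.card
  omega

end Saturable

end TwoPM

namespace TwoPM

/-! ### The search for an augmentation -/

-- Registers `0` and `1` hold the lengths of input and output. Counters of nested loops are kept
-- distinct, since `wf` forbids a body to write the counter of its own loop.
notation "R_n" => 2
notation "R_m" => 3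
notation "R_i" => 4
notation "R_e" => 5
notation "R_a" => 6
notation "R_b" => 7
notation "R_found" => 8
notation "R_rec" => 9
notation "R_v" => 10
notation "R_w" => 11
notation "R_p" => 12
notation "R_q" => 13
notation "R_t" => 14
notation "R_j" => 15
notation "R_k" => 16
notation "R_g" => 17
notation "R_cnt" => 18
notation "R_last" => 19
notation "R_off" => 21

-- Array `0` is the input. Ends of edges are in `A_x` and `A_y`, the current matching in `A_inM`,
-- the edges admitted to the search in `A_act`, and the vertices and edges not yet peeled in `A_av`
-- and `A_ae`.
notation "A_out" => 1
notation "A_x" => 2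
notation "A_y" => 3
notation "A_inM" => 4
notation "A_act" => 5
notation "A_mate" => 6
notation "A_base" => 7
notation "A_lab" => 8
notation "A_par" => 9
notation "A_dep" => 10
notation "A_mark" => 11
notation "A_cov" => 12
notation "A_av" => 13
notation "A_ae" => 14

infixr:60 " ;; " => Cmd.seq

section Programs

open Cmd TwoPM.Expr

/-- Make every vertex exposed and a blossom of its own. -/
def initVertices : Cmd :=
  loop R_i R_n
    (store A_mate (var R_i) (var R_i) ;; store A_base (var R_i) (var R_i) ;;
      store A_dep (var R_i) (const 0))

/-- Link the partners of the matching `A_inM`. -/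
def linkMates : Cmd :=
  loop R_e R_m
    (ite (get A_inM (var R_e))
      (store A_mate (get A_x (var R_e)) (get A_y (var R_e)) ;;
        store A_mate (get A_y (var R_e)) (get A_x (var R_e)))
      skip)

/-- Label the exposed vertices. -/
def initLabels : Cmd :=
  loop R_i R_n (store A_lab (var R_i) (eq (get A_mate (var R_i)) (var R_i)))

/-- Set up the partners of the matching `A_inM` and the initial forest. -/
def initForest : Cmd := initVertices ;; linkMates ;; initLabels

/-- Record the pair of `R_a` and `R_b` if the forest can be extended along it. -/
def checkPair : Cmd :=
  ite (eq (get A_lab (var R_a)) (const 1))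
    (ite (eq (get A_lab (var R_b)) (const 2)) skip
      (ite (eq (get A_base (var R_a)) (get A_base (var R_b))) skip
        (assign R_rec (const 1) ;; assign R_v (var R_a) ;; assign R_w (var R_b))))
    skip

/-- Look for an edge along which the forest can be extended. -/
def scanEdges : Cmd :=
  loop R_e R_m
    (ite (get A_act (var R_e))
      ((assign R_a (get A_x (var R_e)) ;; assign R_b (get A_y (var R_e)) ;; checkPair) ;;
        (assign R_a (get A_y (var R_e)) ;; assign R_b (get A_x (var R_e)) ;; checkPair))
      skip)

/-- Find an edge along which the forest can be extended. -/
def findEdge : Cmd := assign R_rec (const 0) ;; scanEdges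

/-- Add the unlabelled vertex `R_w` and its partner to the forest. -/
def growForest : Cmd :=
  store A_lab (var R_w) (const 2) ;;
  store A_par (var R_w) (var R_v) ;;
  store A_dep (get A_mate (var R_w)) (add (get A_dep (get A_base (var R_v))) (const 1)) ;;
  store A_lab (get A_mate (var R_w)) (const 1)

/-- Mark the blossom of `p` and the inner vertex above it, and move `p` up. -/
def climbFrom (p : ℕ) : Cmd :=
  store A_mark (var p) (const 1) ;;
  store A_mark (get A_mate (var p)) (const 1) ;;
  assign p (get A_base (get A_par (get A_mate (var p))))

/-- Reset the marks. -/
def resetMarks : Cmd := loop R_i R_n (store A_mark (var R_i) (const 0))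

/-- Move the deeper one of `R_p` and `R_q` up, unless they agree or both are roots. -/
def climbStep : Cmd :=
  ite (eq (var R_p) (var R_q)) skip
    (ite (lt (get A_dep (var R_p)) (get A_dep (var R_q))) (climbFrom R_q)
      (ite (get A_dep (var R_p)) (climbFrom R_p) skip))

/-- Climb from `R_p` and `R_q` until the paths meet or both roots are reached. -/
def climbLoop : Cmd := loop R_j 0 climbStep

/-- Climb from the ends of the recorded edge. -/
def climb : Cmd :=
  resetMarks ;; assign R_p (get A_base (var R_v)) ;; assign R_q (get A_base (var R_w)) ;;
    climbLoop

/-- Merge the marked blossoms into that of `R_p`. -/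
def mergeMarked : Cmd :=
  loop R_i R_n
    (ite (eq (get A_mark (get A_base (var R_i))) (const 1))
      (store A_base (var R_i) (var R_p) ;; store A_lab (var R_i) (const 1))
      skip)

/-- One step of the forest search. -/
def searchStep : Cmd :=
  findEdge ;;
  ite (var R_rec)
    (ite (get A_lab (var R_w))
      (climb ;; ite (eq (var R_p) (var R_q)) mergeMarked (assign R_found (const 1)))
      growForest)
    skip

/-- Repeat `searchStep` until an augmentation is found. -/
def searchLoop : Cmd := loop R_t 0 (ite (var R_found) skip searchStep)

/-- Decide whether the matching `A_inM` is smaller than some matching inside `A_act`. -/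
def search : Cmd := initForest ;; assign R_found (const 0) ;; searchLoop

end Programs

/-- The graph with the vertices below `n` and the edges below `m` is stored. -/
structure Stored (n m : ℕ) (x y : ℕ → ℕ) (s : State) : Prop where
  reg_n : s.reg R_n = n
  reg_m : s.reg R_m = m
  arr_x : s.arr A_x = x
  arr_y : s.arr A_y = y
  two_mul_lt : 2 * n < s.reg 0
  lt_reg : m < s.reg 0
  valid : ∀ e < m, x e < n ∧ y e < n ∧ x e ≠ y e

/-- Commands that do not touch the stored graph. -/
def Cmd.keeps (c : Cmd) : Bool :=
  !c.setsReg 0 && !c.setsReg R_n && !c.setsReg R_m && !c.setsArr A_x && !c.setsArr A_y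

variable {n m : ℕ} {x y : ℕ → ℕ} {s : State}

theorem Stored.congr (h : Stored n m x y s) {s' : State} (h0 : s'.reg 0 = s.reg 0)
    (hn : s'.reg R_n = s.reg R_n) (hm : s'.reg R_m = s.reg R_m) (hx : s'.arr A_x = s.arr A_x)
    (hy : s'.arr A_y = s.arr A_y) : Stored n m x y s' :=
  ⟨hn.trans h.reg_n, hm.trans h.reg_m, hx.trans h.arr_x, hy.trans h.arr_y,
    h0 ▸ h.two_mul_lt, h0 ▸ h.lt_reg, h.valid⟩

theorem Stored.run (h : Stored n m x y s) (c : Cmd) (hc : c.keeps = true) :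
    Stored n m x y (c.run s) := by
  simp only [Cmd.keeps, Bool.and_eq_true, Bool.not_eq_true'] at hc
  exact h.congr (c.run_reg hc.1.1.1.1 s) (c.run_reg hc.1.1.1.2 s) (c.run_reg hc.1.1.2 s)
    (c.run_arr hc.1.2 s) (c.run_arr hc.2 s)

theorem Stored.le_reg (h : Stored n m x y s) : n ≤ s.reg 0 := by
  have := h.two_mul_lt
  omega

/-- The invariant rule for loops over the vertices of the stored graph. -/
theorem Stored.loop_vertices (h : Stored n m x y s) {r : ℕ} {c : Cmd}
    (hw : (Cmd.loop r R_n c).wf = true) (P : ℕ → State → Prop) (h0 : P 0 (s.setReg r 0))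
    (hs : ∀ i < n, ∀ s' : State, s'.reg r = i →
      (∀ r', (Cmd.loop r R_n c).setsReg r' = false → s'.reg r' = s.reg r') →
      (∀ b, (Cmd.loop r R_n c).setsArr b = false → s'.arr b = s.arr b) →
      P i s' → P (i + 1) ((c.run s').setReg r (i + 1))) :
    P n ((Cmd.loop r R_n c).run s) := by
  have hmin : min (s.reg R_n) (s.reg 0) = n := by
    rw [h.reg_n]
    exact min_eq_left h.le_reg
  have := Cmd.run_loop hw s P h0
  rw [hmin] at this
  exact this hs

/-- The invariant rule for loops over the edges of the stored graph. -/
theorem Stored.loop_edges (h : Stored n m x y s) {r : ℕ} {c : Cmd}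
    (hw : (Cmd.loop r R_m c).wf = true) (P : ℕ → State → Prop) (h0 : P 0 (s.setReg r 0))
    (hs : ∀ i < m, ∀ s' : State, s'.reg r = i →
      (∀ r', (Cmd.loop r R_m c).setsReg r' = false → s'.reg r' = s.reg r') →
      (∀ b, (Cmd.loop r R_m c).setsArr b = false → s'.arr b = s.arr b) →
      P i s' → P (i + 1) ((c.run s').setReg r (i + 1))) :
    P m ((Cmd.loop r R_m c).run s) := by
  have hmin : min (s.reg R_m) (s.reg 0) = m := by
    rw [h.reg_m]
    exact min_eq_left h.lt_reg.le
  have := Cmd.run_loop hw s P h0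
  rw [hmin] at this
  exact this hs

/-- The indices below `m` at which `a` is not zero. -/
def supp (m : ℕ) (a : ℕ → ℕ) : Finset ℕ := (Finset.range m).filter fun e => a e ≠ 0

@[simp] theorem mem_supp {a : ℕ → ℕ} {e : ℕ} : e ∈ supp m a ↔ e < m ∧ a e ≠ 0 := by
  simp [supp]

/-- `mate` gives the partners in the matching `M`. -/
structure IsMate (n : ℕ) (x y : ℕ → ℕ) (M : Finset ℕ) (mate : ℕ → ℕ) : Prop where
  edge : ∀ e ∈ M, mate (x e) = y e ∧ mate (y e) = x e
  exposed : ∀ v < n, v ∉ ends x y M → mate v = v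

section

variable {M A : Finset ℕ} {mate : ℕ → ℕ}

theorem IsMate.cases (h : IsMate n x y M mate) {v : ℕ} (hv : v < n) :
    mate v = v ∨ ∃ e ∈ M, (x e = v ∧ y e = mate v) ∨ (x e = mate v ∧ y e = v) := by
  by_cases hm : v ∈ ends x y M
  · obtain ⟨e, he, rfl | rfl⟩ := mem_ends.1 hm
    · exact Or.inr ⟨e, he, Or.inl ⟨rfl, (h.edge e he).1.symm⟩⟩
    · exact Or.inr ⟨e, he, Or.inr ⟨(h.edge e he).2.symm, rfl⟩⟩
  · exact Or.inl (h.exposed v hv hm)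

/-- Parents may be arbitrary, as there are no inner vertices yet. Values left over from an earlier
search do no harm. -/
theorem IsMate.forest (h : IsMate n x y M mate) (hM : ∀ e ∈ M, x e < n ∧ y e < n)
    (hMA : M ⊆ A) {base lab par dep : ℕ → ℕ} (hbase : ∀ v < n, base v = v)
    (hlab : ∀ v < n, lab v = if mate v = v then 1 else 0) (hdep : ∀ v < n, dep v = 0) :
    Forest n (AdjBy x y A) mate base lab par dep := by
  refine Forest.init (fun a b => AdjBy.symm) ?_ ?_ ?_ hbase hlab hdep
  · intro v hv
    rcases h.cases hv with e | ⟨e, he, ⟨-, h1⟩ | ⟨h1, -⟩⟩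
    · rwa [e]
    · rw [← h1]
      exact (hM e he).2
    · rw [← h1]
      exact (hM e he).1
  · intro v hv
    rcases h.cases hv with e | ⟨e, he, ⟨h1, h2⟩ | ⟨h1, h2⟩⟩
    · rw [e, e]
    · rw [← h2, (h.edge e he).2, h1]
    · rw [← h1, (h.edge e he).1, h2]
  · intro v hv hne
    rcases h.cases hv with e | ⟨e, he, h1⟩
    · exact absurd e hne
    · exact ⟨e, hMA he, h1⟩

theorem IsMate.card_covered (h : IsMate n x y M mate) (hm : IsMatching x y M)
    (hM : ∀ e ∈ M, x e < n ∧ y e < n ∧ x e ≠ y e) :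
    (covered n mate).card = 2 * M.card := by
  rw [← hm.card_ends fun e he => (hM e he).2.2]
  congr 1
  ext v
  simp only [covered, Finset.mem_filter, Finset.mem_range]
  constructor
  · rintro ⟨hv, hne⟩
    by_contra hv'
    exact hne (h.exposed v hv hv')
  · intro hv
    obtain ⟨e, he, rfl | rfl⟩ := mem_ends.1 hv
    · refine ⟨(hM e he).1, ?_⟩
      rw [(h.edge e he).1]
      exact (hM e he).2.2.symm
    · refine ⟨(hM e he).2.1, ?_⟩
      rw [(h.edge e he).2]
      exact (hM e he).2.2

end

theorem initForest_run (h : Stored n m x y s)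
    (hM : IsMatching x y (supp m (s.arr A_inM))) :
    IsMate n x y (supp m (s.arr A_inM)) ((initForest.run s).arr A_mate) ∧
    (∀ v < n, (initForest.run s).arr A_base v = v) ∧
    (∀ v < n, (initForest.run s).arr A_dep v = 0) ∧
    ∀ v < n, (initForest.run s).arr A_lab v =
      if (initForest.run s).arr A_mate v = v then 1 else 0 := by
  have h1 : Stored n m x y (initVertices.run s) := h.run _ rfl
  have e1 : (initVertices.run s).arr A_inM = s.arr A_inM := Cmd.run_arr initVertices rfl s
  have i1 : ∀ v < n, (initVertices.run s).arr A_mate v = v ∧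
      (initVertices.run s).arr A_base v = v ∧ (initVertices.run s).arr A_dep v = 0 := by
    rw [initVertices]
    refine h.loop_vertices rfl (fun k s => ∀ v < k, s.arr A_mate v = v ∧ s.arr A_base v = v ∧
      s.arr A_dep v = 0) (by simp) ?_
    intro i hi s' hi' _ _ hP v hv
    simp [Function.update_apply, hi']
    by_cases hvi : v = i
    · simp [hvi]
    · simpa [hvi] using hP v (by omega)
  rw [initForest, Cmd.run_seq, Cmd.run_seq]
  set s₁ := initVertices.run s
  have h2 : Stored n m x y (linkMates.run s₁) := h1.run _ rfl
  have e2 : (linkMates.run s₁).arr A_base = s₁.arr A_base := Cmd.run_arr linkMates rfl s₁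
  have e2' : (linkMates.run s₁).arr A_dep = s₁.arr A_dep := Cmd.run_arr linkMates rfl s₁
  have i2 : (∀ f < m, s.arr A_inM f ≠ 0 → (linkMates.run s₁).arr A_mate (x f) = y f ∧
        (linkMates.run s₁).arr A_mate (y f) = x f) ∧
      ∀ v < n, (∀ f < m, s.arr A_inM f ≠ 0 → x f ≠ v ∧ y f ≠ v) →
        (linkMates.run s₁).arr A_mate v = v := by
    rw [linkMates]
    refine h1.loop_edges rfl (fun k s' => (∀ f < k, s.arr A_inM f ≠ 0 →
        s'.arr A_mate (x f) = y f ∧ s'.arr A_mate (y f) = x f) ∧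
      ∀ v < n, (∀ f < k, s.arr A_inM f ≠ 0 → x f ≠ v ∧ y f ≠ v) → s'.arr A_mate v = v)
      ⟨by simp, fun v hv _ => (i1 v hv).1⟩ ?_
    intro i hi s' hi' _ ha ⟨hP, hQ⟩
    have ex : s'.arr A_x = x := (ha A_x rfl).trans h1.arr_x
    have ey : s'.arr A_y = y := (ha A_y rfl).trans h1.arr_y
    have eM : s'.arr A_inM = s.arr A_inM := (ha A_inM rfl).trans e1
    by_cases hin : s.arr A_inM i = 0
    · simp [eM, hi', hin]
      refine ⟨fun f hf hf' => hP f ?_ hf', fun v hv hv' => hQ v hv fun f hf => hv' f (by omega)⟩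
      obtain hf | rfl : f < i ∨ f = i := by omega
      · exact hf
      · exact absurd hin hf'
    · simp [Function.update_apply, eM, hi', hin, ex, ey]
      have hxy := (h.valid i hi).2.2
      refine ⟨fun f hf hf' => ?_, fun v hv hv' => ?_⟩
      · obtain hf | rfl : f < i ∨ f = i := by omega
        -- Matching edges share no ends, so the later writes do not destroy the earlier ones.
        · obtain ⟨g1, g2, g3, g4⟩ := hM f (by simp; omega) i (by simp; omega) (by omega)
          have := hP f hf hf'
          simp [g1, g2, g3, g4, this]
        · simp [hxy]
      · have hi2 := hv' i (by omega) hin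
        simp [Ne.symm hi2.1, Ne.symm hi2.2]
        exact hQ v hv fun f hf hf' => hv' f (by omega) hf'
  set s₂ := linkMates.run s₁
  have i3 : ∀ v < n, (initLabels.run s₂).arr A_lab v =
      if s₂.arr A_mate v = v then 1 else 0 := by
    rw [initLabels]
    refine h2.loop_vertices rfl (fun k s => ∀ v < k, s.arr A_lab v =
      if s₂.arr A_mate v = v then 1 else 0) (by simp) ?_
    intro i hi s' hi' _ ha hP v hv
    have eM : s'.arr A_mate = s₂.arr A_mate := ha A_mate rfl
    simp [Function.update_apply, hi', eM]
    by_cases hvi : v = i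
    · simp [hvi]
    · simp only [hvi, if_false]
      exact hP v (by omega)
  have e3 : (initLabels.run s₂).arr A_mate = s₂.arr A_mate := Cmd.run_arr initLabels rfl s₂
  have e3b : (initLabels.run s₂).arr A_base = s₂.arr A_base := Cmd.run_arr initLabels rfl s₂
  have e3d : (initLabels.run s₂).arr A_dep = s₂.arr A_dep := Cmd.run_arr initLabels rfl s₂
  rw [e3, e3b, e3d, e2, e2']
  refine ⟨⟨fun e he => ?_, fun v hv hv' => ?_⟩, fun v hv => (i1 v hv).2.1,
    fun v hv => (i1 v hv).2.2, i3⟩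
  · rw [mem_supp] at he
    exact i2.1 e he.1 he.2
  · simp only [mem_ends, not_exists, not_and, not_or] at hv'
    exact i2.2 v hv fun f hf hf' =>
      ⟨Ne.symm (hv' f (mem_supp.2 ⟨hf, hf'⟩)).1, Ne.symm (hv' f (mem_supp.2 ⟨hf, hf'⟩)).2⟩

end TwoPM

/-! ### Correctness of the phases of a search step -/

namespace TwoPM

variable {n m : ℕ} {x y : ℕ → ℕ} {s : State}

/-- The forest can be extended along the pair of `a` and `b`. -/
def Extendable (base lab : ℕ → ℕ) (a b : ℕ) : Prop := lab a = 1 ∧ lab b ≠ 2 ∧ base a ≠ base b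

theorem checkPair_run (s : State) :
    (¬Extendable (s.arr A_base) (s.arr A_lab) (s.reg R_a) (s.reg R_b) ∧ checkPair.run s = s) ∨
    (Extendable (s.arr A_base) (s.arr A_lab) (s.reg R_a) (s.reg R_b) ∧
      checkPair.run s = ((s.setReg R_rec 1).setReg R_v (s.reg R_a)).setReg R_w (s.reg R_b)) := by
  by_cases h1 : s.arr A_lab (s.reg R_a) = 1 <;> by_cases h2 : s.arr A_lab (s.reg R_b) = 2 <;>
    by_cases h3 : s.arr A_base (s.reg R_a) = s.arr A_base (s.reg R_b) <;>
    simp [checkPair, Extendable, h1, h2, h3]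

/-- The registers record a pair along which the forest can be extended. -/
def Recorded (n : ℕ) (adj : ℕ → ℕ → Prop) (base lab : ℕ → ℕ) (s : State) : Prop :=
  s.reg R_rec = 1 ∧ s.reg R_v < n ∧ s.reg R_w < n ∧ adj (s.reg R_v) (s.reg R_w) ∧
    Extendable base lab (s.reg R_v) (s.reg R_w)

/-- `Extendable` is not symmetric in its two vertices, so each active edge is tested in both
directions. A later success overwrites an earlier one. -/
theorem findEdge_run (h : Stored n m x y s) :
    ((findEdge.run s).reg R_rec = 0 ∧
      Stuck n (AdjBy x y (supp m (s.arr A_act))) (s.arr A_base) (s.arr A_lab)) ∨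
    Recorded n (AdjBy x y (supp m (s.arr A_act))) (s.arr A_base) (s.arr A_lab)
      (findEdge.run s) := by
  set adj := AdjBy x y (supp m (s.arr A_act)) with hadj
  set base := s.arr A_base with hbase
  set lab := s.arr A_lab with hlab
  have try' : ∀ (t : State) (Q : Prop), t.arr A_base = base → t.arr A_lab = lab →
      t.reg R_a < n → t.reg R_b < n → adj (t.reg R_a) (t.reg R_b) →
      ((t.reg R_rec = 0 ∧ Q) ∨ Recorded n adj base lab t) →
      ((checkPair.run t).reg R_rec = 0 ∧ Q ∧ ¬Extendable base lab (t.reg R_a) (t.reg R_b)) ∨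
        Recorded n adj base lab (checkPair.run t) := by
    intro t Q hb hl ha hb' hab ht
    rcases checkPair_run t with ⟨h1, h2⟩ | ⟨h1, h2⟩
    · rw [hb, hl] at h1
      rw [h2]
      tauto
    · rw [hb, hl] at h1
      right
      rw [h2]
      simpa [Recorded] using ⟨ha, hb', hab, h1⟩
  rw [findEdge, Cmd.run_seq, Cmd.run_assign]
  set s₀ := s.setReg R_rec ((Expr.const 0).eval s) with hs₀
  have h0 : Stored n m x y s₀ := h.congr rfl rfl rfl rfl rfl
  have key : ((scanEdges.run s₀).reg R_rec = 0 ∧ ∀ f < m, s.arr A_act f ≠ 0 →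
      ¬Extendable base lab (x f) (y f) ∧ ¬Extendable base lab (y f) (x f)) ∨
      Recorded n adj base lab (scanEdges.run s₀) := by
    rw [scanEdges]
    refine h0.loop_edges rfl (fun k t => (t.reg R_rec = 0 ∧ ∀ f < k, s.arr A_act f ≠ 0 →
      ¬Extendable base lab (x f) (y f) ∧ ¬Extendable base lab (y f) (x f)) ∨
      Recorded n adj base lab t) (Or.inl (by simp [hs₀])) ?_
    intro i hi t hti _ ha hP
    have ex : t.arr A_x = x := (ha A_x rfl).trans h0.arr_x
    have ey : t.arr A_y = y := (ha A_y rfl).trans h0.arr_y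
    have eact : t.arr A_act = s.arr A_act := ha A_act rfl
    have eb : t.arr A_base = base := ha A_base rfl
    have el : t.arr A_lab = lab := ha A_lab rfl
    have hset : ∀ u v, Recorded n adj base lab (State.setReg u R_e v) ↔
        Recorded n adj base lab u := by
      intro u v
      simp [Recorded]
    have hset2 : ∀ u v w, Recorded n adj base lab ((State.setReg u R_a v).setReg R_b w) ↔
        Recorded n adj base lab u := by
      intro u v w
      simp [Recorded]
    by_cases hact : s.arr A_act i = 0
    · simp only [Cmd.run_ite, Expr.eval, eact, hti, hact, if_true, Cmd.run_skip, hset]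
      refine hP.imp (fun hP => ⟨by simpa using hP.1, fun f hf hf' => hP.2 f ?_ hf'⟩) id
      rcases Nat.lt_or_ge f i with h' | h'
      · exact h'
      · obtain rfl : f = i := by omega
        exact absurd hact hf'
    · obtain ⟨h1, h2, -⟩ := h.valid i hi
      have hA : i ∈ supp m (s.arr A_act) := by simpa using ⟨hi, hact⟩
      simp only [Cmd.run_ite, Expr.eval, eact, hti, hact, if_false, Cmd.run_seq, hset]
      have r1 := try' (((Cmd.assign R_a (Expr.get A_x (Expr.var R_e))).run t |>
        (Cmd.assign R_b (Expr.get A_y (Expr.var R_e))).run)) _ (by simpa using eb)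
        (by simpa using el) (by simpa [ex, hti] using h1) (by simpa [ey, hti] using h2)
        (by simpa [ex, ey, hti] using ⟨i, hA, Or.inl ⟨rfl, rfl⟩⟩)
        (by
          refine hP.imp (fun hP => ⟨by simpa using hP.1, hP.2⟩) fun hP => ?_
          simpa only [Cmd.run_assign, hset2] using hP)
      set u := checkPair.run (((Cmd.assign R_a (Expr.get A_x (Expr.var R_e))).run t |>
        (Cmd.assign R_b (Expr.get A_y (Expr.var R_e))).run)) with hu
      have ux : u.arr A_x = x := by rw [hu, Cmd.run_arr checkPair rfl]; simpa using ex
      have uy : u.arr A_y = y := by rw [hu, Cmd.run_arr checkPair rfl]; simpa using ey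
      have ub : u.arr A_base = base := by rw [hu, Cmd.run_arr checkPair rfl]; simpa using eb
      have ul : u.arr A_lab = lab := by rw [hu, Cmd.run_arr checkPair rfl]; simpa using el
      have ue : u.reg R_e = i := by rw [hu, Cmd.run_reg checkPair rfl]; simpa using hti
      have r2 := try' (((Cmd.assign R_a (Expr.get A_y (Expr.var R_e))).run u |>
        (Cmd.assign R_b (Expr.get A_x (Expr.var R_e))).run)) _ (by simpa using ub)
        (by simpa using ul) (by simpa [uy, ue] using h2) (by simpa [ux, ue] using h1)
        (by simpa [ux, uy, ue] using ⟨i, hA, Or.inr ⟨rfl, rfl⟩⟩)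
        (by
          refine r1.imp (fun hP => ⟨by simpa using hP.1, hP.2⟩) fun hP => ?_
          simpa only [Cmd.run_assign, hset2] using hP)
      refine r2.imp (fun hP => ⟨by simpa using hP.1, fun f hf hf' => ?_⟩) id
      obtain ⟨-, ⟨g1, g2⟩, g3⟩ := hP
      rcases Nat.lt_or_ge f i with h' | h'
      · exact g1 f h' hf'
      · obtain rfl : f = i := by omega
        simp [ex, ey, hti, ux, uy, ue] at g2 g3
        exact ⟨g2, g3⟩
  refine key.imp (fun hk => ⟨hk.1, ?_⟩) id
  intro a _ b _ hab hla hlb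
  obtain ⟨f, hf, hf'⟩ := hab
  rw [mem_supp] at hf
  have := hk.2 f hf.1 hf.2
  by_contra hne
  rcases hf' with ⟨rfl, rfl⟩ | ⟨rfl, rfl⟩
  · exact this.1 ⟨hla, hlb, hne⟩
  · exact this.2 ⟨hla, hlb, hne⟩

/-- The arrays of the state describe an alternating forest. -/
def HasForest (n : ℕ) (adj : ℕ → ℕ → Prop) (s : State) : Prop :=
  Forest n adj (s.arr A_mate) (s.arr A_base) (s.arr A_lab) (s.arr A_par) (s.arr A_dep)

theorem labelled_le (n : ℕ) (lab : ℕ → ℕ) : labelled n lab ≤ n :=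
  (Finset.card_filter_le _ _).trans (Finset.card_range n).le

theorem absorbed_le (n : ℕ) (base : ℕ → ℕ) : absorbed n base ≤ n :=
  (Finset.card_filter_le _ _).trans (Finset.card_range n).le

theorem growForest_run {adj : ℕ → ℕ → Prop} (hf : HasForest n adj s)
    (hr : Recorded n adj (s.arr A_base) (s.arr A_lab) s) (hw : s.arr A_lab (s.reg R_w) = 0) :
    HasForest n adj (growForest.run s) ∧
      labelled n (s.arr A_lab) < labelled n ((growForest.run s).arr A_lab) := by
  obtain ⟨-, h1, h2, h3, h4, -⟩ := hr
  have := Forest.grow hf h1 h2 h4 hw h3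
  simpa [HasForest, growForest] using this

/-- Each move lowers the sum of the two depths, which is at most 2n and hence below the number of
rounds. If the pointers meet, at least one move was made, since the bases differed at the start.
That move marked an outer vertex, as `Climb.merge` requires. -/
theorem climb_run (h : Stored n m x y s) {adj : ℕ → ℕ → Prop} (hf : HasForest n adj s)
    (hr : Recorded n adj (s.arr A_base) (s.arr A_lab) s) (hw : s.arr A_lab (s.reg R_w) ≠ 0) :
    Climb n adj (s.arr A_mate) (s.arr A_base) (s.arr A_lab) (s.arr A_dep)
      ((climb.run s).arr A_mark) ((climb.run s).reg R_p) ((climb.run s).reg R_q) ∧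
    ((climb.run s).reg R_p = (climb.run s).reg R_q →
      ∃ z < n, (climb.run s).arr A_mark z = 1 ∧ s.arr A_lab z = 1) ∧
    ((climb.run s).reg R_p ≠ (climb.run s).reg R_q →
      s.arr A_dep ((climb.run s).reg R_p) = 0 ∧ s.arr A_dep ((climb.run s).reg R_q) = 0) := by
  obtain ⟨-, hv, hwn, hvw, hlv, hlw, hne⟩ := hr
  have hlw1 : s.arr A_lab (s.reg R_w) = 1 := by
    have := hf.lab_le _ hwn
    omega
  have hreset : ∀ z < n, (resetMarks.run s).arr A_mark z = 0 := by
    rw [resetMarks]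
    refine h.loop_vertices rfl (fun k s => ∀ z < k, s.arr A_mark z = 0) (by simp) ?_
    intro i hi t hti _ _ hP z hz
    simp only [Cmd.run_store, Expr.eval, hti, State.setReg_arr, State.setArr_arr, if_true,
      Function.update_apply]
    split_ifs with hzi
    · rfl
    · exact hP z (by omega)
  rw [climb, Cmd.run_seq, Cmd.run_seq, Cmd.run_seq, Cmd.run_assign, Cmd.run_assign]
  have eb : (resetMarks.run s).arr A_base = s.arr A_base := Cmd.run_arr resetMarks rfl s
  have em : (resetMarks.run s).arr A_mate = s.arr A_mate := Cmd.run_arr resetMarks rfl s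
  have ep : (resetMarks.run s).arr A_par = s.arr A_par := Cmd.run_arr resetMarks rfl s
  have ed : (resetMarks.run s).arr A_dep = s.arr A_dep := Cmd.run_arr resetMarks rfl s
  have ev : (resetMarks.run s).reg R_v = s.reg R_v := Cmd.run_reg resetMarks rfl s
  have ew : (resetMarks.run s).reg R_w = s.reg R_w := Cmd.run_reg resetMarks rfl s
  have e0 : (resetMarks.run s).reg 0 = s.reg 0 := Cmd.run_reg resetMarks rfl s
  set s₁ := resetMarks.run s
  simp only [Expr.eval, State.setReg_reg, State.setReg_arr, eb, ev, ew]
  norm_num only [if_false]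
  set p₀ := s.arr A_base (s.reg R_v)
  set q₀ := s.arr A_base (s.reg R_w)
  set s₂ := (s₁.setReg R_p p₀).setReg R_q q₀ with hs₂
  set mate := s.arr A_mate
  set base := s.arr A_base
  set lab := s.arr A_lab
  set dep := s.arr A_dep
  have hf' : Forest n adj mate base lab (s.arr A_par) dep := hf
  -- The invariant: the chain, an outer vertex marked unless nothing has moved, and either a final
  -- position or a depth sum that has dropped by the number of rounds.
  have key := Cmd.run_loop (x := R_j) (k := 0) (c := climbStep) rfl s₂
    (fun k t => Climb n adj mate base lab dep (t.arr A_mark) (t.reg R_p) (t.reg R_q) ∧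
      ((t.reg R_p = p₀ ∧ t.reg R_q = q₀) ∨ ∃ z < n, t.arr A_mark z = 1 ∧ lab z = 1) ∧
      (t.reg R_p = t.reg R_q ∨ (dep (t.reg R_p) = 0 ∧ dep (t.reg R_q) = 0) ∨
        dep (t.reg R_p) + dep (t.reg R_q) + k ≤ 2 * n)) ?_ ?_
  rotate_left
  · simp only [hs₂, State.setReg_arr, State.setReg_reg]
    norm_num only [if_false, if_true]
    refine ⟨Climb.init hf hreset hv hwn hlv hlw1 hvw, Or.inl (by simp), ?_⟩
    right; right
    have h1 := (hf.dep_le _ (hf.base_lt _ hv)).trans (labelled_le _ _)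
    have h2 := (hf.dep_le _ (hf.base_lt _ hwn)).trans (labelled_le _ _)
    change dep p₀ ≤ n at h1
    change dep q₀ ≤ n at h2
    omega
  · intro i hi t hti hr ha ⟨hc, hP, hQ⟩
    have tm : t.arr A_mate = mate := (ha A_mate rfl).trans em
    have tb : t.arr A_base = base := (ha A_base rfl).trans eb
    have tp : t.arr A_par = s.arr A_par := (ha A_par rfl).trans ep
    have td : t.arr A_dep = dep := (ha A_dep rfl).trans ed
    by_cases hpq : t.reg R_p = t.reg R_q
    · simp [climbStep, hpq] at hc hP hQ ⊢
      exact ⟨hc, hP⟩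
    by_cases hlt : dep (t.reg R_p) < dep (t.reg R_q)
    · obtain ⟨g1, g2⟩ := (hc.symm hf').step hf' (Ne.symm hpq) hlt.le (by omega)
      have g3 := g1.symm hf'
      simp [hpq, hlt, climbStep, climbFrom, td, tm, tb, tp]
      refine ⟨g3, Or.inr ⟨t.reg R_q, hc.right.1, ?_, hc.right.2.1⟩, ?_⟩
      · simp [Function.update_apply]
      · right; right
        change dep (base (s.arr A_par (mate (t.reg R_q)))) < _ at g2
        omega
    by_cases hd : dep (t.reg R_p) = 0
    · have hd' : dep (t.reg R_q) = 0 := by omega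
      simp [climbStep, hpq, hd, hd', td]
      exact ⟨hc, hP⟩
    · obtain ⟨g1, g2⟩ := hc.step hf' hpq (by omega) hd
      simp [hpq, hlt, hd, climbStep, climbFrom, td, tm, tb, tp]
      refine ⟨g1, Or.inr ⟨t.reg R_p, hc.left.1, ?_, hc.left.2.1⟩, ?_⟩
      · simp [Function.update_apply]
      · right; right
        change dep (base (s.arr A_par (mate (t.reg R_p)))) < _ at g2
        omega
  rw [min_self] at key
  change Climb n adj mate base lab dep ((climbLoop.run s₂).arr A_mark) _ _ ∧ _ at key
  obtain ⟨k1, k2, k3⟩ := key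
  refine ⟨k1, fun hpq => ?_, fun hpq => ?_⟩
  · rcases k2 with ⟨k2, k2'⟩ | k2
    · exact absurd (k2.symm.trans (hpq.trans k2')) hne
    · exact k2
  · rcases k3 with k3 | k3 | k3
    · exact absurd k3 hpq
    · exact k3
    · have h1 := h.two_mul_lt
      have h2 : s₂.reg 0 = s.reg 0 := by simp [hs₂, e0]
      omega

/-- The merge works in place: round `i` reads the base of `i` only, which no earlier round has
overwritten, and the marks stay fixed. -/
theorem mergeMarked_run (h : Stored n m x y s) :
    (∀ z < n, (mergeMarked.run s).arr A_base z =
      if s.arr A_mark (s.arr A_base z) = 1 then s.reg R_p else s.arr A_base z) ∧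
    ∀ z < n, (mergeMarked.run s).arr A_lab z =
      if s.arr A_mark (s.arr A_base z) = 1 then 1 else s.arr A_lab z := by
  have key : ∀ z < n, (mergeMarked.run s).arr A_base z =
      (if z < n ∧ s.arr A_mark (s.arr A_base z) = 1 then s.reg R_p else s.arr A_base z) ∧
      (mergeMarked.run s).arr A_lab z =
        if z < n ∧ s.arr A_mark (s.arr A_base z) = 1 then 1 else s.arr A_lab z := by
    rw [mergeMarked]
    refine h.loop_vertices rfl (fun k t => ∀ z < n, t.arr A_base z =
      (if z < k ∧ s.arr A_mark (s.arr A_base z) = 1 then s.reg R_p else s.arr A_base z) ∧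
      t.arr A_lab z =
        if z < k ∧ s.arr A_mark (s.arr A_base z) = 1 then 1 else s.arr A_lab z) (by simp) ?_
    intro i hi t hti hr ha hP z hz
    have tp : t.reg R_p = s.reg R_p := hr R_p rfl
    have tm : t.arr A_mark = s.arr A_mark := ha A_mark rfl
    have hPi := (hP i hi).1
    rw [if_neg (by omega)] at hPi
    have hPz := hP z hz
    by_cases hm : s.arr A_mark (s.arr A_base i) = 1
    · simp only [Cmd.run_ite, Expr.eval, hti, tm, hPi, hm, if_true, one_ne_zero, if_false,
        Cmd.run_seq, Cmd.run_store, State.setReg_arr, State.setArr_arr, State.setArr_reg, tp]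
      norm_num only [if_false, if_true]
      by_cases hzi : z = i
      · simp [hzi, hm]
      · have : z < i + 1 ↔ z < i := by omega
        simpa [hzi, this, hti] using hPz
    · simp only [Cmd.run_ite, Expr.eval, hti, tm, hPi, hm, if_true, if_false, Cmd.run_skip,
        State.setReg_arr]
      by_cases hzi : z = i
      · simpa [hzi, hm] using hP i hi
      · have : z < i + 1 ↔ z < i := by omega
        simpa [this] using hPz
  refine ⟨fun z hz => ?_, fun z hz => ?_⟩
  · simpa [hz] using (key z hz).1
  · simpa [hz] using (key z hz).2

end TwoPM

/-! ### Correctness of the search -/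

namespace TwoPM

variable {n m : ℕ} {x y : ℕ → ℕ} {s : State}

theorem Recorded.not_stuck {adj : ℕ → ℕ → Prop} {base lab : ℕ → ℕ}
    (h : Recorded n adj base lab s) : ¬Stuck n adj base lab := fun hs =>
  h.2.2.2.2.2.2 (hs _ h.2.1 _ h.2.2.1 h.2.2.2.1 h.2.2.2.2.1 h.2.2.2.2.2.1)

/-- Growing raises the number of labelled vertices, and merging raises that of absorbed vertices
without losing labels. Their sum is thus a strictly increasing potential bounded by 2n, and a stuck
forest stays stuck. -/
theorem searchStep_run (h : Stored n m x y s) {adj : ℕ → ℕ → Prop}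
    (hadj : adj = AdjBy x y (supp m (s.arr A_act))) (hf : HasForest n adj s) :
    ((searchStep.run s).reg R_found = s.reg R_found ∧ HasForest n adj (searchStep.run s) ∧
      (Stuck n adj ((searchStep.run s).arr A_base) ((searchStep.run s).arr A_lab) ∨
        (¬Stuck n adj (s.arr A_base) (s.arr A_lab) ∧
          labelled n (s.arr A_lab) + absorbed n (s.arr A_base) <
            labelled n ((searchStep.run s).arr A_lab) +
              absorbed n ((searchStep.run s).arr A_base)))) ∨
    ((searchStep.run s).reg R_found = 1 ∧
      ∃ U, PerfectlyMatched adj U ∧ (covered n (s.arr A_mate)).card < U.card) := by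
  subst hadj
  set adj := AdjBy x y (supp m (s.arr A_act))
  have hfind := findEdge_run h
  have e : ∀ b, findEdge.setsArr b = false → (findEdge.run s).arr b = s.arr b :=
    fun b hb => Cmd.run_arr _ hb s
  have em := e A_mate rfl
  have eb := e A_base rfl
  have el := e A_lab rfl
  have ep := e A_par rfl
  have ed := e A_dep rfl
  have ef : (findEdge.run s).reg R_found = s.reg R_found := Cmd.run_reg findEdge rfl s
  have h₁ : Stored n m x y (findEdge.run s) := h.run _ rfl
  rw [searchStep, Cmd.run_seq]
  set s₁ := findEdge.run s
  have hf₁ : HasForest n adj s₁ := by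
    rw [HasForest, em, eb, el, ep, ed]
    exact hf
  rcases hfind with ⟨hr, hs⟩ | hr
  · left
    simp only [Cmd.run_ite, Expr.eval, hr, if_true, Cmd.run_skip]
    refine ⟨ef, hf₁, Or.inl ?_⟩
    rw [eb, el]
    exact hs
  · have hns := hr.not_stuck
    rw [← eb, ← el] at hr
    have hrec : s₁.reg R_rec ≠ 0 := by
      rw [hr.1]
      exact one_ne_zero
    simp only [Cmd.run_ite, Expr.eval, hrec, if_false]
    by_cases hw : s₁.arr A_lab (s₁.reg R_w) = 0
    · left
      simp only [hw, if_true]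
      obtain ⟨g1, g2⟩ := growForest_run hf₁ hr hw
      refine ⟨(Cmd.run_reg growForest rfl s₁).trans ef, g1, Or.inr ⟨hns, ?_⟩⟩
      rw [Cmd.run_arr growForest rfl s₁ (b := A_base), eb]
      rw [el] at g2
      exact Nat.add_lt_add_right g2 _
    · simp only [hw, if_false, Cmd.run_seq, Cmd.run_ite, Expr.eval, Cmd.run_assign]
      obtain ⟨g1, g2, g3⟩ := climb_run h₁ hf₁ hr hw
      have e' : ∀ b, climb.setsArr b = false → (climb.run s₁).arr b = s₁.arr b :=
        fun b hb => Cmd.run_arr _ hb s₁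
      have ef₂ : (climb.run s₁).reg R_found = s₁.reg R_found := Cmd.run_reg climb rfl s₁
      have em₂ := e' A_mate rfl
      have eb₂ := e' A_base rfl
      have el₂ := e' A_lab rfl
      have ep₂ := e' A_par rfl
      have ed₂ := e' A_dep rfl
      have h₂ : Stored n m x y (climb.run s₁) := h₁.run _ rfl
      set s₂ := climb.run s₁
      by_cases hpq : s₂.reg R_p = s₂.reg R_q
      · left
        simp only [hpq, if_true, one_ne_zero, if_false]
        obtain ⟨k1, k2⟩ := mergeMarked_run h₂
        rw [eb₂] at k1 k2
        rw [el₂] at k2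
        rw [← hpq] at g1
        obtain ⟨l1, l2, l3⟩ := g1.merge hf₁ k1 k2 (g2 hpq)
        refine ⟨(Cmd.run_reg mergeMarked rfl s₂).trans (ef₂.trans ef), ?_, Or.inr ⟨hns, ?_⟩⟩
        · rw [HasForest, Cmd.run_arr mergeMarked rfl s₂ (b := A_mate),
            Cmd.run_arr mergeMarked rfl s₂ (b := A_par),
            Cmd.run_arr mergeMarked rfl s₂ (b := A_dep), em₂, ep₂, ed₂]
          exact l1
        · rw [el] at l2
          rw [eb] at l3
          omega
      · right
        simp only [hpq, if_false, if_true, State.setReg_reg]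
        refine ⟨trivial, ?_⟩
        rw [← em]
        exact g1.augment hf₁ hpq (g3 hpq).1 (g3 hpq).2

/-- A stuck alternating forest for the matching `M` inside `A`. -/
def Certified (n : ℕ) (x y : ℕ → ℕ) (A M : Finset ℕ) : Prop :=
  ∃ mate base lab par dep, Forest n (AdjBy x y A) mate base lab par dep ∧
    Stuck n (AdjBy x y A) base lab ∧ (covered n mate).card = 2 * M.card

theorem Certified.card_le {A M N : Finset ℕ} (h : Certified n x y A M)
    (hA : ∀ e ∈ A, x e < n ∧ y e < n ∧ x e ≠ y e) (hNA : N ⊆ A) (hN : IsMatching x y N) :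
    N.card ≤ M.card := by
  obtain ⟨mate, base, lab, par, dep, hf, hs, hc⟩ := h
  have := hf.card_le hA hs hNA hN
  omega

/-- The search reports whether there is a larger matching. -/
theorem search_run (h : Stored n m x y s) (hM : IsMatching x y (supp m (s.arr A_inM)))
    (hMA : supp m (s.arr A_inM) ⊆ supp m (s.arr A_act)) :
    ((search.run s).reg R_found ≠ 0 ∧ ∃ N ⊆ supp m (s.arr A_act), IsMatching x y N ∧
      (supp m (s.arr A_inM)).card < N.card) ∨
    ((search.run s).reg R_found = 0 ∧
      Certified n x y (supp m (s.arr A_act)) (supp m (s.arr A_inM))) := by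
  set A := supp m (s.arr A_act)
  set M := supp m (s.arr A_inM)
  have hA : ∀ e ∈ A, x e < n ∧ y e < n ∧ x e ≠ y e := fun e he => h.valid e (mem_supp.1 he).1
  have hMv : ∀ e ∈ M, x e < n ∧ y e < n ∧ x e ≠ y e := fun e he => h.valid e (mem_supp.1 he).1
  obtain ⟨i1, i2, i3, i4⟩ := initForest_run h hM
  have hf : HasForest n (AdjBy x y A) (initForest.run s) :=
    i1.forest (fun e he => ⟨(hMv e he).1, (hMv e he).2.1⟩) hMA i2 i4 i3
  have hcard := i1.card_covered hM hMv
  have h₁ : Stored n m x y (initForest.run s) := h.run _ rfl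
  have eact : (initForest.run s).arr A_act = s.arr A_act := Cmd.run_arr initForest rfl s
  have ereg : (initForest.run s).reg 0 = s.reg 0 := Cmd.run_reg initForest rfl s
  rw [search, Cmd.run_seq, Cmd.run_seq, Cmd.run_assign]
  set s₁ := initForest.run s
  set s₂ := s₁.setReg R_found ((Expr.const 0).eval s₁) with hs₂
  have h₂ : Stored n m x y s₂ := h₁.congr rfl rfl rfl rfl rfl
  have key := Cmd.run_loop (x := R_t) (k := 0)
    (c := Cmd.ite (Expr.var R_found) Cmd.skip searchStep) rfl s₂
    (fun k t => (t.reg R_found ≠ 0 ∧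
        ∃ U, PerfectlyMatched (AdjBy x y A) U ∧ (covered n (s₁.arr A_mate)).card < U.card) ∨
      (t.reg R_found = 0 ∧ HasForest n (AdjBy x y A) t ∧
        (Stuck n (AdjBy x y A) (t.arr A_base) (t.arr A_lab) ∨
          k ≤ labelled n (t.arr A_lab) + absorbed n (t.arr A_base)))) ?_ ?_
  rotate_left
  · right
    exact ⟨by simp [hs₂], hf, Or.inr (Nat.zero_le _)⟩
  · intro i hi t hti hr ha hP
    have tact : t.arr A_act = s.arr A_act := (ha A_act rfl).trans eact
    have tm : t.arr A_mate = s₁.arr A_mate := ha A_mate rfl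
    have ht : Stored n m x y t :=
      h₂.congr (hr 0 rfl) (hr R_n rfl) (hr R_m rfl) (ha A_x rfl) (ha A_y rfl)
    rcases hP with ⟨hP, hU⟩ | ⟨hP, hft, hk⟩
    · left
      simp only [Cmd.run_ite, Expr.eval, hP, if_false, Cmd.run_skip]
      exact ⟨by simpa using hP, hU⟩
    · simp only [Cmd.run_ite, Expr.eval, hP, if_true]
      rcases searchStep_run ht (by rw [tact]) hft with ⟨g1, g2, g3⟩ | ⟨g1, g2⟩
      · right
        refine ⟨by simpa [hP] using g1, g2, ?_⟩
        rcases g3 with g3 | ⟨g3, g4⟩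
        · exact Or.inl g3
        · rcases hk with hk | hk
          · exact absurd hk g3
          · right
            simp only [State.setReg_arr]
            omega
      · left
        rw [tm] at g2
        exact ⟨by simp [g1], g2⟩
  rw [min_self] at key
  rcases key with ⟨k1, U, hU, hc⟩ | ⟨k1, k2, k3⟩
  · left
    obtain ⟨N, hNA, hN, rfl⟩ := hU.exists_matching
    refine ⟨k1, N, hNA, hN, ?_⟩
    rw [hN.card_ends fun e he => (hA e (hNA he)).2.2, hcard] at hc
    exact Nat.lt_of_mul_lt_mul_left hc
  · right
    refine ⟨k1, _, _, _, _, _, k2, ?_, ?_⟩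
    · rcases k3 with k3 | k3
      · exact k3
      · have g1 := h₂.two_mul_lt
        have g2 := labelled_le n
          (((Cmd.loop R_t 0 (Cmd.ite (Expr.var R_found) Cmd.skip searchStep)).run s₂).arr A_lab)
        have g3 := absorbed_le n
          (((Cmd.loop R_t 0 (Cmd.ite (Expr.var R_found) Cmd.skip searchStep)).run s₂).arr A_base)
        omega
    · rw [Cmd.run_arr (Cmd.loop R_t 0 (Cmd.ite (Expr.var R_found) Cmd.skip searchStep)) rfl s₂
        (b := A_mate)]
      exact hcard

/-! ### Maximum matchings -/

section Programs

open Cmd TwoPM.Expr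

/-- Activate all edges. -/
def activateAll : Cmd := loop R_e R_m (store A_act (var R_e) (const 1))

/-- Deactivate the edge `R_g` outside the matching unless all augmentations use it. -/
def thinStep : Cmd :=
  ite (get A_inM (var R_g)) skip
    (store A_act (var R_g) (const 0) ;; search ;;
      ite (var R_found) skip (store A_act (var R_g) (const 1)))

/-- Deactivate edges as long as an augmentation remains. -/
def thin : Cmd := loop R_g R_m thinStep

/-- Reset the covering flags. -/
def resetCover : Cmd := loop R_i R_n (store A_cov (var R_i) (const 0))

/-- Flag the ends of the active edges outside the matching. -/
def flagCover : Cmd :=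
  loop R_e R_m
    (ite (get A_act (var R_e))
      (ite (get A_inM (var R_e)) skip
        (store A_cov (get A_x (var R_e)) (const 1) ;; store A_cov (get A_y (var R_e)) (const 1)))
      skip)

/-- Replace the matching edges at flagged vertices by the active edges outside the matching. -/
def exchange : Cmd :=
  loop R_e R_m
    (ite (get A_inM (var R_e))
      (ite (add (get A_cov (get A_x (var R_e))) (get A_cov (get A_y (var R_e))))
        (store A_inM (var R_e) (const 0)) skip)
      (store A_inM (var R_e) (get A_act (var R_e))))

/-- Enlarge the matching `A_inM` if possible. -/
def augment : Cmd :=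
  activateAll ;; search ;;
    ite (var R_found) (thin ;; resetCover ;; flagCover ;; exchange) skip

/-- Compute a maximum matching, starting from the empty one. -/
def maxMatching : Cmd := loop R_k 0 augment

end Programs

/-- `M` with the edges meeting `Q` replaced by `Q`. -/
def exchanged (x y : ℕ → ℕ) (M Q : Finset ℕ) : Finset ℕ :=
  (M.filter fun e => x e ∉ ends x y Q ∧ y e ∉ ends x y Q) ∪ Q

/-- If the edges `A` outside the matching `M` belong to all larger matchings inside `A`, then
exchanging them enlarges `M`. -/
theorem exchanged_spec {A M N : Finset ℕ} (hM : IsMatching x y M) (hNA : N ⊆ A)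
    (hN : IsMatching x y N) (hc : M.card < N.card) (hQ : ∀ e ∈ A \ M, e ∈ N) :
    IsMatching x y (exchanged x y M (A \ M)) ∧
      M.card < (exchanged x y M (A \ M)).card := by
  -- `N` contains all of `A \ M`. Its other edges lie in `M` and, `N` being a matching, avoid the
  -- ends of `A \ M`, so the exchange keeps them.
  have hsub : N ⊆ exchanged x y M (A \ M) := by
    intro e he
    by_cases heM : e ∈ M
    · refine Finset.mem_union_left _ (Finset.mem_filter.2 ⟨heM, ?_⟩)
      simp only [mem_ends, not_exists, not_and, not_or]
      have : ∀ f ∈ A \ M, x e ≠ x f ∧ x e ≠ y f ∧ y e ≠ x f ∧ y e ≠ y f := fun f hf =>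
        hN e he f (hQ f hf) fun h => (Finset.mem_sdiff.1 hf).2 (h ▸ heM)
      exact ⟨fun f hf => ⟨(this f hf).1, (this f hf).2.1⟩,
        fun f hf => ⟨(this f hf).2.2.1, (this f hf).2.2.2⟩⟩
    · exact Finset.mem_union_right _ (Finset.mem_sdiff.2 ⟨hNA he, heM⟩)
  refine ⟨?_, hc.trans_le (Finset.card_le_card hsub)⟩
  have aux : ∀ e ∈ M.filter (fun e => x e ∉ ends x y (A \ M) ∧ y e ∉ ends x y (A \ M)),
      ∀ f ∈ A \ M, x e ≠ x f ∧ x e ≠ y f ∧ y e ≠ x f ∧ y e ≠ y f := by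
    intro e he f hf
    simp only [Finset.mem_filter, mem_ends, not_exists, not_and, not_or] at he
    exact ⟨(he.2.1 f hf).1, (he.2.1 f hf).2, (he.2.2 f hf).1, (he.2.2 f hf).2⟩
  intro e he f hf hne
  rcases Finset.mem_union.1 he with he | he <;> rcases Finset.mem_union.1 hf with hf | hf
  · exact hM e (Finset.mem_of_mem_filter e he) f (Finset.mem_of_mem_filter f hf) hne
  · exact aux e he f hf
  · obtain ⟨h1, h2, h3, h4⟩ := aux f hf e he
    exact ⟨h1.symm, h3.symm, h2.symm, h4.symm⟩
  · exact hN e (hQ e he) f (hQ f hf) hne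

end TwoPM

/-! ### Correctness of the maximum matching program -/

namespace TwoPM

variable {n m : ℕ} {x y : ℕ → ℕ} {s : State}

/-- An edge set containing `M` all of whose edges outside `M` belong to every larger
matching inside it. -/
structure Thin (x y : ℕ → ℕ) (A M : Finset ℕ) : Prop where
  subset : M ⊆ A
  larger : ∃ N ⊆ A, IsMatching x y N ∧ M.card < N.card
  forced : ∀ e ∈ A \ M, ∀ N ⊆ A, IsMatching x y N → M.card < N.card → e ∈ N

/-- One pass is enough: an edge contained in every larger matching inside an edge set has the same
property for each smaller edge set, so later deletions never revive a decision. -/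
theorem thin_run (h : Stored n m x y s) (hM : IsMatching x y (supp m (s.arr A_inM)))
    (hall : ∀ e < m, s.arr A_act e ≠ 0)
    (hN : ∃ N ⊆ supp m (s.arr A_act), IsMatching x y N ∧
      (supp m (s.arr A_inM)).card < N.card) :
    Thin x y (supp m ((thin.run s).arr A_act)) (supp m (s.arr A_inM)) := by
  set M := supp m (s.arr A_inM) with hMdef
  have key : (∃ N ⊆ supp m ((thin.run s).arr A_act), IsMatching x y N ∧ M.card < N.card) ∧
      (∀ e < m, m ≤ e ∨ s.arr A_inM e ≠ 0 → (thin.run s).arr A_act e ≠ 0) ∧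
      ∀ e < m, e ∈ supp m ((thin.run s).arr A_act) → e ∉ M →
        ∀ N ⊆ supp m ((thin.run s).arr A_act), IsMatching x y N → M.card < N.card → e ∈ N := by
    rw [thin]
    refine h.loop_edges rfl (fun k t =>
      (∃ N ⊆ supp m (t.arr A_act), IsMatching x y N ∧ M.card < N.card) ∧
      (∀ e < m, k ≤ e ∨ s.arr A_inM e ≠ 0 → t.arr A_act e ≠ 0) ∧
      ∀ e < k, e ∈ supp m (t.arr A_act) → e ∉ M →
        ∀ N ⊆ supp m (t.arr A_act), IsMatching x y N → M.card < N.card → e ∈ N)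
      ⟨hN, fun e he _ => hall e he, by simp⟩ ?_
    intro i hi t hti hr ha ⟨hP, hQ, hR⟩
    have tM : t.arr A_inM = s.arr A_inM := ha A_inM rfl
    have ht : Stored n m x y t :=
      h.congr (hr 0 rfl) (hr R_n rfl) (hr R_m rfl) (ha A_x rfl) (ha A_y rfl)
    by_cases hin : s.arr A_inM i = 0
    · simp only [thinStep, Cmd.run_ite, Expr.eval, tM, hti, hin, if_true, Cmd.run_seq,
        Cmd.run_store, State.setReg_arr]
      set t₁ := t.setArr A_act i 0 with ht₁
      have h₁ : Stored n m x y t₁ := ht.congr rfl rfl rfl (by simp [ht₁]) (by simp [ht₁])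
      have eM : t₁.arr A_inM = s.arr A_inM := by simp [ht₁, tM]
      have eA : supp m (t₁.arr A_act) = (supp m (t.arr A_act)).erase i := by
        ext e
        by_cases hei : e = i <;> simp [ht₁, hei]
      have hMA : M ⊆ (supp m (t.arr A_act)).erase i := by
        intro e he
        rw [hMdef, mem_supp] at he
        rw [Finset.mem_erase, mem_supp]
        exact ⟨fun h' => he.2 (h' ▸ hin), he.1, hQ e he.1 (Or.inr he.2)⟩
      have hsr := search_run h₁ (by rw [eM]; exact hM) (by rw [eM, eA]; exact hMA)
      have ea : (search.run t₁).arr A_act = t₁.arr A_act := Cmd.run_arr search rfl t₁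
      have eg : (search.run t₁).reg R_g = i := by
        rw [Cmd.run_reg search rfl t₁]
        simpa [ht₁] using hti
      rw [eM, eA] at hsr
      set t₂ := search.run t₁
      have hother : ∀ e, e ≠ i → t₁.arr A_act e = t.arr A_act e := fun e he => by
        simp [ht₁, he]
      rcases hsr with ⟨hfound, hlarge⟩ | ⟨hfound, hcert⟩
      · simp only [hfound, if_false, Cmd.run_skip, ea, eA]
        refine ⟨hlarge, fun e he h' => ?_, fun e he hea hem N hNs => ?_⟩
        · have hei : e ≠ i := fun h'' => by
            rcases h' with h' | h'
            · omega
            · exact h' (h'' ▸ hin)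
          rw [hother e hei]
          exact hQ e he (h'.imp (fun _ => by omega) id)
        · rw [Finset.mem_erase] at hea
          exact hR e (by omega) hea.2 hem N (hNs.trans (Finset.erase_subset _ _))
      · simp only [hfound, if_true, eg]
        have eA' : supp m ((t₂.setArr A_act i 1).arr A_act) = supp m (t.arr A_act) := by
          ext e
          by_cases hei : e = i
          · subst hei
            simpa using fun _ => hQ e hi (Or.inl le_rfl)
          · simp [ea, hei, hother e hei]
        simp only [eA']
        refine ⟨hP, fun e he h' => ?_, fun e he hea hem N hNs hNm hNc => ?_⟩
        · by_cases hei : e = i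
          · subst hei
            simp
          · simp only [State.setArr_arr, if_true, Function.update_of_ne hei, ea,
              hother e hei]
            exact hQ e he (h'.imp (fun _ => by omega) id)
        · by_cases hei : e = i
          · subst hei
            -- A larger matching without `e` would lie among the edges that the failed search has
            -- just certified to contain none.
            by_contra hen
            have := hcert.card_le (fun f hf => h.valid f (mem_supp.1
              (Finset.mem_of_mem_erase hf)).1) (Finset.subset_erase.2 ⟨hNs, hen⟩) hNm
            exact absurd hNc (not_lt.2 this)
          · exact hR e (by omega) hea hem N hNs hNm hNc
    · simp only [thinStep, Cmd.run_ite, Expr.eval, tM, hti, hin, if_false, Cmd.run_skip,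
        State.setReg_arr]
      refine ⟨hP, fun e he h' => hQ e he (h'.imp (fun _ => by omega) id),
        fun e he hea hem => ?_⟩
      have hei : e ≠ i := by
        rintro rfl
        exact hem (by simpa [hMdef] using ⟨hi, hin⟩)
      exact hR e (by omega) hea hem
  refine ⟨fun e he => ?_, key.1, fun e he => ?_⟩
  · rw [hMdef, mem_supp] at he
    exact mem_supp.2 ⟨he.1, key.2.1 e he.1 (Or.inr he.2)⟩
  · rw [Finset.mem_sdiff] at he
    exact key.2.2 e (mem_supp.1 he.1).1 he.1 he.2

theorem flagCover_run (h : Stored n m x y s) (hc : ∀ v < n, s.arr A_cov v = 0) :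
    ∀ v < n, (flagCover.run s).arr A_cov v ≠ 0 ↔
      v ∈ ends x y (supp m (s.arr A_act) \ supp m (s.arr A_inM)) := by
  have key : ∀ v < n, (flagCover.run s).arr A_cov v ≠ 0 ↔
      ∃ e < m, (s.arr A_act e ≠ 0 ∧ s.arr A_inM e = 0) ∧ (v = x e ∨ v = y e) := by
    rw [flagCover]
    refine h.loop_edges rfl (fun k t => ∀ v < n, t.arr A_cov v ≠ 0 ↔
      ∃ e < k, (s.arr A_act e ≠ 0 ∧ s.arr A_inM e = 0) ∧ (v = x e ∨ v = y e))
      (by simpa using hc) ?_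
    intro i hi t hti hr ha hP v hv
    have tM : t.arr A_inM = s.arr A_inM := ha A_inM rfl
    have tA : t.arr A_act = s.arr A_act := ha A_act rfl
    have tx : t.arr A_x = x := (ha A_x rfl).trans h.arr_x
    have ty : t.arr A_y = y := (ha A_y rfl).trans h.arr_y
    have hPv := hP v hv
    have hsplit : (∃ e < i + 1, (s.arr A_act e ≠ 0 ∧ s.arr A_inM e = 0) ∧
        (v = x e ∨ v = y e)) ↔ (∃ e < i, (s.arr A_act e ≠ 0 ∧ s.arr A_inM e = 0) ∧
        (v = x e ∨ v = y e)) ∨ ((s.arr A_act i ≠ 0 ∧ s.arr A_inM i = 0) ∧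
        (v = x i ∨ v = y i)) := by
      constructor
      · rintro ⟨e, he, h'⟩
        rcases Nat.lt_or_ge e i with hei | hei
        · exact Or.inl ⟨e, hei, h'⟩
        · obtain rfl : e = i := by omega
          exact Or.inr h'
      · rintro (⟨e, he, h'⟩ | h')
        · exact ⟨e, by omega, h'⟩
        · exact ⟨i, by omega, h'⟩
    rw [hsplit, ← hPv]
    by_cases h1 : s.arr A_act i = 0
    · simp [tA, hti, h1]
    by_cases h2 : s.arr A_inM i = 0
    · simp only [Cmd.run_ite, Expr.eval, tA, tM, hti, h1, h2, if_true, if_false, Cmd.run_seq,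
        Cmd.run_store, State.setReg_arr, State.setArr_arr, State.setArr_reg, tx, ty,
        Function.update_apply]
      norm_num only [if_false]
      by_cases hvy : v = y i <;> by_cases hvx : v = x i <;> simp [h1, hvx, hvy]
    · simp [tA, tM, hti, h1, h2]
  intro v hv
  rw [key v hv, mem_ends]
  simp only [Finset.mem_sdiff, mem_supp]
  constructor
  · rintro ⟨e, he, ⟨h1, h2⟩, h3⟩
    exact ⟨e, ⟨⟨he, h1⟩, fun h' => h'.2 h2⟩, h3⟩
  · rintro ⟨e, ⟨⟨he, h1⟩, h2⟩, h3⟩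
    exact ⟨e, he, ⟨h1, by_contra fun h' => h2 ⟨he, h'⟩⟩, h3⟩

/-- The matching is rewritten in place, so the invariant records that entries not yet visited are
unchanged. The flags were computed before and remain fixed. -/
theorem exchange_run (h : Stored n m x y s)
    (hc : ∀ v < n, s.arr A_cov v ≠ 0 ↔
      v ∈ ends x y (supp m (s.arr A_act) \ supp m (s.arr A_inM))) :
    supp m ((exchange.run s).arr A_inM) = exchanged x y (supp m (s.arr A_inM))
      (supp m (s.arr A_act) \ supp m (s.arr A_inM)) := by
  set M := supp m (s.arr A_inM) with hM
  set Q := supp m (s.arr A_act) \ M with hQ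
  have key : ∀ e < m, ((exchange.run s).arr A_inM e ≠ 0 ↔
      if e < m then e ∈ exchanged x y M Q else e ∈ M) ∧
      (m ≤ e → (exchange.run s).arr A_inM e = s.arr A_inM e) := by
    rw [exchange]
    refine h.loop_edges rfl (fun k t => ∀ e < m, (t.arr A_inM e ≠ 0 ↔
      if e < k then e ∈ exchanged x y M Q else e ∈ M) ∧
      (k ≤ e → t.arr A_inM e = s.arr A_inM e)) (fun e he => ?_) ?_
    · simp [hM, he]
    intro i hi t hti hr ha hP e he
    have tc : t.arr A_cov = s.arr A_cov := ha A_cov rfl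
    have tA : t.arr A_act = s.arr A_act := ha A_act rfl
    have tx : t.arr A_x = x := (ha A_x rfl).trans h.arr_x
    have ty : t.arr A_y = y := (ha A_y rfl).trans h.arr_y
    have hPi := (hP i hi).2 le_rfl
    by_cases hei : e = i
    · subst hei
      have hlt : e < e + 1 := by omega
      refine ⟨?_, fun h' => by omega⟩
      rw [if_pos hlt]
      obtain ⟨hx, hy, -⟩ := h.valid e hi
      have hx := hc _ hx
      have hy := hc _ hy
      by_cases hin : s.arr A_inM e = 0
      · have hnM : e ∉ M := by simp [hM, hin]
        simp [hti, hPi, hin, tA, exchanged, hnM, hQ, hi]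
      · have heM : e ∈ M := by simpa [hM] using ⟨hi, hin⟩
        have heQ : e ∉ Q := by simp [hQ, heM]
        by_cases h0 : s.arr A_cov (x e) + s.arr A_cov (y e) = 0
        · have h1 : x e ∉ ends x y Q := fun h' => hx.2 h' (by omega)
          have h2 : y e ∉ ends x y Q := fun h' => hy.2 h' (by omega)
          have h3 : s.arr A_cov (x e) = 0 ∧ s.arr A_cov (y e) = 0 := by omega
          simp [hti, hPi, hin, tc, tx, ty, h3, exchanged, heM, heQ, h1, h2]
        · have h1 : ¬(x e ∉ ends x y Q ∧ y e ∉ ends x y Q) := by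
            rw [← hx, ← hy]
            omega
          have h3 : ¬(s.arr A_cov (x e) = 0 ∧ s.arr A_cov (y e) = 0) := by omega
          simp only [Cmd.run_ite, Expr.eval, hti, hPi, hin, if_false, tc, tx, ty, h0,
            Cmd.run_store, State.setReg_arr, State.setArr_arr, if_true, Function.update_self,
            exchanged, Finset.mem_union, Finset.mem_filter, h1, heQ]
          simp
    · have hsame : ((Cmd.run (Cmd.ite (Expr.get A_inM (Expr.var R_e))
          (Cmd.ite (Expr.add (Expr.get A_cov (Expr.get A_x (Expr.var R_e)))
            (Expr.get A_cov (Expr.get A_y (Expr.var R_e))))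
            (Cmd.store A_inM (Expr.var R_e) (Expr.const 0)) Cmd.skip)
          (Cmd.store A_inM (Expr.var R_e) (Expr.get A_act (Expr.var R_e)))) t).setReg R_e
          (i + 1)).arr A_inM e = t.arr A_inM e := by
        simp only [Cmd.run_ite, Expr.eval, hti, State.setReg_arr]
        split_ifs <;> simp [hti, hei]
      rw [hsame]
      have hlt : e < i + 1 ↔ e < i := by omega
      simp only [hlt]
      exact ⟨(hP e he).1, fun h' => (hP e he).2 (by omega)⟩
  ext e
  rw [mem_supp]
  constructor
  · rintro ⟨he, h'⟩
    simpa [he] using (key e he).1.1 h'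
  · intro h'
    have he : e < m := by
      rcases Finset.mem_union.1 h' with h'' | h''
      · exact (mem_supp.1 (Finset.mem_of_mem_filter e h'')).1
      · exact (mem_supp.1 (Finset.mem_sdiff.1 h'').1).1
    exact ⟨he, (key e he).1.2 (by simpa [he] using h')⟩

theorem augment_run (h : Stored n m x y s) (hM : IsMatching x y (supp m (s.arr A_inM))) :
    IsMatching x y (supp m ((augment.run s).arr A_inM)) ∧
      ((supp m (s.arr A_inM)).card < (supp m ((augment.run s).arr A_inM)).card ∨
        Certified n x y (Finset.range m) (supp m ((augment.run s).arr A_inM))) := by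
  have h1 : ∀ e < m, (activateAll.run s).arr A_act e ≠ 0 := by
    rw [activateAll]
    refine h.loop_edges rfl (fun k t => ∀ e < k, t.arr A_act e ≠ 0) (by simp) ?_
    intro i hi t hti _ _ hP e he
    by_cases hei : e = i
    · simp [hti, hei]
    · simpa [hti, hei] using hP e (by omega)
  have e1 : (activateAll.run s).arr A_inM = s.arr A_inM := Cmd.run_arr activateAll rfl s
  have hs1 : Stored n m x y (activateAll.run s) := h.run _ rfl
  rw [augment, Cmd.run_seq, Cmd.run_seq, Cmd.run_ite]
  set s₁ := activateAll.run s
  have hA : supp m (s₁.arr A_act) = Finset.range m := by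
    ext e
    simpa using h1 e
  rw [← e1] at hM ⊢
  have h2 := search_run hs1 hM (by rw [hA]; exact Finset.filter_subset _ _)
  have e2 : (search.run s₁).arr A_inM = s₁.arr A_inM := Cmd.run_arr search rfl s₁
  have e2' : (search.run s₁).arr A_act = s₁.arr A_act := Cmd.run_arr search rfl s₁
  have hs2 : Stored n m x y (search.run s₁) := hs1.run _ rfl
  set s₂ := search.run s₁
  rw [← e2] at hM ⊢
  rw [← e2, ← e2'] at h2
  rcases h2 with ⟨hfound, hlarge⟩ | ⟨hfound, hcert⟩
  · simp only [Expr.eval, hfound, if_false, Cmd.run_seq]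
    have h3 := thin_run hs2 hM (by rw [e2']; exact h1) hlarge
    have e3 : (thin.run s₂).arr A_inM = s₂.arr A_inM := Cmd.run_arr thin rfl s₂
    have hs3 : Stored n m x y (thin.run s₂) := hs2.run _ rfl
    set s₃ := thin.run s₂
    rw [← e3] at h3 hM ⊢
    have h4 : ∀ v < n, (resetCover.run s₃).arr A_cov v = 0 := by
      rw [resetCover]
      refine hs3.loop_vertices rfl (fun k t => ∀ v < k, t.arr A_cov v = 0) (by simp) ?_
      intro i hi t hti _ _ hP v hv
      by_cases hvi : v = i
      · simp [hti, hvi]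
      · simpa [hti, hvi] using hP v (by omega)
    have e4 : (resetCover.run s₃).arr A_inM = s₃.arr A_inM := Cmd.run_arr resetCover rfl s₃
    have e4' : (resetCover.run s₃).arr A_act = s₃.arr A_act := Cmd.run_arr resetCover rfl s₃
    have hs4 : Stored n m x y (resetCover.run s₃) := hs3.run _ rfl
    set s₄ := resetCover.run s₃
    have h5 := flagCover_run hs4 h4
    have e5 : (flagCover.run s₄).arr A_inM = s₄.arr A_inM := Cmd.run_arr flagCover rfl s₄
    have e5' : (flagCover.run s₄).arr A_act = s₄.arr A_act := Cmd.run_arr flagCover rfl s₄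
    have hs5 : Stored n m x y (flagCover.run s₄) := hs4.run _ rfl
    set s₅ := flagCover.run s₄
    rw [← e5, ← e5'] at h5
    rw [exchange_run hs5 h5, e5, e5', e4, e4']
    obtain ⟨N, hNA, hN, hc⟩ := h3.larger
    have h6 := exchanged_spec hM hNA hN hc fun e he => h3.forced e he N hNA hN hc
    exact ⟨h6.1, Or.inl h6.2⟩
  · simp only [Expr.eval, hfound, if_true, Cmd.run_skip]
    rw [e2', hA] at hcert
    exact ⟨hM, Or.inr hcert⟩

/-- Every round without a certificate enlarges the matching, whose size is at most `m`, less than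
the number of rounds. A certified matching cannot grow any more. -/
theorem maxMatching_run (h : Stored n m x y s) (h0 : ∀ e < m, s.arr A_inM e = 0) :
    IsMatching x y (supp m ((maxMatching.run s).arr A_inM)) ∧
      Certified n x y (Finset.range m) (supp m ((maxMatching.run s).arr A_inM)) := by
  have hempty : supp m (s.arr A_inM) = ∅ :=
    Finset.filter_eq_empty_iff.2 fun e he => by simp [h0 e (Finset.mem_range.1 he)]
  have key := Cmd.run_loop (x := R_k) (k := 0) (c := augment) rfl s
    (fun k t => IsMatching x y (supp m (t.arr A_inM)) ∧
      (Certified n x y (Finset.range m) (supp m (t.arr A_inM)) ∨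
        k ≤ (supp m (t.arr A_inM)).card)) ?_ ?_
  rotate_left
  · simp [hempty, IsMatching]
  · intro i hi t hti hr ha ⟨hP, hQ⟩
    have ht : Stored n m x y t :=
      h.congr (hr 0 rfl) (hr R_n rfl) (hr R_m rfl) (ha A_x rfl) (ha A_y rfl)
    obtain ⟨g1, g2⟩ := augment_run ht hP
    simp only [State.setReg_arr]
    refine ⟨g1, ?_⟩
    rcases g2 with g2 | g2
    · rcases hQ with hQ | hQ
      · have := hQ.card_le (N := supp m ((augment.run t).arr A_inM))
          (fun e he => h.valid e (Finset.mem_range.1 he))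
          (Finset.filter_subset _ _) g1
        omega
      · right
        omega
    · exact Or.inl g2
  rw [min_self] at key
  refine ⟨key.1, key.2.resolve_right fun hk => ?_⟩
  have h1 := h.lt_reg
  have h2 : (supp m (((Cmd.loop R_k 0 augment).run s).arr A_inM)).card ≤ m :=
    (Finset.card_filter_le _ _).trans (Finset.card_range m).le
  omega

end TwoPM

namespace TwoPM

/-! ### Extending a maximum matching -/

section Programs

open Cmd TwoPM.Expr

/-- Copy the matching `A_inM` to the output, as an indicator. -/
def copyMatching : Cmd :=
  loop R_e R_m (store A_out (var R_e) (lt (const 0) (get A_inM (var R_e))))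

/-- All vertices are alive. -/
def reviveVertices : Cmd := loop R_i R_n (store A_av (var R_i) (const 1))

/-- The edges outside the output set are alive. -/
def reviveEdges : Cmd :=
  loop R_e R_m (store A_ae (var R_e) (eq (get A_out (var R_e)) (const 0)))

/-- Count the alive edges at `R_i`. -/
def countLoop : Cmd :=
  loop R_e R_m
    (ite (get A_ae (var R_e))
      (ite (add (eq (get A_x (var R_e)) (var R_i)) (eq (get A_y (var R_e)) (var R_i)))
        (assign R_cnt (add (var R_cnt) (const 1)) ;; assign R_last (var R_e)) skip)
      skip)

/-- Examine the vertices in turn. -/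
def degreeLoop (test : Expr) : Cmd :=
  loop R_i R_n
    (ite (get A_av (var R_i))
      ((assign R_cnt (const 0) ;; countLoop) ;;
        ite test (assign R_rec (const 1) ;; assign R_v (var R_i) ;; assign R_w (var R_last)) skip)
      skip)

/-- Find an alive vertex whose number of alive edges passes the test. -/
def scanDegree (test : Expr) : Cmd := assign R_rec (const 0) ;; degreeLoop test

/-- Remove a vertex of degree one together with its edge. -/
def peelStep : Cmd :=
  scanDegree (eq (var R_cnt) (const 1)) ;;
    ite (var R_rec) (store A_av (var R_v) (const 0) ;; store A_ae (var R_w) (const 0)) skip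

/-- Remove vertices of degree one as long as there are any. -/
def peel : Cmd := loop R_t 0 peelStep

/-- Add an edge to the output set that covers a new vertex. -/
def extendStep : Cmd :=
  (reviveVertices ;; reviveEdges) ;; peel ;; scanDegree (lt (const 2) (var R_cnt)) ;;
    ite (var R_rec) (store A_out (var R_w) (const 1)) skip

/-- Add edges to the output set as long as possible. -/
def extendLoop : Cmd := loop R_k 0 extendStep

end Programs

variable {n m : ℕ} {x y : ℕ → ℕ} {s : State}

theorem countLoop_run (h : Stored n m x y s) (hc : s.reg R_cnt = 0) :
    (countLoop.run s).reg R_cnt = (inc x y (supp m (s.arr A_ae)) (s.reg R_i)).card ∧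
    ((countLoop.run s).reg R_cnt ≠ 0 →
      (countLoop.run s).reg R_last ∈ inc x y (supp m (s.arr A_ae)) (s.reg R_i)) := by
  set K := inc x y (supp m (s.arr A_ae)) (s.reg R_i) with hK
  have key : (countLoop.run s).reg R_cnt = (K.filter (· < m)).card ∧
      ((countLoop.run s).reg R_cnt ≠ 0 → (countLoop.run s).reg R_last ∈ K) := by
    rw [countLoop]
    refine h.loop_edges rfl (fun k t => t.reg R_cnt = (K.filter (· < k)).card ∧
      (t.reg R_cnt ≠ 0 → t.reg R_last ∈ K)) (by simp [hc]) ?_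
    intro i hi t hti hr ha ⟨hP, hQ⟩
    have tx : t.arr A_x = x := (ha A_x rfl).trans h.arr_x
    have ty : t.arr A_y = y := (ha A_y rfl).trans h.arr_y
    have te : t.arr A_ae = s.arr A_ae := ha A_ae rfl
    have tv : t.reg R_i = s.reg R_i := hr R_i rfl
    have hskip : i ∉ K → K.filter (· < i + 1) = K.filter (· < i) := by
      intro hiK
      refine Finset.filter_congr fun e he => ?_
      have : e ≠ i := fun h' => hiK (h' ▸ he)
      omega
    by_cases h1 : s.arr A_ae i = 0
    · have hiK : i ∉ K := by simp [hK, h1]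
      rw [hskip hiK]
      simpa [te, hti, h1] using ⟨hP, hQ⟩
    by_cases h2 : x i = s.reg R_i ∨ y i = s.reg R_i
    · have hiK : i ∈ K := by simpa [hK] using ⟨⟨hi, h1⟩, h2⟩
      have hins : K.filter (· < i + 1) = insert i (K.filter (· < i)) := by
        ext e
        simp only [Finset.mem_filter, Finset.mem_insert]
        constructor
        · rintro ⟨h3, h4⟩
          rcases Nat.lt_or_ge e i with h5 | h5
          · exact Or.inr ⟨h3, h5⟩
          · exact Or.inl (by omega)
        · rintro (rfl | ⟨h3, h4⟩)
          · exact ⟨hiK, by omega⟩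
          · exact ⟨h3, by omega⟩
      rw [hins, Finset.card_insert_of_notMem (by simp)]
      have h3 : ¬(((if x i = s.reg R_i then 1 else 0) + if y i = s.reg R_i then 1 else 0) = 0) :=
        by rcases h2 with h2 | h2 <;> simp [h2]
      simp only [Cmd.run_ite, Expr.eval, te, hti, h1, if_false, tx, ty, tv, h3, Cmd.run_seq,
        Cmd.run_assign]
      simpa [hP, hti] using hiK
    · have hiK : i ∉ K := by
        simp only [hK, mem_inc]
        tauto
      push Not at h2
      rw [hskip hiK]
      simpa [te, hti, h1, tx, ty, tv, h2.1, h2.2] using ⟨hP, hQ⟩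
  have hall : K.filter (· < m) = K := Finset.filter_true_of_mem fun e he =>
    (mem_supp.1 (mem_inc.1 he).1).1
  rwa [hall] at key

/-- Since the test fails at zero, a vertex that passes has an alive edge, and `R_last` holds one. -/
theorem scanDegree_run (h : Stored n m x y s) {test : Expr} (T : ℕ → Prop)
    (hT : ∀ t : State, test.eval t ≠ 0 ↔ T (t.reg R_cnt)) (hT0 : ¬T 0) :
    ((scanDegree test).run s).reg R_rec = 0 ∧
      (∀ v < n, s.arr A_av v ≠ 0 → ¬T (inc x y (supp m (s.arr A_ae)) v).card) ∨
    ∃ v w, ((scanDegree test).run s).reg R_rec = 1 ∧ ((scanDegree test).run s).reg R_v = v ∧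
      ((scanDegree test).run s).reg R_w = w ∧ v < n ∧ s.arr A_av v ≠ 0 ∧
      T (inc x y (supp m (s.arr A_ae)) v).card ∧ w ∈ inc x y (supp m (s.arr A_ae)) v := by
  rw [scanDegree, Cmd.run_seq, Cmd.run_assign]
  set s₀ := s.setReg R_rec ((Expr.const 0).eval s) with hs₀
  have h0 : Stored n m x y s₀ := h.congr rfl rfl rfl rfl rfl
  rw [degreeLoop]
  refine h0.loop_vertices rfl (fun k t => t.reg R_rec = 0 ∧
      (∀ v < k, s.arr A_av v ≠ 0 → ¬T (inc x y (supp m (s.arr A_ae)) v).card) ∨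
    ∃ v w, t.reg R_rec = 1 ∧ t.reg R_v = v ∧ t.reg R_w = w ∧ v < n ∧ s.arr A_av v ≠ 0 ∧
      T (inc x y (supp m (s.arr A_ae)) v).card ∧ w ∈ inc x y (supp m (s.arr A_ae)) v)
    (by simp [hs₀]) ?_
  intro i hi t hti hr ha hP
  have tav : t.arr A_av = s.arr A_av := ha A_av rfl
  have tae : t.arr A_ae = s.arr A_ae := ha A_ae rfl
  have ht : Stored n m x y t :=
    h0.congr (hr 0 rfl) (hr R_n rfl) (hr R_m rfl) (ha A_x rfl) (ha A_y rfl)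
  by_cases h1 : s.arr A_av i = 0
  · simp only [Cmd.run_ite, Expr.eval, hti, tav, h1, if_true, Cmd.run_skip]
    refine hP.imp (fun hP => ⟨by simpa using hP.1, fun v hv hv' => ?_⟩) fun hP => by simpa using hP
    have : v ≠ i := fun h' => hv' (h' ▸ h1)
    exact hP.2 v (by omega) hv'
  · simp only [Cmd.run_ite, Expr.eval, hti, tav, h1, if_false, Cmd.run_seq, Cmd.run_assign]
    set t₁ := t.setReg R_cnt 0 with ht₁
    have g := countLoop_run (ht.congr rfl rfl rfl rfl rfl : Stored n m x y t₁) (by simp [ht₁])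
    have ei : t₁.reg R_i = i := by simp [ht₁, hti]
    have eae : t₁.arr A_ae = s.arr A_ae := tae
    rw [ei, eae] at g
    have r1 : (countLoop.run t₁).reg R_rec = t.reg R_rec := by
      rw [Cmd.run_reg countLoop rfl]
      simp [ht₁]
    have r2 : (countLoop.run t₁).reg R_v = t.reg R_v := by
      rw [Cmd.run_reg countLoop rfl]
      simp [ht₁]
    have r3 : (countLoop.run t₁).reg R_w = t.reg R_w := by
      rw [Cmd.run_reg countLoop rfl]
      simp [ht₁]
    have r4 : (countLoop.run t₁).reg R_i = i := by
      rw [Cmd.run_reg countLoop rfl]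
      exact ei
    set t₂ := countLoop.run t₁
    by_cases h2 : test.eval t₂ = 0
    · have h3 : ¬T (t₂.reg R_cnt) := fun h' => (hT t₂).2 h' h2
      simp only [h2, if_true]
      refine hP.imp (fun hP => ⟨by simpa [r1] using hP.1, fun v hv hv' => ?_⟩)
        fun hP => by simpa [r1, r2, r3] using hP
      by_cases hvi : v = i
      · rw [hvi, ← g.1]
        exact h3
      · exact hP.2 v (by omega) hv'
    · have h3 : T (t₂.reg R_cnt) := (hT t₂).1 h2
      have h4 : t₂.reg R_cnt ≠ 0 := fun h' => hT0 (h' ▸ h3)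
      simp only [h2, if_false]
      right
      refine ⟨i, t₂.reg R_last, by simp, by simp [r4], by simp, hi, h1, ?_, g.2 h4⟩
      rw [← g.1]
      exact h3

/-- Each round removes an alive vertex unless none of degree one is left, and there are more rounds
than vertices. -/
theorem peel_run (h : Stored n m x y s) {F : Finset ℕ}
    (hp : Peeling n x y F (supp n (s.arr A_av)) (supp m (s.arr A_ae))) :
    Peeling n x y F (supp n ((peel.run s).arr A_av)) (supp m ((peel.run s).arr A_ae)) ∧
      ∀ v ∈ supp n ((peel.run s).arr A_av),
        (inc x y (supp m ((peel.run s).arr A_ae)) v).card ≠ 1 := by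
  have hle : ∀ a, (supp n a).card ≤ n := fun a =>
    (Finset.card_filter_le _ _).trans (Finset.card_range n).le
  have key := Cmd.run_loop (x := R_t) (k := 0) (c := peelStep) rfl s
    (fun k t => Peeling n x y F (supp n (t.arr A_av)) (supp m (t.arr A_ae)) ∧
      ((∀ v ∈ supp n (t.arr A_av), (inc x y (supp m (t.arr A_ae)) v).card ≠ 1) ∨
        (supp n (t.arr A_av)).card + k ≤ n)) ?_ ?_
  rotate_left
  · exact ⟨hp, Or.inr (hle _)⟩
  · intro i hi t hti hr ha ⟨hP, hQ⟩
    have ht : Stored n m x y t :=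
      h.congr (hr 0 rfl) (hr R_n rfl) (hr R_m rfl) (ha A_x rfl) (ha A_y rfl)
    have g := scanDegree_run ht (test := Expr.eq (Expr.var R_cnt) (Expr.const 1)) (· = 1)
      (fun t => by by_cases hc : t.reg R_cnt = 1 <;> simp [hc]) (by simp)
    have e1 : ((scanDegree (Expr.eq (Expr.var R_cnt) (Expr.const 1))).run t).arr A_av =
      t.arr A_av := Cmd.run_arr _ rfl t
    have e2 : ((scanDegree (Expr.eq (Expr.var R_cnt) (Expr.const 1))).run t).arr A_ae =
      t.arr A_ae := Cmd.run_arr _ rfl t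
    simp only [State.setReg_arr]
    rw [peelStep, Cmd.run_seq, Cmd.run_ite]
    set t₁ := (scanDegree (Expr.eq (Expr.var R_cnt) (Expr.const 1))).run t
    rcases g with ⟨g1, g2⟩ | ⟨v, w, g1, g2, g3, g4, g5, g6, g7⟩
    · simp only [Expr.eval, g1, if_true, Cmd.run_skip, e1, e2]
      refine ⟨hP, Or.inl fun v hv => ?_⟩
      rw [mem_supp] at hv
      exact g2 v hv.1 hv.2
    · have hv : v ∈ supp n (t.arr A_av) := mem_supp.2 ⟨g4, g5⟩
      have hinc : inc x y (supp m (t.arr A_ae)) v = {w} := by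
        obtain ⟨a, ha⟩ := Finset.card_eq_one.1 g6
        rw [ha, Finset.mem_singleton] at g7
        rw [ha, g7]
      have ea : supp n (Function.update (t.arr A_av) v 0) = (supp n (t.arr A_av)).erase v := by
        ext u
        by_cases hu : u = v <;> simp [hu]
      have eb : supp m (Function.update (t.arr A_ae) w 0) = (supp m (t.arr A_ae)).erase w := by
        ext u
        by_cases hu : u = w <;> simp [hu]
      have hrun : ((if Expr.eval t₁ (Expr.var R_rec) = 0 then Cmd.skip.run t₁ else
          (Cmd.store A_av (Expr.var R_v) (Expr.const 0) ;;
            Cmd.store A_ae (Expr.var R_w) (Expr.const 0)).run t₁).arr A_av =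
              Function.update (t.arr A_av) v 0) ∧
          ((if Expr.eval t₁ (Expr.var R_rec) = 0 then Cmd.skip.run t₁ else
          (Cmd.store A_av (Expr.var R_v) (Expr.const 0) ;;
            Cmd.store A_ae (Expr.var R_w) (Expr.const 0)).run t₁).arr A_ae =
              Function.update (t.arr A_ae) w 0) := by
        simp [g1, g2, g3, e1, e2]
      rw [hrun.1, hrun.2, ea, eb]
      refine ⟨hP.step hv hinc, Or.inr ?_⟩
      have h1 := Finset.card_erase_add_one hv
      rcases hQ with hQ | hQ
      · exact absurd g6 (hQ v hv)
      · omega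
  rw [min_self] at key
  refine ⟨key.1, key.2.resolve_right fun hk => ?_⟩
  have := h.two_mul_lt
  omega

theorem Saturable.card_le {F : Finset ℕ} (h : Saturable x y (Finset.range n) F) :
    n ≤ F.card := by
  obtain ⟨f, hf, hm⟩ := h
  have := Finset.card_le_card_of_injOn f (fun v hv => (mem_inc.1 (hm v hv)).1) hf
  simpa using this

theorem extendStep_run (h : Stored n m x y s)
    (hd : ∀ v < n, (inc x y (Finset.range m) v).card = 3)
    (hs : Saturable x y (Finset.range n) (Finset.range m \ supp m (s.arr A_out))) :
    ((extendStep.run s).arr A_out = s.arr A_out ∧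
      (Finset.range m \ supp m (s.arr A_out)).card = n) ∨
    ∃ w < m, (extendStep.run s).arr A_out = Function.update (s.arr A_out) w 1 ∧
      w ∉ supp m (s.arr A_out) ∧
      Saturable x y (Finset.range n) ((Finset.range m \ supp m (s.arr A_out)).erase w) ∧
      (ends x y (supp m (s.arr A_out))).card <
        (ends x y (insert w (supp m (s.arr A_out)))).card := by
  set S := supp m (s.arr A_out) with hS
  set F := Finset.range m \ S with hF
  have hFv : ∀ e ∈ F, x e < n ∧ y e < n ∧ x e ≠ y e := fun e he =>
    h.valid e (Finset.mem_range.1 (Finset.mem_sdiff.1 he).1)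
  have h1 : ∀ v < n, (reviveVertices.run s).arr A_av v = 1 := by
    rw [reviveVertices]
    refine h.loop_vertices rfl (fun k t => ∀ v < k, t.arr A_av v = 1) (by simp) ?_
    intro i hi t hti _ _ hP v hv
    by_cases hvi : v = i
    · simp [hti, hvi]
    · simpa [hti, hvi] using hP v (by omega)
  have hs1 : Stored n m x y (reviveVertices.run s) := h.run _ rfl
  have e1 : (reviveVertices.run s).arr A_out = s.arr A_out := Cmd.run_arr reviveVertices rfl s
  rw [extendStep, Cmd.run_seq, Cmd.run_seq, Cmd.run_seq, Cmd.run_seq, Cmd.run_ite]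
  set s₁ := reviveVertices.run s
  have h2 : ∀ e < m, (reviveEdges.run s₁).arr A_ae e = if s.arr A_out e = 0 then 1 else 0 := by
    rw [reviveEdges]
    refine hs1.loop_edges rfl
      (fun k t => ∀ e < k, t.arr A_ae e = if s.arr A_out e = 0 then 1 else 0) (by simp) ?_
    intro i hi t hti _ ha hP e he
    have tout : t.arr A_out = s.arr A_out := (ha A_out rfl).trans e1
    by_cases hei : e = i
    · simp [hti, hei, tout]
    · simpa [hti, hei] using hP e (by omega)
  have hs2 : Stored n m x y (reviveEdges.run s₁) := hs1.run _ rfl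
  have e2 : (reviveEdges.run s₁).arr A_out = s₁.arr A_out := Cmd.run_arr reviveEdges rfl s₁
  have e2' : (reviveEdges.run s₁).arr A_av = s₁.arr A_av := Cmd.run_arr reviveEdges rfl s₁
  set s₂ := reviveEdges.run s₁
  have hV : supp n (s₂.arr A_av) = Finset.range n := by
    ext v
    rw [mem_supp, e2', Finset.mem_range]
    exact ⟨fun h' => h'.1, fun h' => ⟨h', by rw [h1 v h']; exact one_ne_zero⟩⟩
  have hB : supp m (s₂.arr A_ae) = F := by
    ext e
    simp only [hF, hS, mem_supp, Finset.mem_sdiff, Finset.mem_range]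
    refine and_congr_right fun he => ?_
    rw [h2 e he]
    by_cases h0 : s.arr A_out e = 0 <;> simp [h0, he]
  obtain ⟨h3, h4⟩ := peel_run hs2 (F := F) (by rw [hV, hB]; exact Peeling.init hFv hs)
  have hs3 : Stored n m x y (peel.run s₂) := hs2.run _ rfl
  have e3 : (peel.run s₂).arr A_out = s₂.arr A_out := Cmd.run_arr peel rfl s₂
  set s₃ := peel.run s₂
  have g := scanDegree_run hs3 (test := Expr.lt (Expr.const 2) (Expr.var R_cnt)) (2 < ·)
    (fun t => by by_cases hc : 2 < t.reg R_cnt <;> simp [hc]) (by simp)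
  have e4 : ((scanDegree (Expr.lt (Expr.const 2) (Expr.var R_cnt))).run s₃).arr A_out =
    s₃.arr A_out := Cmd.run_arr _ rfl s₃
  set s₄ := (scanDegree (Expr.lt (Expr.const 2) (Expr.var R_cnt))).run s₃
  rcases g with ⟨g1, g2⟩ | ⟨v, w, g1, g2, g3, g4, g5, g6, g7⟩
  · left
    simp only [Expr.eval, g1, if_true, Cmd.run_skip]
    refine ⟨by rw [e4, e3, e2, e1], ?_⟩
    refine h3.card_eq (fun e he => (hFv e he).2.2) h4 fun v hv => ?_
    rw [mem_supp] at hv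
    have := g2 v hv.1 hv.2
    omega
  · right
    have hwB := (mem_inc.1 g7).1
    have hwF := h3.edges hwB
    have hwF' := Finset.mem_sdiff.1 hwF
    refine ⟨w, Finset.mem_range.1 hwF'.1, ?_, hwF'.2,
      h3.saturable_erase (fun e he => (hFv e he).2.2) h4 g6 g7, ?_⟩
    · simp [g1, g3, e4, e3, e2, e1]
    -- Three edges at `v` survive the peeling, which are all its edges. None of them is in the
    -- output set, so `v` is not yet covered.
    · have hinc : inc x y (supp m (s₃.arr A_ae)) v = inc x y (Finset.range m) v := by
        refine Finset.eq_of_subset_of_card_le (inc_mono (h3.edges.trans Finset.sdiff_subset) v) ?_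
        rw [hd v g4]
        exact g6
      have hv : v ∉ ends x y S := by
        intro hv
        obtain ⟨e, he, hve⟩ := mem_ends.1 hv
        have : e ∈ inc x y (Finset.range m) v := mem_inc.2
          ⟨Finset.mem_range.2 (mem_supp.1 he).1, hve.imp Eq.symm Eq.symm⟩
        rw [← hinc] at this
        exact (Finset.mem_sdiff.1 (h3.edges (mem_inc.1 this).1)).2 he
      refine Finset.card_lt_card (Finset.ssubset_iff_of_subset
        (ends_mono (Finset.subset_insert _ _)) |>.2 ⟨v, ?_, hv⟩)
      exact mem_ends.2 ⟨w, Finset.mem_insert_self _ _, (mem_inc.1 g7).2.imp Eq.symm Eq.symm⟩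

/-- Each added edge covers at least one new vertex, so the excess of covered vertices over edges
never falls below its initial bound `r`. The set has at most `m` edges, so more rounds than that
suffice. -/
theorem extendLoop_run (h : Stored n m x y s)
    (hd : ∀ v < n, (inc x y (Finset.range m) v).card = 3)
    (hs : Saturable x y (Finset.range n) (Finset.range m \ supp m (s.arr A_out)))
    (h1 : ∀ e < m, s.arr A_out e ≤ 1) {r : ℕ}
    (hr : r + (supp m (s.arr A_out)).card ≤ (ends x y (supp m (s.arr A_out))).card) :
    Saturable x y (Finset.range n) (Finset.range m \ supp m ((extendLoop.run s).arr A_out)) ∧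
    (∀ e < m, (extendLoop.run s).arr A_out e ≤ 1) ∧
    r + (supp m ((extendLoop.run s).arr A_out)).card ≤
      (ends x y (supp m ((extendLoop.run s).arr A_out))).card ∧
    (Finset.range m \ supp m ((extendLoop.run s).arr A_out)).card = n := by
  have key := Cmd.run_loop (x := R_k) (k := 0) (c := extendStep) rfl s
    (fun k t =>
      Saturable x y (Finset.range n) (Finset.range m \ supp m (t.arr A_out)) ∧
      (∀ e < m, t.arr A_out e ≤ 1) ∧
      r + (supp m (t.arr A_out)).card ≤ (ends x y (supp m (t.arr A_out))).card ∧
      ((Finset.range m \ supp m (t.arr A_out)).card = n ∨ k ≤ (supp m (t.arr A_out)).card)) ?_ ?_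
  rotate_left
  · exact ⟨hs, h1, hr, Or.inr (Nat.zero_le _)⟩
  · intro i hi t hti hr ha ⟨hP, hQ, hR, hT⟩
    have ht : Stored n m x y t :=
      h.congr (hr 0 rfl) (hr R_n rfl) (hr R_m rfl) (ha A_x rfl) (ha A_y rfl)
    simp only [State.setReg_arr]
    rcases extendStep_run ht hd hP with ⟨g1, g2⟩ | ⟨w, hw, g1, g2, g3, g4⟩
    · rw [g1]
      exact ⟨hP, hQ, hR, Or.inl g2⟩
    · have hins : supp m (Function.update (t.arr A_out) w 1) =
          insert w (supp m (t.arr A_out)) := by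
        ext e
        by_cases hew : e = w <;> simp [hew, hw]
      have hset : Finset.range m \ insert w (supp m (t.arr A_out)) =
          (Finset.range m \ supp m (t.arr A_out)).erase w := by
        rw [Finset.sdiff_insert]
      rw [g1, hins, hset, Finset.card_insert_of_notMem g2]
      refine ⟨g3, fun e he => ?_, by omega, ?_⟩
      · rw [Function.update_apply]
        split_ifs
        · exact le_rfl
        · exact hQ e he
      · right
        -- With exactly `n` edges outside the set no further edge can be moved, since saturating `n`
        -- vertices takes `n` edges.
        rcases hT with hT | hT
        · have h2 := g3.card_le
          have h3 := Finset.card_erase_add_one (a := w)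
            (s := Finset.range m \ supp m (t.arr A_out))
            (Finset.mem_sdiff.2 ⟨Finset.mem_range.2 hw, g2⟩)
          omega
        · omega
  rw [min_self] at key
  refine ⟨key.1, key.2.1, key.2.2.1, key.2.2.2.resolve_right fun hk => ?_⟩
  have h2 := h.lt_reg
  have h3 : (supp m (((Cmd.loop R_k 0 extendStep).run s).arr A_out)).card ≤ m :=
    (Finset.card_filter_le _ _).trans (Finset.card_range m).le
  omega

theorem copyMatching_run (h : Stored n m x y s) :
    (∀ e < m, (copyMatching.run s).arr A_out e ≤ 1) ∧
    supp m ((copyMatching.run s).arr A_out) = supp m (s.arr A_inM) := by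
  have key : ∀ e < m, (copyMatching.run s).arr A_out e =
      if 0 < s.arr A_inM e then 1 else 0 := by
    rw [copyMatching]
    refine h.loop_edges rfl
      (fun k t => ∀ e < k, t.arr A_out e = if 0 < s.arr A_inM e then 1 else 0) (by simp) ?_
    intro i hi t hti _ ha hP e he
    have tM : t.arr A_inM = s.arr A_inM := ha A_inM rfl
    by_cases hei : e = i
    · simp [hti, hei, tM]
    · simpa [hti, hei] using hP e (by omega)
  refine ⟨fun e he => ?_, ?_⟩
  · rw [key e he]
    split_ifs <;> omega
  · ext e
    simp only [mem_supp]
    refine and_congr_right fun he => ?_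
    rw [key e he]
    split_ifs <;> omega

/-- In a graph with all degrees three, the complement of a matching is saturable. -/
theorem IsMatching.saturable_compl {M : Finset ℕ} (hM : IsMatching x y M)
    (hv : ∀ e < m, x e ≠ y e) (hd : ∀ v < n, (inc x y (Finset.range m) v).card = 3) :
    Saturable x y (Finset.range n) (Finset.range m \ M) := by
  refine saturable_of_sum (fun e he => hv e (Finset.mem_range.1 (Finset.mem_sdiff.1 he).1))
    fun X hX => ?_
  -- A matching takes at most one of the three edges at a vertex.
  have : ∀ v ∈ X, 2 ≤ (inc x y (Finset.range m \ M) v).card := by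
    intro v hvX
    have h1 : (inc x y M v).card ≤ 1 := by
      refine Finset.card_le_one.2 fun e he f hf => by_contra fun hne => ?_
      rw [mem_inc] at he hf
      obtain ⟨g1, g2, g3, g4⟩ := hM e he.1 f hf.1 hne
      rcases he.2 with a | a <;> rcases hf.2 with b | b
      · exact g1 (a.trans b.symm)
      · exact g2 (a.trans b.symm)
      · exact g3 (a.trans b.symm)
      · exact g4 (a.trans b.symm)
    have h2 : inc x y (Finset.range m) v ⊆ inc x y (Finset.range m \ M) v ∪ inc x y M v := by
      intro e he
      simp only [mem_inc, Finset.mem_union, Finset.mem_sdiff] at he ⊢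
      tauto
    have h3 := (Finset.card_le_card h2).trans (Finset.card_union_le _ _)
    rw [hd v (Finset.mem_range.1 (hX hvX))] at h3
    omega
  have := Finset.sum_le_sum this
  rw [Finset.sum_const, smul_eq_mul] at this
  omega

end TwoPM

namespace TwoPM

/-! ### The values of the solution -/

variable {n m : ℕ} {x y : ℕ → ℕ}

/-- In a graph with all degrees three, a maximum matching covers four fifths of the vertices. -/
theorem Certified.four_mul_le {A M : Finset ℕ} (h : Certified n x y A M)
    (hA : ∀ e ∈ A, x e < n ∧ y e < n ∧ x e ≠ y e) (hd : ∀ v < n, (inc x y A v).card = 3) :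
    4 * n ≤ 10 * M.card := by
  obtain ⟨mate, base, lab, par, dep, hf, hs, hc⟩ := h
  have h1 := hf.five_mul_exposed_le hA hs hd
  have h2 := card_covered_add n mate
  omega

namespace BipGraph

/-- The vertex `b < m` of `B` has exactly the neighbours `x b` and `y b`. -/
structure HasEnds (G : BipGraph n m) (x y : ℕ → ℕ) : Prop where
  adj_iff : ∀ a b, G.adj a b = true ↔ x b = a ∨ y b = a
  valid : ∀ e < m, x e < n ∧ y e < n ∧ x e ≠ y e

variable {G : BipGraph n m}

theorem HasEnds.map_nbhd (h : G.HasEnds x y) (S : Finset (Fin m)) :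
    (G.nbhd S).map Fin.valEmbedding = ends x y (S.map Fin.valEmbedding) := by
  ext v
  simp only [Finset.mem_map, nbhd, Finset.mem_filter, Finset.mem_univ, true_and,
    Fin.valEmbedding_apply, mem_ends, h.adj_iff]
  constructor
  · rintro ⟨a, ⟨b, hb, hab⟩, rfl⟩
    exact ⟨b, ⟨b, hb, rfl⟩, hab.imp Eq.symm Eq.symm⟩
  · rintro ⟨_, ⟨b, hb, rfl⟩, hv⟩
    have hvn : v < n := by
      rcases hv with rfl | rfl
      · exact (h.valid b b.2).1
      · exact (h.valid b b.2).2.1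
    exact ⟨⟨v, hvn⟩, ⟨b, hb, hv.imp Eq.symm Eq.symm⟩, rfl⟩

theorem HasEnds.value2PPM_eq (h : G.HasEnds x y) (S : Finset (Fin m)) :
    G.value2PPM S = (ends x y (S.map Fin.valEmbedding)).card := by
  rw [value2PPM, ← h.map_nbhd, Finset.card_map]

theorem HasEnds.card_inc (h : G.HasEnds x y) (a : Fin n) :
    (inc x y (Finset.range m) a).card = (Finset.univ.filter fun b => G.adj a b = true).card := by
  rw [← Finset.card_map Fin.valEmbedding]
  congr 1
  ext e
  simp only [mem_inc, Finset.mem_range, Finset.mem_map, Finset.mem_filter, Finset.mem_univ,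
    true_and, Fin.valEmbedding_apply, h.adj_iff]
  constructor
  · rintro ⟨he, hv⟩
    exact ⟨⟨e, he⟩, hv, rfl⟩
  · rintro ⟨b, hv, rfl⟩
    exact ⟨b.2, hv⟩

theorem HasEnds.feasible2PPM (h : G.HasEnds x y) {S : Finset (Fin m)}
    (hs : Saturable x y (Finset.range n) (Finset.range m \ S.map Fin.valEmbedding)) :
    G.Feasible2PPM S := by
  obtain ⟨f, hf, hm⟩ := hs
  have hm' : ∀ a : Fin n, (f a < m ∧ f a ∉ S.map Fin.valEmbedding) ∧
      (x (f a) = a ∨ y (f a) = a) := fun a => by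
    simpa only [mem_inc, Finset.mem_sdiff, Finset.mem_range] using
      hm a (Finset.mem_range.2 a.2)
  refine ⟨fun a => ⟨f a, (hm' a).1.1⟩, fun a b hab => ?_, fun a => ⟨?_, fun hS => ?_⟩⟩
  · exact Fin.ext (hf (by simp) (by simp) (Fin.mk.inj_iff.1 hab))
  · exact (h.adj_iff _ _).2 (hm' a).2
  · exact (hm' a).1.2 (Finset.mem_map.2 ⟨_, hS, rfl⟩)

theorem Feasible2PPM.card_add_le {S : Finset (Fin m)} (h : G.Feasible2PPM S) :
    S.card + n ≤ m := by
  obtain ⟨M, hM, hS⟩ := h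
  have h1 : (Finset.univ.image M).card = n := by
    rw [Finset.card_image_of_injective _ hM, Finset.card_univ, Fintype.card_fin]
  have h2 : Disjoint S (Finset.univ.image M) := by
    rw [Finset.disjoint_right]
    intro b hb
    obtain ⟨a, -, rfl⟩ := Finset.mem_image.1 hb
    exact (hS a).2
  have h3 := Finset.card_le_univ (S ∪ Finset.univ.image M)
  rw [Finset.card_union_of_disjoint h2, h1, Fintype.card_fin] at h3
  exact h3

theorem value2PPM_le (S : Finset (Fin m)) : G.value2PPM S ≤ n :=
  (Finset.card_le_univ _).trans (Fintype.card_fin n).le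

theorem opt2PPM_eq {S : Finset (Fin m)} (h : G.Feasible2PPM S)
    (hmax : ∀ T, G.Feasible2PPM T → G.value2PPM T ≤ G.value2PPM S) :
    G.opt2PPM = G.value2PPM S := by
  refine le_antisymm (csSup_le ⟨_, S, h, rfl⟩ ?_) (le_csSup ⟨n, ?_⟩ ⟨S, h, rfl⟩)
  · rintro _ ⟨T, hT, rfl⟩
    exact hmax T hT
  · rintro _ ⟨T, -, rfl⟩
    exact value2PPM_le T

theorem opt2PM_le (G : BipGraph n m) : G.opt2PM ≤ n := by
  refine csSup_le' ?_
  rintro _ ⟨S, W, -, rfl⟩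
  exact (Finset.card_le_univ _).trans (Fintype.card_fin n).le

theorem IsBiregular.mul_eq {d e : ℕ} (h : G.IsBiregular d e) : n * d = m * e := by
  have := Finset.card_mul_eq_card_mul (s := (Finset.univ : Finset (Fin n)))
    (t := (Finset.univ : Finset (Fin m))) (fun a b => G.adj a b = true)
    (fun a _ => h.1 a) (fun b _ => h.2 b)
  simpa using this

/-- A solution extending a maximum matching by edges each of which covers a new vertex is
optimal. -/
theorem HasEnds.optimal (h : G.HasEnds x y) (hG : G.IsBiregular 3 2) {M : Finset ℕ}
    (hM : Certified n x y (Finset.range m) M) {S : Finset (Fin m)}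
    (hs : Saturable x y (Finset.range n) (Finset.range m \ S.map Fin.valEmbedding))
    (hr : M.card + S.card ≤ (ends x y (S.map Fin.valEmbedding)).card)
    (hc : (Finset.range m \ S.map Fin.valEmbedding).card = n) :
    G.Feasible2PPM S ∧ G.value2PPM S = G.opt2PPM ∧ 9 * n ≤ 10 * G.value2PPM S := by
  have hv : ∀ e ∈ Finset.range m, x e < n ∧ y e < n ∧ x e ≠ y e :=
    fun e he => h.valid e (Finset.mem_range.1 he)
  have hnm := hG.mul_eq
  have hcard : S.card + n = m := by
    have hsub : S.map Fin.valEmbedding ⊆ Finset.range m := fun e he => by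
      obtain ⟨b, -, rfl⟩ := Finset.mem_map.1 he
      exact Finset.mem_range.2 b.2
    have := Finset.card_sdiff_add_card_eq_card hsub
    rw [hc, Finset.card_map, Finset.card_range] at this
    omega
  have hfeas := h.feasible2PPM hs
  refine ⟨hfeas, (opt2PPM_eq hfeas fun T hT => ?_).symm, ?_⟩
  -- For feasible `T` this gives |N(T)| ≤ |T| + |N| ≤ (m - n) + |M| = |S| + |M| ≤ |N(S)|.
  · obtain ⟨N, hN, hNm, hNc⟩ := exists_matching_card_ends_le (x := x) (y := y)
      (T.map Fin.valEmbedding)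
    have h1 := hT.card_add_le
    have h2 := hM.card_le hv (hN.trans fun e he => by
      obtain ⟨b, -, rfl⟩ := Finset.mem_map.1 he
      exact Finset.mem_range.2 b.2) hNm
    rw [h.value2PPM_eq, h.value2PPM_eq]
    rw [Finset.card_map] at hNc
    omega
  -- Here 10|M| ≥ 4n, and 10|S| = 10(m - n) = 5n because 2m = 3n.
  · have := hM.four_mul_le hv fun v hvn => by
      rw [h.card_inc ⟨v, hvn⟩, hG.1]
    rw [h.value2PPM_eq]
    omega

end BipGraph

end TwoPM

namespace TwoPM

/-! ### Input and output -/

section Programs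

open Cmd TwoPM.Expr

/-- Read the row `R_i` of the adjacency matrix, starting at the position `R_off`. -/
def readRow : Cmd :=
  loop R_e R_m
    (ite (get 0 (add (var R_off) (var R_e)))
      (store A_y (var R_e) (get A_x (var R_e)) ;; store A_x (var R_e) (var R_i))
      skip)

/-- Read the adjacency matrix. -/
def readRows : Cmd := loop R_i R_n (readRow ;; assign R_off (add (var R_off) (var R_m)))

/-- Read the input. -/
def readInput : Cmd :=
  (assign R_n (get 0 (const 0)) ;; assign R_m (get 0 (const 1)) ;; assign R_off (const 2)) ;;
    readRows

/-- Append the indicator of all vertices to the output. -/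
def writeVertices : Cmd := loop R_i R_n (store A_out (add (var R_m) (var R_i)) (const 1))

/-- The approximation algorithm. -/
def algorithm : Cmd :=
  readInput ;; maxMatching ;; copyMatching ;; extendLoop ;; writeVertices ;;
    assign 1 (add (var R_m) (var R_n))

end Programs

variable {n m : ℕ} {x y : ℕ → ℕ} {s : State}

theorem readRow_run (hm : s.reg R_m = m) (h0 : m ≤ s.reg 0) :
    ∀ b < m,
      (readRow.run s).arr A_x b =
        (if s.arr 0 (s.reg R_off + b) = 0 then s.arr A_x b else s.reg R_i) ∧
      (readRow.run s).arr A_y b =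
        (if s.arr 0 (s.reg R_off + b) = 0 then s.arr A_y b else s.arr A_x b) := by
  have key := Cmd.run_loop (x := R_e) (k := R_m)
    (c := .ite (.get 0 (.add (.var R_off) (.var R_e)))
      (.store A_y (.var R_e) (.get A_x (.var R_e)) ;; .store A_x (.var R_e) (.var R_i))
      .skip) rfl s
    (fun k t => ∀ b < m,
      t.arr A_x b = (if k ≤ b ∨ s.arr 0 (s.reg R_off + b) = 0 then s.arr A_x b else s.reg R_i) ∧
      t.arr A_y b = (if k ≤ b ∨ s.arr 0 (s.reg R_off + b) = 0 then s.arr A_y b else s.arr A_x b))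
    ?_ ?_
  · rw [hm, min_eq_left h0] at key
    intro b hb
    have h1 := key b hb
    simp only [Nat.not_le.2 hb, false_or] at h1
    exact h1
  · simp
  · intro i hi t hti hr ha hP b hb
    have r1 : t.reg R_off = s.reg R_off := hr _ rfl
    have r2 : t.reg R_i = s.reg R_i := hr _ rfl
    have a0 : t.arr 0 = s.arr 0 := ha _ rfl
    obtain ⟨p1, p2⟩ := hP b hb
    simp only [State.setReg_arr, Cmd.run_ite, Expr.eval, r1, a0, hti]
    by_cases hz : s.arr 0 (s.reg R_off + i) = 0
    · rw [if_pos hz, Cmd.run_skip, p1, p2]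
      by_cases hbi : b = i
      · subst hbi
        simp [hz]
      · have : i + 1 ≤ b ↔ i ≤ b := by omega
        simp [this]
    · rw [if_neg hz]
      by_cases hbi : b = i
      · subst hbi
        have h1 : t.arr A_x b = s.arr A_x b := by simpa using p1
        simp [hz, hti, h1, r2]
      · have : i + 1 ≤ b ↔ i ≤ b := by omega
        simp [this, hti, hbi, p1, p2]

/-- Each nonzero entry of a column moves the content of `A_x` to `A_y` and stores the row number in
`A_x`. With neighbours p < q, the row p is first stored and then pushed to `A_y` by the row q. The
row offset is advanced by addition, as the machine has no multiplication. -/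
theorem readRows_run (hn : s.reg R_n = n) (hm : s.reg R_m = m) (hn0 : n ≤ s.reg 0)
    (hm0 : m ≤ s.reg 0) (ho : s.reg R_off = 2) {p q : ℕ → ℕ}
    (hpq : ∀ b < m, p b < q b ∧ q b < n)
    (hadj : ∀ a < n, ∀ b < m, s.arr 0 (2 + a * m + b) ≠ 0 ↔ a = p b ∨ a = q b) :
    ∀ b < m, (readRows.run s).arr A_x b = q b ∧ (readRows.run s).arr A_y b = p b := by
  have key := Cmd.run_loop (x := R_i) (k := R_n)
    (c := readRow ;; .assign R_off (.add (.var R_off) (.var R_m))) rfl s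
    (fun k t => t.reg R_off = 2 + k * m ∧ ∀ b < m, (p b < k → k ≤ q b → t.arr A_x b = p b) ∧
      (q b < k → t.arr A_x b = q b ∧ t.arr A_y b = p b)) ?_ ?_
  · rw [hn, min_eq_left hn0] at key
    exact fun b hb => (key.2 b hb).2 (hpq b hb).2
  · simp [ho]
  · intro i hi t hti hr ha ⟨hoff, hP⟩
    have hin : i < n := by omega
    have r0 : t.reg 0 = s.reg 0 := hr _ rfl
    have rm : t.reg R_m = m := (hr _ rfl).trans hm
    have a0 : t.arr 0 = s.arr 0 := ha _ rfl
    have g := readRow_run rm (by omega)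
    have e1 : (readRow.run t).reg R_off = t.reg R_off := Cmd.run_reg _ rfl t
    have e2 : (readRow.run t).reg R_m = t.reg R_m := Cmd.run_reg _ rfl t
    rw [Cmd.run_seq, Cmd.run_assign]
    simp only [State.setReg_arr]
    refine ⟨?_, fun b hb => ?_⟩
    · simp [e1, e2, hoff, rm]
      ring
    · obtain ⟨g1, g2⟩ := g b hb
      obtain ⟨h1, h2⟩ := hP b hb
      have h3 := hpq b hb
      have h4 := hadj i hin b hb
      rw [hoff, a0, hti] at g1
      rw [hoff, a0] at g2
      rw [g1, g2]
      by_cases hz : s.arr 0 (2 + i * m + b) = 0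
      · rw [if_pos hz, if_pos hz]
        have h5 : ¬(i = p b ∨ i = q b) := fun h => h4.2 h hz
        exact ⟨fun _ _ => h1 (by omega) (by omega), fun _ => h2 (by omega)⟩
      · rw [if_neg hz, if_neg hz]
        have h5 := h4.1 hz
        exact ⟨fun _ _ => by omega, fun _ => ⟨by omega, h1 (by omega) (by omega)⟩⟩

namespace BipGraph

variable {G : BipGraph n m}

theorem length_encode (G : BipGraph n m) : G.encode.length = n * m + 2 := by
  simp [encode]

theorem encode_getD (a : Fin n) (b : Fin m) :
    G.encode.getD (2 + a * m + b) 0 = (G.adj a b).toNat := by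
  have h1 : (a : ℕ) * m + b < n * m := by
    calc (a : ℕ) * m + b < a * m + m := by omega
      _ = (a + 1) * m := by ring
      _ ≤ n * m := Nat.mul_le_mul_right _ a.2
  have h2 : 2 + (a : ℕ) * m + b = a * m + b + 1 + 1 := by omega
  rw [encode, h2, List.getD_cons_succ, List.getD_cons_succ, List.getD_eq_getElem _ _ (by simpa)]
  rw [List.getElem_ofFn]
  congr 2
  · ext
    simp only [Fin.coe_divNat]
    rw [mul_comm, Nat.mul_add_div (by omega), Nat.div_eq_of_lt b.2, add_zero]
  · ext
    simp only [Fin.coe_modNat]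
    rw [mul_comm, Nat.mul_add_mod, Nat.mod_eq_of_lt b.2]

/-- This makes the input length `n * m + 2` exceed both `2 * n` and `m`, as the capped loops
require. For positive `n`, 3n = 2m forces m ≥ 2. -/
theorem IsBiregular.bounds (h : G.IsBiregular 3 2) : 2 * n ≤ n * m ∧ m ≤ n * m := by
  have h1 := h.mul_eq
  rcases Nat.eq_zero_or_pos n with rfl | hn
  · omega
  · refine ⟨?_, Nat.le_mul_of_pos_left _ hn⟩
    rw [mul_comm]
    exact Nat.mul_le_mul_left _ (by omega)

theorem IsBiregular.exists_ends {d : ℕ} (h : G.IsBiregular d 2) :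
    ∃ p q : ℕ → ℕ, (∀ b < m, p b < q b ∧ q b < n) ∧
      ∀ (a : Fin n) (b : Fin m), G.adj a b = true ↔ (a : ℕ) = p b ∨ (a : ℕ) = q b := by
  have key : ∀ b : Fin m, ∃ c d : Fin n, c < d ∧ ∀ a, G.adj a b = true ↔ a = c ∨ a = d := by
    intro b
    obtain ⟨c, d, hcd, he⟩ := Finset.card_eq_two.1 (h.2 b)
    have he' : ∀ a, G.adj a b = true ↔ a = c ∨ a = d := fun a => by
      simpa using Finset.ext_iff.1 he a
    rcases lt_or_gt_of_ne hcd with hlt | hlt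
    · exact ⟨c, d, hlt, he'⟩
    · exact ⟨d, c, hlt, fun a => (he' a).trans or_comm⟩
  choose c d hcd hadj using key
  refine ⟨fun b => if hb : b < m then c ⟨b, hb⟩ else 0,
    fun b => if hb : b < m then d ⟨b, hb⟩ else 0, fun b hb => ?_, fun a b => ?_⟩
  · simp only [hb, dif_pos]
    exact ⟨hcd _, (d _).2⟩
  · simp [hadj, Fin.ext_iff]

theorem IsBiregular.readInput_run (h : G.IsBiregular 3 2) :
    ∃ x y, G.HasEnds x y ∧ Stored n m x y (readInput.run (State.init G.encode)) := by
  obtain ⟨p, q, hpq, hadj⟩ := h.exists_ends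
  obtain ⟨b1, b2⟩ := h.bounds
  have hlen := G.length_encode
  set s := State.init G.encode with hs
  have s0 : s.reg 0 = n * m + 2 := by simp [hs, State.init, hlen]
  set s₁ := (Cmd.assign R_n (.get 0 (.const 0)) ;; .assign R_m (.get 0 (.const 1)) ;;
    .assign R_off (.const 2)).run s with hs₁
  have t0 : s₁.reg 0 = n * m + 2 := by simp [hs₁, s0]
  have tn : s₁.reg R_n = n := by simp [hs₁, hs, State.init, encode]
  have tm : s₁.reg R_m = m := by simp [hs₁, hs, State.init, encode]
  have tf : s₁.reg R_off = 2 := by simp [hs₁]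
  have ta : s₁.arr 0 = s.arr 0 := by simp [hs₁]
  have key := readRows_run tn tm (by omega) (by omega) tf hpq fun a ha b hb => by
    rw [ta, hs, ← hadj ⟨a, ha⟩ ⟨b, hb⟩]
    simp only [State.init, if_true]
    rw [G.encode_getD ⟨a, ha⟩ ⟨b, hb⟩]
    cases G.adj ⟨a, ha⟩ ⟨b, hb⟩ <;> simp
  have hrun : readInput.run s = readRows.run s₁ := rfl
  rw [hrun]
  have hvalid : ∀ e < m, (readRows.run s₁).arr A_x e < n ∧ (readRows.run s₁).arr A_y e < n ∧
      (readRows.run s₁).arr A_x e ≠ (readRows.run s₁).arr A_y e := fun e he => by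
    rw [(key e he).1, (key e he).2]
    have := hpq e he
    omega
  refine ⟨_, _, ⟨fun a b => ?_, hvalid⟩, (Cmd.run_reg readRows rfl s₁).trans tn,
    (Cmd.run_reg readRows rfl s₁).trans tm, rfl, rfl, ?_, ?_, hvalid⟩
  · rw [hadj, (key b b.2).1, (key b b.2).2, or_comm, eq_comm (b := q b), eq_comm (b := p b)]
  · rw [Cmd.run_reg readRows rfl s₁]
    omega
  · rw [Cmd.run_reg readRows rfl s₁]
    omega

end BipGraph

theorem writeVertices_run (h : Stored n m x y s) :
    ∀ i < m + n, (writeVertices.run s).arr A_out i = if i < m then s.arr A_out i else 1 := by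
  have key : ∀ i < m + n, (writeVertices.run s).arr A_out i =
      if i < m then s.arr A_out i else if i < m + n then 1 else s.arr A_out i := by
    rw [writeVertices]
    refine h.loop_vertices rfl (fun k t => ∀ i < m + n, t.arr A_out i =
      if i < m then s.arr A_out i else if i < m + k then 1 else s.arr A_out i) ?_ ?_
    · intro i _
      simp only [State.setReg_arr, add_zero]
      split_ifs <;> rfl
    · intro i hi t hti hr _ hP j hj
      have rm : t.reg R_m = m := (hr _ rfl).trans h.reg_m
      by_cases hji : j = m + i
      · simp [hti, rm, hji]
      · have h1 : j < m + (i + 1) ↔ j < m + i := by omega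
        simp [hti, rm, hji, hP j hj, h1]
  intro i hi
  rw [key i hi, if_pos hi]

theorem indicator_eq_map (S : Finset (Fin m)) {f : ℕ → ℕ}
    (h : ∀ b : Fin m, f b = if b ∈ S then 1 else 0) :
    indicator S = (List.range m).map f := by
  refine List.ext_getElem (by simp [indicator]) fun i h1 h2 => ?_
  simp [indicator, ← h]

/-- The algorithm outputs an optimal solution. -/
theorem BipGraph.IsBiregular.algorithm_run {G : BipGraph n m} (hG : G.IsBiregular 3 2) :
    ∃ S : Finset (Fin m),
      (algorithm.run (State.init G.encode)).output =
        encodeSolution S (Finset.univ : Finset (Fin n)) ∧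
      G.Feasible2PPM S ∧ G.value2PPM S = G.opt2PPM ∧ 9 * n ≤ 10 * G.value2PPM S := by
  obtain ⟨x, y, he, h₁⟩ := hG.readInput_run
  have hd : ∀ v < n, (inc x y (Finset.range m) v).card = 3 := fun v hv => by
    rw [he.card_inc ⟨v, hv⟩, hG.1]
  have i1 : (readInput.run (State.init G.encode)).arr A_inM =
    (State.init G.encode).arr A_inM := Cmd.run_arr readInput rfl _
  simp only [algorithm, Cmd.run_seq]
  set s₁ := readInput.run (State.init G.encode)
  obtain ⟨hM, hcert⟩ := maxMatching_run h₁ fun e _ => by rw [i1]; simp [State.init]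
  have h₂ : Stored n m x y (maxMatching.run s₁) := h₁.run _ rfl
  set s₂ := maxMatching.run s₁
  obtain ⟨c1, c2⟩ := copyMatching_run h₂
  have h₃ : Stored n m x y (copyMatching.run s₂) := h₂.run _ rfl
  set s₃ := copyMatching.run s₂
  set M := supp m (s₂.arr A_inM) with hMdef
  have hMends := hM.card_ends fun e he' => (he.valid e (mem_supp.1 he').1).2.2
  -- The initial set is the matching itself with 2|M| covered vertices, so its excess is |M|.
  obtain ⟨k1, k2, k3, k4⟩ := extendLoop_run h₃ hd
    (by rw [c2]; exact hM.saturable_compl (fun e he' => (he.valid e he').2.2) hd) c1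
    (r := M.card) (by rw [c2]; omega)
  have h₄ : Stored n m x y (extendLoop.run s₃) := h₃.run _ rfl
  set s₄ := extendLoop.run s₃
  have w := writeVertices_run h₄
  have h₅ : Stored n m x y (writeVertices.run s₄) := h₄.run _ rfl
  set s₅ := writeVertices.run s₄
  clear_value s₅ s₄ s₃ s₂ s₁
  set S : Finset (Fin m) := Finset.univ.filter fun b => s₄.arr A_out b ≠ 0 with hS
  have hmap : S.map Fin.valEmbedding = supp m (s₄.arr A_out) := by
    ext e
    simp only [Finset.mem_map, hS, Finset.mem_filter, Finset.mem_univ, true_and,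
      Fin.valEmbedding_apply, mem_supp]
    constructor
    · rintro ⟨b, hb, rfl⟩
      exact ⟨b.2, hb⟩
    · rintro ⟨hem, hne⟩
      exact ⟨⟨e, hem⟩, hne, rfl⟩
  have hcard : S.card = (supp m (s₄.arr A_out)).card := by
    rw [← hmap, Finset.card_map]
  refine ⟨S, ?_, he.optimal hG hcert (hmap ▸ k1) (by rw [hmap, hcard]; exact k3)
    (hmap ▸ k4)⟩
  have hreg : (s₅.setReg 1 (s₅.reg R_m + s₅.reg R_n)).reg 1 = m + n := by
    rw [State.setReg_reg_self, h₅.reg_m, h₅.reg_n]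
  rw [Cmd.run_assign, State.output]
  simp only [Expr.eval]
  rw [hreg, State.setReg_arr, List.range_add, List.map_append, encodeSolution, List.map_map]
  congr 1
  · refine (indicator_eq_map S fun b => ?_).symm
    have h1 := k2 b b.2
    rw [w b (by omega), if_pos b.2]
    simp only [hS, Finset.mem_filter, Finset.mem_univ, true_and]
    split_ifs <;> omega
  · refine (indicator_eq_map _ fun a => ?_).symm
    simp [w (m + a) (by omega)]

end TwoPM

/-! ### Running time in the input size, and the main theorem -/

namespace TwoPM

/-- The time bound is a polynomial in the length of the list. Each entry contributes at least its
separator to the size. -/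
theorem length_le_inputSize (l : List ℕ) : l.length ≤ inputSize l := by
  induction l with
  | nil => simp [inputSize]
  | cons a l ih =>
    simp only [inputSize, List.map_cons, List.sum_cons, List.length_cons] at ih ⊢
    omega

theorem eval_mono (q : Polynomial ℕ) {a b : ℕ} (h : a ≤ b) : q.eval a ≤ q.eval b := by
  simp only [Polynomial.eval_eq_sum, Polynomial.sum]
  exact Finset.sum_le_sum fun i _ => Nat.mul_le_mul_left _ (Nat.pow_le_pow_left h i)

/-- The algorithm halts within polynomial time. -/
theorem algorithm_outputsWithin (l : List ℕ) :
    OutputsWithin algorithm.toProg l (algorithm.run (State.init l)).output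
      (algorithm.time.eval (inputSize l)) := by
  obtain ⟨t, ht, he⟩ := Cmd.exists_exec algorithm rfl (State.init l)
  refine ⟨_, t, he, ht.trans (eval_mono _ ?_), rfl⟩
  simpa [State.init] using length_le_inputSize l

theorem BipGraph.Feasible2PPM.feasible2PM {n m : ℕ} {G : BipGraph n m} {S : Finset (Fin m)}
    (h : G.Feasible2PPM S) : G.Feasible2PM S Finset.univ := by
  obtain ⟨M, hM, hS⟩ := h
  exact ⟨M, hM.injOn, fun a _ => hS a⟩

end TwoPM

theorem mainTheorem3 :
    ∃ (p : TwoPM.Prog) (q : Polynomial ℕ),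
      ∀ (n m : ℕ) (G : TwoPM.BipGraph n m), G.IsBiregular 3 2 →
        ∃ (S : Finset (Fin m)) (W : Finset (Fin n)),
          TwoPM.OutputsWithin p G.encode (TwoPM.encodeSolution S W)
            (q.eval (TwoPM.inputSize G.encode)) ∧
          G.Feasible2PM S W ∧
          (9 / 10 : ℝ) * (G.opt2PM : ℝ) ≤ (G.value2PM S W : ℝ) ∧
          W = Finset.univ ∧
          G.Feasible2PPM S ∧
          G.value2PPM S = G.opt2PPM ∧
          (9 / 10 : ℝ) * (n : ℝ) ≤ (G.opt2PPM : ℝ) ∧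
          (9 / 10 : ℝ) * (G.opt2PM : ℝ) ≤ (9 / 10 : ℝ) * (n : ℝ) := by
  refine ⟨TwoPM.algorithm.toProg, TwoPM.algorithm.time, fun n m G hG => ?_⟩
  obtain ⟨S, hout, hfeas, hopt, hval⟩ := hG.algorithm_run
  have h1 : (G.opt2PM : ℝ) ≤ n := by exact_mod_cast G.opt2PM_le
  have h2 : (9 : ℝ) * n ≤ 10 * G.value2PPM S := by exact_mod_cast hval
  -- With W = A the two objectives agree, and `opt2PM` is compared with the trivial bound `n` only.
  have h3 : G.value2PM S Finset.univ = G.value2PPM S := by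
    rw [TwoPM.BipGraph.value2PM, Finset.inter_univ, TwoPM.BipGraph.value2PPM]
  refine ⟨S, Finset.univ, ?_, hfeas.feasible2PM, ?_, rfl, hfeas, hopt, ?_, ?_⟩
  · rw [← hout]
    exact TwoPM.algorithm_outputsWithin G.encode
  · rw [h3]
    linarith
  · rw [← hopt]
    linarith
  · linarith
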